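/- \textbf{Setting.} An \emph{mm-space} is a complete separable metric space $X$ of diameter at most $1$ with a Borel probability measure $\mu_X$ of full support; $\chi$ is the set of mm-spaces up to measure-preserving isometry. Let $M_\infty$ be the compact space (product topology) of matrices $(d_{ij})_{i,j\ge 1}$ with $0\le d_{ij}\le 1$, $d_{ij}=d_{ji}$, $d_{ii}=0$. For an mm-space $X$ let $\tau(X)\in\mathcal P(M_\infty)$ be the law of $(d_X(x_i,x_j))_{i,j}$, where $x_1,x_2,\dots$ are independent $\mu_X$-random points, and let $\overline\chi$ be the closure of $\tau(\chi)$ in $\mathcal P(M_\infty)$ for the weak topology; $\chi$ is identified with $\tau(\chi)\subset\overline\chi$. A \emph{qmm-space} $(X,\mu,d^*)$ is a standard Borel probability space with a Borel map $d^*:X\times X\to\mathcal P[0,1]$ such that $d^*(x,x)=\delta_0$, $d^*(x,y)=d^*(y,x)$, and for $\mu^3$-almost every $(a,b,c)$ independent random lengths with laws $d^*(a,b)$, $d^*(b,c)$, $d^*(a,c)$ almost surely satisfy the triangle inequalities. Its sampling measure $\tau(X)\in\mathcal P(M_\infty)$ is the law of the random matrix obtained by choosing independent $\mu$-random points $x_1,x_2,\dots$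 and then, independently for all $i<j$, entries $d_{ij}=d_{ji}$ with law $d^*(x_i,x_j)$ (and $d_{ii}=0$). Let $Y$ be a compact metric space and $0<\kappa<1$. For $\nu\in\mathcal P(Y)$ let $diam(\nu,\kappa)$ be the infimum of the diameters of the Borel sets $Y_0\subset Y$ with $\nu(Y_0)\ge 1-\kappa$. For an mm-space $X$, $Lip_1(X,Y)$ is the set of $1$-Lipschitz maps $X\to Y$; for a qmm-space $(X,\mu,d^*)$, $Lip_1(X,Y)$ is the set of measurable maps $f:X\to Y$ with $d_Y(f(x_1),f(x_2))\le\,\downarrow\! d^*(x_1,x_2)$ for $\mu\times\mu$-almost all $(x_1,x_2)$, where $\downarrow\!\nu$ is the infimum of the support of $\nu\in\mathcal P[0,1]$. In both cases $$ObsDiam_Y(X,\kappa)=\sup_{f\in Lip_1(X,Y)} diam(f_*\mu_X,\kappa).$$ \textbf{Theorem.} For every compact metric space $Y$, the functions $ObsDiam_Y(\cdot,\kappa)$, $0<\kappa<1$, extend from $\chi$ to $\overline\chi$ through qmm-spaces in an essentially upper semicontinuous way. That is, every $\zeta\in\overline\chi$ equals $\tau(X)$ for some qmm-space $X$, $\tau(X)\in\overline\chi$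 for every qmm-space $X$, and there is a function $(\zeta,\kappa)\mapsto ObsDiam_Y(\zeta,\kappa)$ on $\overline\chi\times(0,1)$ such that \begin{enumerate} \item $ObsDiam_Y(\tau(X),\kappa)=ObsDiam_Y(X,\kappa)$ for every mm-space $X$ and $0<\kappa<1$; \item $ObsDiam_Y(\tau(X),\kappa)=ObsDiam_Y(X,\kappa)$ for every qmm-space $X$ and $0<\kappa<1$; \item if $\zeta_n\to\zeta$ weakly in $\overline\chi$ and $0<\kappa'<\kappa<1$, then $$\limsup_{n\to\infty} ObsDiam_Y(\zeta_n,\kappa)\le ObsDiam_Y(\zeta,\kappa').$$ \end{enumerate} -/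

import Mathlib

open MeasureTheory ProbabilityTheory Filter Topology
open scoped ENNReal unitInterval

noncomputable section

/-- The compact space `M_∞` of infinite symmetric matrices with entries in `[0,1]` and zero
diagonal, with the product topology and its Borel σ-algebra. -/
abbrev DistMatrix : Type :=
  {d : ℕ → ℕ → I // (∀ i j, d i j = d j i) ∧ ∀ i, d i i = 0}

/-- An mm-space: a complete separable metric space of diameter at most one with a Borel
probability measure of full support. (Every such space has a copy in `Type`.) -/
structure MMSpace where
  carrier : Type
  [metricSpace : MetricSpace carrier]
  [completeSpace : CompleteSpace carrier]
  [separableSpace : TopologicalSpace.SeparableSpace carrier]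
  [measurableSpace : MeasurableSpace carrier]
  [borelSpace : BorelSpace carrier]
  dist_le_one : ∀ x y : carrier, dist x y ≤ 1
  μ : Measure carrier
  [isProbabilityMeasure : IsProbabilityMeasure μ]
  [fullSupport : μ.IsOpenPosMeasure]

attribute [instance] MMSpace.metricSpace MMSpace.completeSpace MMSpace.separableSpace
  MMSpace.measurableSpace MMSpace.borelSpace MMSpace.isProbabilityMeasure MMSpace.fullSupport

/-- A quantum metric measure space: a standard Borel probability space with a measurable
`P[0,1]`-valued (that is, Markov kernel) distance. -/
structure QMMSpace where
  carrier : Type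
  [measurableSpace : MeasurableSpace carrier]
  [standardBorelSpace : StandardBorelSpace carrier]
  μ : Measure carrier
  [isProbabilityMeasure : IsProbabilityMeasure μ]
  dStar : Kernel (carrier × carrier) I
  [isMarkovKernel : IsMarkovKernel dStar]
  dStar_self : ∀ x, dStar (x, x) = Measure.dirac 0
  dStar_comm : ∀ x y, dStar (x, y) = dStar (y, x)
  /-- For almost all triples `(a, b, c)`, independent random lengths `l(a,b)`, `l(b,c)`, `l(a,c)`
  almost surely satisfy the triangle inequalities. -/
  triangle : ∀ᵐ p ∂(μ.prod (μ.prod μ)),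
    ∀ᵐ l ∂((dStar (p.1, p.2.1)).prod ((dStar (p.2.1, p.2.2)).prod (dStar (p.1, p.2.2)))),
      (l.2.2 : ℝ) ≤ l.1 + l.2.1 ∧ (l.1 : ℝ) ≤ l.2.1 + l.2.2 ∧ (l.2.1 : ℝ) ≤ l.1 + l.2.2

attribute [instance] QMMSpace.measurableSpace QMMSpace.standardBorelSpace
  QMMSpace.isProbabilityMeasure QMMSpace.isMarkovKernel

namespace MMSpace

/-- The matrix of mutual distances of a sequence of points. -/
def distMatrix (X : MMSpace) (x : ℕ → X.carrier) : DistMatrix :=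
  ⟨fun i j => ⟨dist (x i) (x j), dist_nonneg, X.dist_le_one _ _⟩,
    fun _ _ => Subtype.ext (dist_comm _ _), fun _ => Subtype.ext (dist_self _)⟩

theorem measurable_distMatrix (X : MMSpace) : Measurable X.distMatrix := by
  have : SecondCountableTopology X.carrier := UniformSpace.secondCountable_of_separable _
  refine Measurable.subtype_mk ?_
  refine measurable_pi_lambda _ fun i => measurable_pi_lambda _ fun j => ?_
  refine Measurable.subtype_mk ?_
  exact (measurable_pi_apply i).dist (measurable_pi_apply j)

/-- The sampling measure `τ(X)` on `M_∞`: the law of the distance matrix of a sequence of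
independent `μ`-random points. -/
def sampling (X : MMSpace) : ProbabilityMeasure DistMatrix :=
  ⟨(Measure.infinitePi fun _ : ℕ => X.μ).map X.distMatrix,
    Measure.isProbabilityMeasure_map X.measurable_distMatrix.aemeasurable⟩

end MMSpace

/-- The compactification `χ̄`: the weak closure of the sampling measures of all mm-spaces. -/
def ChiBar : Set (ProbabilityMeasure DistMatrix) :=
  closure (Set.range MMSpace.sampling)

/-- The symmetric matrix with zero diagonal whose entry at `i < j` is `ω (i, j)`. -/
def symmMatrix (ω : ℕ × ℕ → I) : DistMatrix :=
  ⟨fun i j => if i = j then 0 else ω (min i j, max i j),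
    fun i j => by simp only [eq_comm, min_comm, max_comm], fun i => by simp⟩

theorem measurable_symmMatrix : Measurable symmMatrix := by
  refine Measurable.subtype_mk ?_
  refine measurable_pi_lambda _ fun i => measurable_pi_lambda _ fun j => ?_
  by_cases h : i = j
  · simp [h]
  · simpa [h] using measurable_pi_apply _

namespace QMMSpace

/-- For a sequence of points `x`, the law on `M_∞` of the random matrix whose entries at the
positions `i < j` are independent with laws `d*(x i, x j)`. -/
def matrixLaw (X : QMMSpace) (x : ℕ → X.carrier) : Measure DistMatrix :=
  (Measure.infinitePi fun p : ℕ × ℕ => X.dStar (x p.1, x p.2)).map symmMatrix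

instance (X : QMMSpace) (x : ℕ → X.carrier) : IsProbabilityMeasure (X.matrixLaw x) :=
  Measure.isProbabilityMeasure_map measurable_symmMatrix.aemeasurable

theorem measurable_matrixLaw (X : QMMSpace) : Measurable X.matrixLaw := by
  refine (Measure.measurable_map _ measurable_symmMatrix).comp ?_
  refine Measurable.measure_of_isPiSystem_of_isProbabilityMeasure
    (generateFrom_squareCylinders (α := fun _ : ℕ × ℕ => I)).symm
    (isPiSystem_squareCylinders (fun _ => MeasurableSpace.isPiSystem_measurableSet)
      (fun _ => MeasurableSet.univ (α := I))) ?_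
  rintro _ ⟨s, t, ht, rfl⟩
  have h : ∀ x : ℕ → X.carrier,
      (Measure.infinitePi fun p : ℕ × ℕ => X.dStar (x p.1, x p.2)) ((s : Set (ℕ × ℕ)).pi t) =
        ∏ p ∈ s, X.dStar (x p.1, x p.2) (t p) := fun x =>
    Measure.infinitePi_pi _ fun p _ => ht p (Set.mem_univ p)
  simp only [h]
  refine Finset.measurable_prod _ fun p _ => ?_
  refine (X.dStar.measurable_coe (ht p (Set.mem_univ p))).comp ?_
  exact (measurable_pi_apply p.1).prodMk (measurable_pi_apply p.2)

/-- The sampling measure `τ(X)` on `M_∞`: the barycenter (mixture) of the laws `matrixLaw x`,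
where `x` is a sequence of independent `μ`-random points. -/
def sampling (X : QMMSpace) : ProbabilityMeasure DistMatrix :=
  ⟨(Measure.infinitePi fun _ : ℕ => X.μ).bind X.matrixLaw,
    isProbabilityMeasure_bind X.measurable_matrixLaw.aemeasurable
      (Eventually.of_forall fun _ => inferInstance)⟩

end QMMSpace

/-- The infimum `↓ν` of the support of a probability measure on `[0,1]`. -/
def lowerEnd (ν : Measure I) : ℝ :=
  sInf ((fun t : I => (t : ℝ)) '' ν.support)

/-- The `1`-Lipschitz maps from a qmm-space to a metric space. -/
def QMMSpace.Lip1 (X : QMMSpace) (Y : Type*) [MetricSpace Y] [MeasurableSpace Y] :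
    Set (X.carrier → Y) :=
  {f | Measurable f ∧ ∀ᵐ p ∂(X.μ.prod X.μ), dist (f p.1) (f p.2) ≤ lowerEnd (X.dStar p)}

/-- The partial diameter `diam(ν, κ)`: the infimum of the diameters of the measurable sets of
`ν`-measure at least `1 - κ`. -/
def partialDiam {Y : Type*} [MetricSpace Y] [MeasurableSpace Y] (ν : Measure Y) (κ : ℝ) : ℝ≥0∞ :=
  ⨅ (A : Set Y) (_ : MeasurableSet A ∧ ENNReal.ofReal (1 - κ) ≤ ν A), Metric.ediam A

/-- The observational diameter `ObsDiam_Y(X, κ)` of an mm-space. -/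
def MMSpace.obsDiam (X : MMSpace) (Y : Type*) [MetricSpace Y] [MeasurableSpace Y] (κ : ℝ) : ℝ≥0∞ :=
  ⨆ (f : X.carrier → Y) (_ : LipschitzWith 1 f), partialDiam (X.μ.map f) κ

/-- The observational diameter `ObsDiam_Y(X, κ)` of a qmm-space. -/
def QMMSpace.obsDiam (X : QMMSpace) (Y : Type*) [MetricSpace Y] [MeasurableSpace Y] (κ : ℝ) :
    ℝ≥0∞ :=
  ⨆ (f : X.carrier → Y) (_ : f ∈ X.Lip1 Y), partialDiam (X.μ.map f) κ

end

/-! The proof characterises $\overline\chi$ as the set of laws on $M_\infty$ that are exchangeable,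
dissociated (disjoint blocks are independent) and almost surely satisfy the triangle inequality;
this is `IsSamplingLaw`. The conditions are weakly closed (`isClosed_isSamplingLaw`) and hold for
every qmm-space. Conversely, give the first points of one typical matrix the uniform measure: a
second moment estimate, with independence coming from dissociation, shows that these finite
mm-spaces approximate the law (`integral_sq_average_le`, `mem_chiBar_of_isSamplingLaw`).

That every such law comes from a qmm-space is an Aldous–Hoover representation. Encode the point at
an even index by the row of its distances to the odd indices. Given the odd subarray, the rows are
independent and identically distributed; given also the rows, the even-even entries are independent,
each with a law depending on its two rows. Both facts follow from one relabelling principle,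
`IsCondProb.of_measurePreserving`: a measure preserving relabelling that fixes an event and turns
fine data into a function of coarse data shows that the fine data predict the event no better. By
dissociation the even-even block is independent of the odd subarray, so a typical value of the
latter can be frozen (`exists_mixture`).

The heart of the matter is `QMMSpace.mem_closure_of_tendsto`: if $\tau(Z_i)\to\tau(X)$, and $\nu$ is
a limit of laws of $1$-Lipschitz maps on the $Z_i$, then $\nu$ is a limit of laws of $1$-Lipschitz
maps on $X$. Such maps label samples of $Z_i$ by points of $Y$ with label distances below the matrix
entries and statistics near $\nu$. Having such labels is a closed condition on matrices, so it is
also likely for samples of $X$. There the labels may depend on the random lengths, not just on the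
points; but $N$ points have only $e^{O(N)}$ labellings up to a finite net, while a labelling that
violates the constraints on average is compatible with the $\sim N^2$ independent lengths only with
probability $e^{-cN^2}$. Hence good labels obey $d^*$ on average
(`QMMSpace.exists_labelled_sample`). Limits of the empirical measures of points with labels give a
coupling of $\mu_X$ and $\nu$ under which label distances are almost surely at most
$\downarrow\!d^*$ (`QMMSpace.exists_coupling`).

The coupling is a random label at each point. To obtain maps, cut the space into small cells and use
independent randomness in different cells: the fluctuations of test averages vanish, and any choice
from the supports of the conditional laws still obeys the constraint. Atoms do no harm, because
$d^*(x,x)=\delta_0$ forces a deterministic label there (`exists_selection`).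

It remains that an upper bound on $diam(\cdot,\kappa)$ passes to weak limits at the same $\kappa$
(`partialDiam_le_of_mem_closure`), and that the partial diameter is upper semicontinuous up to a
change of $\kappa$ (`eventually_partialDiam_lt`). The former makes the observational diameter depend
only on the sampling law, and both together give the limsup inequality. For mm-spaces the almost
everywhere Lipschitz condition is no weaker than the usual one, by full support and completeness of
$Y$ (`exists_lipschitz_ae_eq`). -/

noncomputable section

open scoped BoundedContinuousFunction

/-! ### Product measures -/

section InfinitePi

variable {ι κ κ' α : Type*} [MeasurableSpace α]

/-- Restricting an infinite product measure to two disjoint families of coordinates. -/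
theorem infinitePi_map_prod_of_disjoint (P : ι → Measure α) [∀ i, IsProbabilityMeasure (P i)]
    {f : κ → ι} {g : κ' → ι} (hf : Function.Injective f) (hg : Function.Injective g)
    (hfg : ∀ i j, f i ≠ g j) :
    (Measure.infinitePi P).map (fun ω => ((fun i => ω (f i)), fun j => ω (g j))) =
      (Measure.infinitePi fun i => P (f i)).prod (Measure.infinitePi fun j => P (g j)) := by
  have hinj : Function.Injective (Sum.elim f g) := hf.sumElim hg hfg
  have h1 := Measure.map_infinitePi_infinitePi_of_inj (P := P) hinj
  let e : (κ → α) × (κ' → α) → (κ ⊕ κ' → α) := fun p => Sum.elim p.1 p.2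
  have he : Measurable e := by
    refine measurable_pi_lambda _ fun i => ?_
    cases i with
    | inl i => exact (measurable_pi_apply i).comp measurable_fst
    | inr i => exact (measurable_pi_apply i).comp measurable_snd
  have h2 : ((Measure.infinitePi fun i => P (f i)).prod
      (Measure.infinitePi fun j => P (g j))).map e =
      Measure.infinitePi (fun i => P (Sum.elim f g i)) := by
    refine Measure.eq_infinitePi _ fun s t ht => ?_
    rw [Measure.map_apply he (.pi s.countable_toSet fun _ _ => ht _)]
    have : e ⁻¹' ((s : Set (κ ⊕ κ')).pi t) =
        ((s.toLeft : Set κ).pi fun i => t (Sum.inl i)) ×ˢ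
          ((s.toRight : Set κ').pi fun i => t (Sum.inr i)) := by
      ext p
      simp [e, Set.mem_pi]
    rw [this, Measure.prod_prod, Measure.infinitePi_pi _ (fun i _ => ht _),
      Measure.infinitePi_pi _ (fun i _ => ht _), Finset.prod_sum_eq_prod_toLeft_mul_prod_toRight]
    simp
  let q : (κ ⊕ κ' → α) → (κ → α) × (κ' → α) := fun ω => (fun i => ω (Sum.inl i), fun j => ω (Sum.inr j))
  have hq : Measurable q := by fun_prop
  have h3 := congrArg (Measure.map q) (h1.trans h2.symm)
  rw [Measure.map_map hq (by fun_prop), Measure.map_map hq he] at h3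
  have : q ∘ e = id := rfl
  rw [this, Measure.map_id] at h3
  exact h3

theorem infinitePi_map_eval_triple (P : ι → Measure α) [∀ i, IsProbabilityMeasure (P i)]
    {i j k : ι} (hij : i ≠ j) (hik : i ≠ k) (hjk : j ≠ k) :
    (Measure.infinitePi P).map (fun ω => (ω i, ω j, ω k)) =
      (P i).prod ((P j).prod (P k)) := by
  have h := (iIndepFun_infinitePi (P := P) (X := fun _ ω => ω)
    (by fun_prop)).indepFun_prodMk (by fun_prop) j k i hij.symm hik.symm
  have h' := h.symm.map_prod_eq_prod_map_map (by exact (measurable_pi_apply i).aemeasurable) (by fun_prop)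
  rw [h', Measure.infinitePi_map_eval_prod hjk, Measure.infinitePi_map_eval]

end InfinitePi

/-! ### Distance matrices -/

namespace DistMatrix

/-- The subarray `(i, j) ↦ d (φ i) (φ j)`. -/
def reindex (φ : ℕ → ℕ) (d : DistMatrix) : DistMatrix :=
  ⟨fun i j => d.1 (φ i) (φ j), fun _ _ => d.2.1 _ _, fun _ => d.2.2 _⟩

@[simp] theorem reindex_apply (φ : ℕ → ℕ) (d : DistMatrix) (i j : ℕ) :
    (reindex φ d).1 i j = d.1 (φ i) (φ j) := rfl

@[fun_prop] theorem continuous_entry (i j : ℕ) : Continuous fun d : DistMatrix => d.1 i j :=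
  (continuous_apply j).comp ((continuous_apply i).comp continuous_subtype_val)

@[fun_prop] theorem measurable_entry (i j : ℕ) : Measurable fun d : DistMatrix => d.1 i j :=
  (measurable_pi_apply j).comp ((measurable_pi_apply i).comp measurable_subtype_coe)

theorem continuous_reindex (φ : ℕ → ℕ) : Continuous (reindex φ) :=
  Continuous.subtype_mk (continuous_pi fun _ => continuous_pi fun _ => continuous_entry _ _) _

@[fun_prop] theorem measurable_reindex (φ : ℕ → ℕ) : Measurable (reindex φ) :=
  Measurable.subtype_mk
    (measurable_pi_lambda _ fun _ => measurable_pi_lambda _ fun _ => measurable_entry _ _)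

/-- Positions above the diagonal. -/
abbrev Upper : Type := {p : ℕ × ℕ // p.1 < p.2}

/-- The position above the diagonal of the unordered pair `{i, j}`. -/
def Upper.mk' (i j : ℕ) (h : i ≠ j) : Upper := ⟨(min i j, max i j), by simp; omega⟩

/-- The matrix with prescribed entries above the diagonal. -/
def ofUpper (ω : Upper → I) : DistMatrix :=
  ⟨fun i j => if h : i = j then 0 else ω (Upper.mk' i j h),
    fun i j => by simp only [Upper.mk', eq_comm, min_comm, max_comm], fun i => by simp⟩

theorem ofUpper_apply (ω : Upper → I) {i j : ℕ} (h : i ≠ j) :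
    (ofUpper ω).1 i j = ω (Upper.mk' i j h) := by simp [ofUpper, h]

theorem ofUpper_apply_of_lt (ω : Upper → I) {i j : ℕ} (h : i < j) :
    (ofUpper ω).1 i j = ω ⟨(i, j), h⟩ := by
  rw [ofUpper_apply ω h.ne]; congr 1; simp [Upper.mk', h.le]

@[fun_prop] theorem measurable_ofUpper : Measurable ofUpper := by
  refine Measurable.subtype_mk ?_
  refine measurable_pi_lambda _ fun i => measurable_pi_lambda _ fun j => ?_
  by_cases h : i = j
  · simp [h]
  · simpa [h] using measurable_pi_apply _

/-- The entries above the diagonal. -/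
def upper (d : DistMatrix) : Upper → I := fun p => d.1 p.1.1 p.1.2

@[fun_prop] theorem measurable_upper : Measurable upper :=
  measurable_pi_lambda _ fun _ => measurable_entry _ _

theorem ofUpper_upper (d : DistMatrix) : ofUpper (upper d) = d := by
  apply Subtype.ext
  funext i j
  by_cases h : i = j
  · subst h; simp [ofUpper, d.2.2]
  · rw [ofUpper_apply _ h]
    rcases lt_or_gt_of_ne h with h' | h'
    · simp [upper, Upper.mk', h'.le]
    · simp [upper, Upper.mk', h'.le, d.2.1 i j]

/-- A probability measure on matrices is determined by the joint laws of finitely many entries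
above the diagonal. -/
theorem ext_of_cylinder {ζ ζ' : Measure DistMatrix} [IsProbabilityMeasure ζ]
    [IsProbabilityMeasure ζ']
    (h : ∀ (P : Finset Upper) (t : Upper → Set I), (∀ p, MeasurableSet (t p)) →
      ζ {d | ∀ p ∈ P, d.1 p.1.1 p.1.2 ∈ t p} = ζ' {d | ∀ p ∈ P, d.1 p.1.1 p.1.2 ∈ t p}) :
    ζ = ζ' := by
  have key : ζ.map upper = ζ'.map upper := by
    have : IsProbabilityMeasure (ζ.map upper) :=
      Measure.isProbabilityMeasure_map measurable_upper.aemeasurable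
    have : IsProbabilityMeasure (ζ'.map upper) :=
      Measure.isProbabilityMeasure_map measurable_upper.aemeasurable
    refine ext_of_generate_finite _ (generateFrom_squareCylinders (α := fun _ : Upper => I)).symm
      (isPiSystem_squareCylinders (fun _ => MeasurableSpace.isPiSystem_measurableSet)
      (fun _ => MeasurableSet.univ (α := I))) ?_ (by simp)
    rintro _ ⟨s, t, ht, rfl⟩
    have hm : MeasurableSet ((s : Set Upper).pi t) :=
      .pi s.countable_toSet fun p _ => ht p (Set.mem_univ p)
    rw [Measure.map_apply measurable_upper hm, Measure.map_apply measurable_upper hm]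
    exact h s t fun p => ht p (Set.mem_univ p)
  have h2 := congrArg (Measure.map ofUpper) key
  rw [Measure.map_map measurable_ofUpper measurable_upper,
    Measure.map_map measurable_ofUpper measurable_upper] at h2
  have h3 : ofUpper ∘ upper = id := funext ofUpper_upper
  simpa [h3] using h2

end DistMatrix

/-! ### Sampling laws of qmm-spaces: exchangeability, dissociation, triangle inequality -/

open DistMatrix

/-- The properties shared by the laws of random distance matrices: exchangeability, independence
of disjoint blocks, and the triangle inequality. -/
structure IsSamplingLaw (ζ : Measure DistMatrix) : Prop where
  exchangeable : ∀ φ : ℕ → ℕ, Function.Injective φ → ζ.map (reindex φ) = ζ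
  dissociated : ζ.map (fun d => (reindex (fun i => 2 * i) d, reindex (fun i => 2 * i + 1) d)) =
    ζ.prod ζ
  triangle : ∀ᵐ d ∂ζ, ∀ i j k, (d.1 i k : ℝ) ≤ d.1 i j + d.1 j k

namespace QMMSpace

variable (X : QMMSpace)

instance : Nonempty X.carrier := nonempty_of_isProbabilityMeasure X.μ

theorem dStar_mk' (x : ℕ → X.carrier) (i j : ℕ) (h : i ≠ j) :
    X.dStar (x (Upper.mk' i j h).1.1, x (Upper.mk' i j h).1.2) = X.dStar (x i, x j) := by
  rcases lt_or_gt_of_ne h with h' | h'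
  · simp [Upper.mk', h'.le]
  · simp [Upper.mk', h'.le, X.dStar_comm (x i)]

/-- Positions on or below the diagonal never enter the matrix. Without them distinct coordinates are
distinct entries, the form needed for independence and relabelling. -/
theorem matrixLaw_eq (x : ℕ → X.carrier) :
    X.matrixLaw x =
      (Measure.infinitePi fun p : Upper => X.dStar (x p.1.1, x p.1.2)).map ofUpper := by
  have h := Measure.map_infinitePi_infinitePi_of_inj
    (P := fun p : ℕ × ℕ => X.dStar (x p.1, x p.2)) (f := fun p : Upper => p.1)
    Subtype.val_injective
  rw [← h, Measure.map_map measurable_ofUpper (by fun_prop)]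
  rfl

theorem matrixLaw_cylinder (x : ℕ → X.carrier) (P : Finset Upper) (t : Upper → Set I)
    (ht : ∀ p, MeasurableSet (t p)) :
    X.matrixLaw x {d | ∀ p ∈ P, d.1 p.1.1 p.1.2 ∈ t p} =
      ∏ p ∈ P, X.dStar (x p.1.1, x p.1.2) (t p) := by
  have hm : MeasurableSet {d : DistMatrix | ∀ p ∈ P, d.1 p.1.1 p.1.2 ∈ t p} := by
    have : {d : DistMatrix | ∀ p ∈ P, d.1 p.1.1 p.1.2 ∈ t p} = upper ⁻¹' ((P : Set Upper).pi t) :=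
      rfl
    rw [this]
    exact measurable_upper (.pi P.countable_toSet fun p _ => ht p)
  rw [matrixLaw_eq, Measure.map_apply measurable_ofUpper hm]
  rw [← Measure.infinitePi_pi _ fun p _ => ht p]
  congr 1
  ext ω
  simp only [Set.mem_preimage, Set.mem_ofPred_eq, Set.mem_pi, Finset.mem_coe]
  exact forall₂_congr fun p _ => by rw [ofUpper_apply_of_lt ω p.2]

theorem measurable_matrixLaw_apply {S : Set DistMatrix} (hS : MeasurableSet S) :
    Measurable fun x => X.matrixLaw x S :=
  (Measure.measurable_coe hS).comp X.measurable_matrixLaw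

theorem sampling_apply {S : Set DistMatrix} (hS : MeasurableSet S) :
    (X.sampling : Measure DistMatrix) S =
      ∫⁻ x, X.matrixLaw x S ∂(Measure.infinitePi fun _ : ℕ => X.μ) :=
  Measure.bind_apply hS X.measurable_matrixLaw.aemeasurable

theorem sampling_cylinder (P : Finset Upper) (t : Upper → Set I)
    (ht : ∀ p, MeasurableSet (t p)) :
    (X.sampling : Measure DistMatrix) {d | ∀ p ∈ P, d.1 p.1.1 p.1.2 ∈ t p} =
      ∫⁻ x, ∏ p ∈ P, X.dStar (x p.1.1, x p.1.2) (t p) ∂(Measure.infinitePi fun _ : ℕ => X.μ) := by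
  rw [sampling_apply]
  · simp_rw [X.matrixLaw_cylinder _ P t ht]
  · have : {d : DistMatrix | ∀ p ∈ P, d.1 p.1.1 p.1.2 ∈ t p} = upper ⁻¹' ((P : Set Upper).pi t) :=
      rfl
    rw [this]
    exact measurable_upper (.pi P.countable_toSet fun p _ => ht p)

theorem ae_sampling {p : DistMatrix → Prop} (hp : MeasurableSet {d | p d})
    (h : ∀ᵐ x ∂(Measure.infinitePi fun _ : ℕ => X.μ), ∀ᵐ d ∂X.matrixLaw x, p d) :
    ∀ᵐ d ∂(X.sampling : Measure DistMatrix), p d := by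
  rw [ae_iff]
  change (X.sampling : Measure DistMatrix) {d | p d}ᶜ = 0
  rw [sampling_apply _ hp.compl, lintegral_eq_zero_iff
    (X.measurable_matrixLaw_apply hp.compl)]
  filter_upwards [h] with x hx
  exact hx

/-- Since `φ` need not be monotone, a relabelled position may fall below the diagonal and has to be
sorted back; symmetry of `dStar` makes this harmless. -/
theorem matrixLaw_map_reindex {φ : ℕ → ℕ} (hφ : Function.Injective φ) (x : ℕ → X.carrier) :
    (X.matrixLaw x).map (reindex φ) = X.matrixLaw (fun i => x (φ i)) := by
  let s : Upper → Upper := fun p => Upper.mk' (φ p.1.1) (φ p.1.2) (hφ.ne p.2.ne)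
  have hs : Function.Injective s := by
    rintro ⟨⟨a, b⟩, hab⟩ ⟨⟨c, e⟩, hce⟩ h
    simp only [s, Upper.mk', Subtype.mk.injEq, Prod.mk.injEq] at h hab hce ⊢
    have h' : (φ a = φ c ∧ φ b = φ e) ∨ (φ a = φ e ∧ φ b = φ c) := by omega
    rcases h' with ⟨h1, h2⟩ | ⟨h1, h2⟩
    · exact ⟨hφ h1, hφ h2⟩
    · have := hφ h1; have := hφ h2; omega
  have h := Measure.map_infinitePi_infinitePi_of_inj
    (P := fun p : Upper => X.dStar (x p.1.1, x p.1.2)) hs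
  rw [matrixLaw_eq, Measure.map_map (measurable_reindex φ) measurable_ofUpper, matrixLaw_eq]
  have h1 : reindex φ ∘ ofUpper = ofUpper ∘ fun ω p => ω (s p) := by
    funext ω
    apply Subtype.ext
    funext i j
    by_cases hij : i = j
    · subst hij
      exact ((reindex φ (ofUpper ω)).2.2 i).trans ((ofUpper fun p => ω (s p)).2.2 i).symm
    · simp only [Function.comp_apply, reindex_apply]
      rw [ofUpper_apply _ hij, ofUpper_apply _ (hφ.ne hij)]
      congr 1
      simp only [s, Upper.mk', Subtype.mk.injEq, Prod.mk.injEq]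
      rcases le_total i j with h | h <;> simp [h, min_comm, max_comm]
  rw [h1, ← Measure.map_map measurable_ofUpper (by fun_prop), h]
  congr 2
  funext p
  exact X.dStar_mk' x _ _ _

theorem matrixLaw_map_prod (x : ℕ → X.carrier) :
    (X.matrixLaw x).map
        (fun d => (reindex (fun i => 2 * i) d, reindex (fun i => 2 * i + 1) d)) =
      (X.matrixLaw fun i => x (2 * i)).prod (X.matrixLaw fun i => x (2 * i + 1)) := by
  let s : Upper → Upper := fun p => ⟨(2 * p.1.1, 2 * p.1.2), by have := p.2; simp only; omega⟩
  let s' : Upper → Upper := fun p => ⟨(2 * p.1.1 + 1, 2 * p.1.2 + 1), by have := p.2; simp only; omega⟩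
  have hs : Function.Injective s := by
    rintro ⟨⟨a, b⟩, hab⟩ ⟨⟨c, e⟩, hce⟩ h
    simp only [s, Subtype.mk.injEq, Prod.mk.injEq] at h ⊢
    omega
  have hs' : Function.Injective s' := by
    rintro ⟨⟨a, b⟩, hab⟩ ⟨⟨c, e⟩, hce⟩ h
    simp only [s', Subtype.mk.injEq, Prod.mk.injEq] at h ⊢
    omega
  have h := infinitePi_map_prod_of_disjoint
    (fun p : Upper => X.dStar (x p.1.1, x p.1.2)) hs hs' (by
      rintro ⟨⟨a, b⟩, hab⟩ ⟨⟨c, e⟩, hce⟩ h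
      simp only [s, s', Subtype.mk.injEq, Prod.mk.injEq] at h
      omega)
  rw [matrixLaw_eq, matrixLaw_eq, matrixLaw_eq, Measure.map_prod_map _ _ measurable_ofUpper
    measurable_ofUpper, ← h, Measure.map_map (by fun_prop) (by fun_prop),
    Measure.map_map (by fun_prop) (by fun_prop)]
  congr 1
  funext ω
  refine Prod.ext ?_ ?_ <;>
  · apply Subtype.ext
    funext i j
    by_cases hij : i = j
    · subst hij
      simp [ofUpper]
    · simp only [Function.comp_apply, reindex_apply, Prod.map]
      rw [ofUpper_apply _ hij, ofUpper_apply _ (by omega)]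
      congr 1
      simp only [s, s', Upper.mk', Subtype.mk.injEq, Prod.mk.injEq]
      omega

/-- Given the points, relabelling or splitting the matrix amounts to relabelling or splitting the
sequence of points; integrating over independent, identically distributed points gives the claims.
-/
theorem isSamplingLaw_sampling : IsSamplingLaw (X.sampling : Measure DistMatrix) where
  exchangeable φ hφ := by
    ext S hS
    rw [Measure.map_apply (measurable_reindex φ) hS, sampling_apply _ (measurable_reindex φ hS),
      sampling_apply _ hS]
    have h : ∀ x, X.matrixLaw x (reindex φ ⁻¹' S) = X.matrixLaw (fun i => x (φ i)) S := fun x => by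
      rw [← X.matrixLaw_map_reindex hφ, Measure.map_apply (measurable_reindex φ) hS]
    simp_rw [h]
    have h2 := Measure.map_infinitePi_infinitePi_of_inj (P := fun _ : ℕ => X.μ) hφ
    conv_rhs => rw [← h2]
    rw [lintegral_map (X.measurable_matrixLaw_apply hS) (by fun_prop)]
  dissociated := by
    have hm : Measurable fun d : DistMatrix =>
        (reindex (fun i => 2 * i) d, reindex (fun i => 2 * i + 1) d) := by fun_prop
    symm
    refine Measure.prod_eq fun S T hS hT => ?_
    rw [Measure.map_apply hm (hS.prod hT), sampling_apply _ (hm (hS.prod hT)),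
      sampling_apply _ hS, sampling_apply _ hT]
    have h : ∀ x, X.matrixLaw x ((fun d : DistMatrix =>
        (reindex (fun i => 2 * i) d, reindex (fun i => 2 * i + 1) d)) ⁻¹' (S ×ˢ T)) =
        X.matrixLaw (fun i => x (2 * i)) S * X.matrixLaw (fun i => x (2 * i + 1)) T := fun x => by
      rw [← Measure.prod_prod, ← X.matrixLaw_map_prod, Measure.map_apply hm (hS.prod hT)]
    simp_rw [h]
    have mS := X.measurable_matrixLaw_apply hS
    have mT := X.measurable_matrixLaw_apply hT
    have h2 := infinitePi_map_prod_of_disjoint (fun _ : ℕ => X.μ)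
      (f := fun i : ℕ => 2 * i) (g := fun i : ℕ => 2 * i + 1)
      (fun a b h => by simpa using h) (fun a b h => by simpa using h) (fun i j => by omega)
    have h3 := lintegral_prod_mul (μ := Measure.infinitePi fun _ : ℕ => X.μ)
      (ν := Measure.infinitePi fun _ : ℕ => X.μ) mS.aemeasurable mT.aemeasurable
    rw [← h2, lintegral_map (by fun_prop) (by fun_prop)] at h3
    exact h3
  triangle := by
    have key : ∀ i j k : ℕ, i < j → j < k → ∀ᵐ d ∂(X.sampling : Measure DistMatrix),
        (d.1 i k : ℝ) ≤ d.1 i j + d.1 j k ∧ (d.1 i j : ℝ) ≤ d.1 j k + d.1 i k ∧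
          (d.1 j k : ℝ) ≤ d.1 i j + d.1 i k := by
      intro i j k hij hjk
      have hcl : MeasurableSet {l : I × I × I | (l.2.2 : ℝ) ≤ l.1 + l.2.1 ∧
          (l.1 : ℝ) ≤ l.2.1 + l.2.2 ∧ (l.2.1 : ℝ) ≤ l.1 + l.2.2} := by
        refine IsClosed.measurableSet ?_
        refine IsClosed.and ?_ (IsClosed.and ?_ ?_) <;> exact isClosed_le (by fun_prop) (by fun_prop)
      have hm : Measurable fun d : DistMatrix => (d.1 i j, d.1 j k, d.1 i k) :=
        (measurable_entry i j).prodMk ((measurable_entry j k).prodMk (measurable_entry i k))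
      refine X.ae_sampling (hm hcl) ?_
      have hT := X.triangle
      rw [← infinitePi_map_eval_triple (fun _ : ℕ => X.μ) hij.ne (hij.trans hjk).ne hjk.ne] at hT
      filter_upwards [ae_of_ae_map (by fun_prop) hT] with x hx
      have hlaw : (X.matrixLaw x).map (fun d : DistMatrix => (d.1 i j, d.1 j k, d.1 i k)) =
          (X.dStar (x i, x j)).prod ((X.dStar (x j, x k)).prod (X.dStar (x i, x k))) := by
        rw [← infinitePi_map_eval_triple (fun p : Upper => X.dStar (x p.1.1, x p.1.2))
          (i := ⟨(i, j), hij⟩) (j := ⟨(j, k), hjk⟩) (k := ⟨(i, k), hij.trans hjk⟩)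
          (by simp; omega) (by simp; omega) (by simp; omega),
          matrixLaw_eq, Measure.map_map hm measurable_ofUpper]
        congr 1
        funext ω
        simp [ofUpper_apply_of_lt, hij, hjk, hij.trans hjk]
      rw [← hlaw] at hx
      exact ae_of_ae_map hm.aemeasurable hx
    have key' : ∀ᵐ d ∂(X.sampling : Measure DistMatrix), ∀ i j k : ℕ, i < j → j < k →
        (d.1 i k : ℝ) ≤ d.1 i j + d.1 j k ∧ (d.1 i j : ℝ) ≤ d.1 j k + d.1 i k ∧
          (d.1 j k : ℝ) ≤ d.1 i j + d.1 i k := by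
      simp only [ae_all_iff]
      exact key
    filter_upwards [key'] with d hd i j k
    have hs : ∀ a b, d.1 a b = d.1 b a := d.2.1
    have hz : ∀ a, d.1 a a = 0 := d.2.2
    have hn : ∀ a b, (0 : ℝ) ≤ d.1 a b := fun a b => (d.1 a b).2.1
    rcases lt_trichotomy i j with hij | rfl | hij
    · rcases lt_trichotomy j k with hjk | rfl | hjk
      · exact (hd i j k hij hjk).1
      · simp [hz]
      · rcases lt_trichotomy i k with hik | rfl | hik
        · have := hd i k j hik hjk
          rw [hs j k]; linarith [this.2.1]
        · simp only [hz]; simpa using add_nonneg (hn i j) (hn j i)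
        · have := hd k i j hik hij
          rw [hs i k, hs j k]; linarith [this.2.1]
    · simp [hz]
    · rcases lt_trichotomy j k with hjk | rfl | hjk
      · rcases lt_trichotomy i k with hik | rfl | hik
        · have := hd j i k hij hik
          rw [hs i j]; linarith [this.2.2]
        · simp only [hz]; simpa using add_nonneg (hn i j) (hn j i)
        · have := hd j k i hjk hik
          rw [hs i k, hs i j]; linarith [this.2.2]
      · simp [hz]
      · have := hd k j i hjk hij
        rw [hs i k, hs i j, hs j k]; linarith [this.1]

end QMMSpace

/-! ### mm-spaces as qmm-spaces -/

theorem lowerEnd_dirac (t : I) : lowerEnd (Measure.dirac t) = t := by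
  have : (Measure.dirac t).support = {t} := by
    refine Set.Subset.antisymm ?_ ?_
    · exact Measure.support_subset_of_isClosed isClosed_singleton (by
        rw [mem_ae_dirac_iff (measurableSet_singleton t)]; rfl)
    · rintro _ rfl
      rw [Measure.mem_support_iff_forall]
      intro U hU
      rw [Measure.dirac_apply_of_mem (mem_of_mem_nhds hU)]
      exact one_pos
  simp [lowerEnd, this]

/-- The length is almost surely at least the infimum of the support of its law. -/
theorem ae_lowerEnd_le (ν : Measure I) : ∀ᵐ t : I ∂ν, lowerEnd ν ≤ t := by
  filter_upwards [Measure.support_mem_ae (μ := ν)] with t ht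
  exact csInf_le ⟨0, by rintro _ ⟨s, _, rfl⟩; exact s.2.1⟩ ⟨t, ht, rfl⟩

theorem le_lowerEnd {ν : Measure I} (hν : ν ≠ 0) {r : ℝ} (h : ∀ᵐ t : I ∂ν, r ≤ t) :
    r ≤ lowerEnd ν := by
  have hcl : IsClosed {t : I | r ≤ t} := isClosed_le continuous_const continuous_subtype_val
  have hsub := Measure.support_subset_of_isClosed hcl h
  obtain ⟨t, ht⟩ := Measure.nonempty_support hν
  refine le_csInf ⟨t, t, ht, rfl⟩ ?_
  rintro _ ⟨s, hs, rfl⟩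
  exact hsub hs

/-- A measurable map that is `1`-Lipschitz on almost all pairs of points agrees almost everywhere
with a `1`-Lipschitz map. -/
theorem exists_lipschitz_ae_eq {α Y : Type*} [MetricSpace α] [TopologicalSpace.SeparableSpace α]
    [MeasurableSpace α] [BorelSpace α] (μ : Measure α) [IsProbabilityMeasure μ]
    [μ.IsOpenPosMeasure] [MetricSpace Y] [CompleteSpace Y] {f : α → Y}
    (h : ∀ᵐ p ∂(μ.prod μ), dist (f p.1) (f p.2) ≤ dist p.1 p.2) :
    ∃ g : α → Y, LipschitzWith 1 g ∧ f =ᵐ[μ] g := by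
  have h1 : ∀ᵐ x ∂μ, ∀ᵐ y ∂μ, dist (f x) (f y) ≤ dist x y := Measure.ae_ae_of_ae_prod h
  -- Points that are good against almost every other point. They have full measure, hence are dense
  -- by full support, and `f` is genuinely Lipschitz on them.
  set A : Set α := {x | ∀ᵐ y ∂μ, dist (f x) (f y) ≤ dist x y} with hA
  have hAd : Dense A := Measure.dense_of_ae h1
  have hlip : LipschitzWith 1 (fun x : A => f x) := by
    refine LipschitzWith.of_dist_le_mul fun x x' => ?_
    rw [NNReal.coe_one, one_mul, Subtype.dist_eq]
    refine le_of_forall_pos_le_add fun ε hε => ?_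
    have hx : ∀ᵐ y ∂μ, dist (f x) (f y) ≤ dist (x : α) y := x.2
    have hx' : ∀ᵐ y ∂μ, dist (f x') (f y) ≤ dist (x' : α) y := x'.2
    -- Two good points are compared through a third point near `x`, against which both are good; it
    -- exists because balls have positive measure.
    have hpos : 0 < μ (Metric.ball (x : α) (ε / 2)) :=
      Metric.isOpen_ball.measure_pos μ ⟨x, Metric.mem_ball_self (by positivity)⟩
    obtain ⟨y, hy, hy1, hy2⟩ := ((frequently_ae_mem_iff.2 hpos.ne').and_eventually
      (hx.and hx')).exists
    rw [Metric.mem_ball, dist_comm] at hy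
    have t1 := dist_triangle (f x) (f y) (f x')
    rw [dist_comm (f y)] at t1
    have t2 := dist_triangle (x' : α) x y
    rw [dist_comm (x' : α) x] at t2
    linarith
  have hui : IsUniformInducing (Subtype.val : A → α) := isUniformInducing_val A
  have hdr : DenseRange (Subtype.val : A → α) := hAd.denseRange_val
  have hdi : IsDenseInducing (Subtype.val : A → α) := hui.isDenseInducing hdr
  let g : α → Y := hdi.extend fun x : A => f x
  have hgc : Continuous g :=
    (uniformContinuous_uniformly_extend hui hdr hlip.uniformContinuous).continuous
  have hge : ∀ x : A, g x = f x := fun x => hdi.extend_eq hlip.continuous x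
  refine ⟨g, ?_, ?_⟩
  · refine LipschitzWith.of_dist_le_mul fun x y => ?_
    rw [NNReal.coe_one, one_mul]
    have hcl : IsClosed {p : α × α | dist (g p.1) (g p.2) ≤ dist p.1 p.2} :=
      isClosed_le (by fun_prop) (by fun_prop)
    have hd2 : Dense (A ×ˢ A) := hAd.prod hAd
    have : (x, y) ∈ closure (A ×ˢ A) := hd2 _
    refine hcl.closure_subset_iff.2 ?_ this
    rintro ⟨a, b⟩ ⟨ha, hb⟩
    have := hlip.dist_le_mul ⟨a, ha⟩ ⟨b, hb⟩
    rw [NNReal.coe_one, one_mul] at this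
    change dist (g a) (g b) ≤ dist a b
    rw [hge ⟨a, ha⟩, hge ⟨b, hb⟩]
    exact this
  · filter_upwards [h1] with x hx
    exact (hge ⟨x, hx⟩).symm

namespace MMSpace

variable (X : MMSpace)

/-- The distance of an mm-space with values in the unit interval. -/
def idist (p : X.carrier × X.carrier) : I := ⟨dist p.1 p.2, dist_nonneg, X.dist_le_one _ _⟩

theorem measurable_idist : Measurable X.idist := by
  have : SecondCountableTopology X.carrier := UniformSpace.secondCountable_of_separable _
  exact Measurable.subtype_mk (measurable_fst.dist measurable_snd)

/-- An mm-space regarded as a qmm-space. -/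
def toQMM : QMMSpace where
  carrier := X.carrier
  standardBorelSpace :=
    have : SecondCountableTopology X.carrier := UniformSpace.secondCountable_of_separable _
    inferInstance
  μ := X.μ
  dStar := Kernel.deterministic X.idist X.measurable_idist
  dStar_self x := by
    rw [Kernel.deterministic_apply]; congr 1; exact Subtype.ext (dist_self x)
  dStar_comm x y := by
    rw [Kernel.deterministic_apply, Kernel.deterministic_apply]
    congr 1; exact Subtype.ext (dist_comm x y)
  triangle := Eventually.of_forall fun p => by
    have hcl : MeasurableSet {l : I × I × I | (l.2.2 : ℝ) ≤ l.1 + l.2.1 ∧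
          (l.1 : ℝ) ≤ l.2.1 + l.2.2 ∧ (l.2.1 : ℝ) ≤ l.1 + l.2.2} := by
      refine IsClosed.measurableSet ?_
      refine IsClosed.and ?_ (IsClosed.and ?_ ?_) <;> exact isClosed_le (by fun_prop) (by fun_prop)
    simp only [Kernel.deterministic_apply, Measure.dirac_prod_dirac]
    rw [ae_dirac_iff hcl]
    obtain ⟨a, b, c⟩ := p
    refine ⟨dist_triangle a b c, ?_, ?_⟩
    · have := dist_triangle_right a b c
      simp only [idist]; linarith
    · have := dist_triangle_left b c a
      simp only [idist]; linarith

theorem toQMM_matrixLaw (x : ℕ → X.carrier) :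
    X.toQMM.matrixLaw x = Measure.dirac (X.distMatrix x) := by
  have h1 : (fun p : ℕ × ℕ => X.toQMM.dStar (x p.1, x p.2)) =
      fun p : ℕ × ℕ => Measure.dirac (X.idist (x p.1, x p.2)) := by
    funext p; exact Kernel.deterministic_apply X.measurable_idist _
  have h2 : X.toQMM.matrixLaw x = (Measure.infinitePi fun p : ℕ × ℕ =>
      Measure.dirac (X.idist (x p.1, x p.2))).map symmMatrix := by
    unfold QMMSpace.matrixLaw
    congr 2
  rw [h2, Measure.infinitePi_dirac, Measure.map_dirac' measurable_symmMatrix]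
  congr 1
  apply Subtype.ext
  funext i j
  by_cases h : i = j
  · subst h; exact Subtype.ext (by simp [symmMatrix, distMatrix])
  · rcases lt_or_gt_of_ne h with h' | h'
    · exact Subtype.ext (by simp [symmMatrix, distMatrix, idist, h, h'.le])
    · exact Subtype.ext (by simp [symmMatrix, distMatrix, idist, h, h'.le, dist_comm (x i)])

theorem toQMM_sampling : X.toQMM.sampling = X.sampling := by
  apply Subtype.ext
  change (Measure.infinitePi fun _ : ℕ => X.μ).bind X.toQMM.matrixLaw =
    (Measure.infinitePi fun _ : ℕ => X.μ).map X.distMatrix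
  have : X.toQMM.matrixLaw = fun x => Measure.dirac (X.distMatrix x) :=
    funext X.toQMM_matrixLaw
  rw [this]
  exact Measure.bind_dirac_eq_map _ X.measurable_distMatrix

/-- Almost everywhere equal maps have the same law, so by `exists_lipschitz_ae_eq` both suprema run
over the same laws. -/
theorem toQMM_obsDiam (Y : Type*) [MetricSpace Y] [CompactSpace Y] [MeasurableSpace Y]
    [BorelSpace Y] (κ : ℝ) : X.toQMM.obsDiam Y κ = X.obsDiam Y κ := by
  have hl : ∀ p : X.carrier × X.carrier, lowerEnd (X.toQMM.dStar p) = dist p.1 p.2 := fun p => by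
    have : X.toQMM.dStar p = Measure.dirac (X.idist p) :=
      Kernel.deterministic_apply X.measurable_idist _
    rw [this, lowerEnd_dirac]; rfl
  refine le_antisymm ?_ ?_
  · refine iSup₂_le fun f hf => ?_
    obtain ⟨g, hg, hfg⟩ := exists_lipschitz_ae_eq X.μ (f := f) (by
      filter_upwards [hf.2] with p hp
      exact hp.trans_eq (hl p))
    have : X.toQMM.μ.map f = X.μ.map g := Measure.map_congr hfg
    rw [this]
    exact le_iSup₂_of_le g hg le_rfl
  · refine iSup₂_le fun f hf => ?_
    refine le_iSup₂_of_le (f := fun (f : X.toQMM.carrier → Y) (_ : f ∈ X.toQMM.Lip1 Y) =>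
      partialDiam (X.toQMM.μ.map f) κ) f ?_ le_rfl
    refine ⟨hf.continuous.measurable, Eventually.of_forall fun p => ?_⟩
    rw [hl p]
    simpa using hf.dist_le_mul p.1 p.2

end MMSpace

/-! ### The closure of the sampling measures -/

/-- A probability measure is in the weak closure of `S` if finitely many test functions never
separate it from `S`. -/
theorem mem_closure_of_forall_finset {Ω : Type*} [MeasurableSpace Ω] [TopologicalSpace Ω]
    [OpensMeasurableSpace Ω] {S : Set (ProbabilityMeasure Ω)} {ζ : ProbabilityMeasure Ω}
    (h : ∀ (F : Finset (Ω →ᵇ ℝ)) (ε : ℝ), 0 < ε →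
      ∃ ζ' ∈ S, ∀ f ∈ F, |∫ ω, f ω ∂(ζ' : Measure Ω) - ∫ ω, f ω ∂(ζ : Measure Ω)| ≤ ε) :
    ζ ∈ closure S := by
  classical
  -- The approximants form a net indexed by a finite set of test functions and an accuracy.
  choose! z hzS hz using fun (F : Finset (Ω →ᵇ ℝ)) (m : ℕ) =>
    h F (1 / ((m : ℝ) + 1)) Nat.one_div_pos_of_nat
  refine mem_closure_of_tendsto (b := (atTop : Filter (Finset (Ω →ᵇ ℝ) × ℕ)))
    (f := fun p => z p.1 p.2) ?_ (Eventually.of_forall fun p => hzS p.1 p.2)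
  rw [ProbabilityMeasure.tendsto_iff_forall_integral_tendsto]
  intro f
  rw [tendsto_iff_dist_tendsto_zero]
  have h0 : Tendsto (fun p : Finset (Ω →ᵇ ℝ) × ℕ => 1 / ((p.2 : ℝ) + 1)) atTop (𝓝 0) := by
    refine tendsto_one_div_add_atTop_nhds_zero_nat.comp ?_
    rw [← prod_atTop_atTop_eq]
    exact tendsto_snd
  refine squeeze_zero' (Eventually.of_forall fun _ => dist_nonneg) ?_ h0
  filter_upwards [eventually_ge_atTop (({f} : Finset (Ω →ᵇ ℝ)), 0)] with p hp
  rw [Real.dist_eq]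
  exact hz p.1 p.2 f (hp.1 (Finset.mem_singleton_self f))

instance : SecondCountableTopology DistMatrix :=
  TopologicalSpace.Subtype.secondCountableTopology _

instance : TopologicalSpace.MetrizableSpace DistMatrix :=
  Topology.IsEmbedding.subtypeVal.metrizableSpace

instance : HasOuterApproxClosed DistMatrix := by
  let := TopologicalSpace.pseudoMetrizableSpacePseudoMetric DistMatrix
  infer_instance

instance : CompactSpace DistMatrix := by
  refine isCompact_iff_compactSpace.1 (IsClosed.isCompact ?_)
  refine IsClosed.and ?_ ?_
  · simp only [Set.ofPred_forall]
    exact isClosed_iInter fun i => isClosed_iInter fun j =>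
      isClosed_eq (by fun_prop) (by fun_prop)
  · simp only [Set.ofPred_forall]
    exact isClosed_iInter fun i => isClosed_eq (by fun_prop) continuous_const

/-- Exchangeability and dissociation equate weakly continuous functions of the law. The almost sure
triangle inequality is made closed by expressing it as the vanishing of the integral of a continuous
defect. -/
theorem isClosed_isSamplingLaw :
    IsClosed {ζ : ProbabilityMeasure DistMatrix | IsSamplingLaw (ζ : Measure DistMatrix)} := by
  have hset : {ζ : ProbabilityMeasure DistMatrix | IsSamplingLaw (ζ : Measure DistMatrix)} =
      (⋂ (φ : ℕ → ℕ) (_ : Function.Injective φ),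
        {ζ : ProbabilityMeasure DistMatrix | ζ.map (measurable_reindex φ).aemeasurable = ζ}) ∩
      ({ζ : ProbabilityMeasure DistMatrix | ζ.map (f := fun d => (reindex (fun i => 2 * i) d, reindex (fun i => 2 * i + 1) d))
          (Measurable.aemeasurable (by fun_prop)) = ζ.prod ζ} ∩
      ⋂ (i : ℕ) (j : ℕ) (k : ℕ), {ζ | ∫ d : DistMatrix, max ((d.1 i k : ℝ) - d.1 i j - d.1 j k) 0
        ∂(ζ : Measure DistMatrix) = 0}) := by
    ext ζ
    have htri : ∀ i j k : ℕ, (∀ᵐ d ∂(ζ : Measure DistMatrix),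
        (d.1 i k : ℝ) ≤ d.1 i j + d.1 j k) ↔ ∫ d : DistMatrix,
          max ((d.1 i k : ℝ) - d.1 i j - d.1 j k) 0 ∂(ζ : Measure DistMatrix) = 0 := by
      intro i j k
      have hc : Continuous fun d : DistMatrix => max ((d.1 i k : ℝ) - d.1 i j - d.1 j k) 0 := by
        have h1 := continuous_subtype_val.comp (continuous_entry i k)
        have h2 := continuous_subtype_val.comp (continuous_entry i j)
        have h3 := continuous_subtype_val.comp (continuous_entry j k)
        exact ((h1.sub h2).sub h3).max continuous_const
      rw [integral_eq_zero_iff_of_nonneg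
        (f := fun d : DistMatrix => max ((d.1 i k : ℝ) - d.1 i j - d.1 j k) 0)
        (fun d => le_max_right _ _)
        (hc.integrable_of_hasCompactSupport (HasCompactSupport.of_compactSpace _))]
      refine eventually_congr (Eventually.of_forall fun d => ?_)
      rw [Pi.zero_apply, max_eq_right_iff]
      constructor <;> intro h <;> linarith
    simp only [Set.mem_inter_iff, Set.mem_iInter, Set.mem_ofPred_eq]
    constructor
    · intro h
      refine ⟨fun φ hφ => Subtype.ext (h.exchangeable φ hφ), Subtype.ext h.dissociated,
        fun i j k => (htri i j k).1 ?_⟩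
      filter_upwards [h.triangle] with d hd using hd i j k
    · rintro ⟨h1, h2, h3⟩
      refine ⟨fun φ hφ => congrArg Subtype.val (h1 φ hφ), congrArg Subtype.val h2, ?_⟩
      simp only [ae_all_iff]
      exact fun i j k => (htri i j k).2 (h3 i j k)
  rw [hset]
  refine IsClosed.inter ?_ (IsClosed.inter ?_ ?_)
  · refine isClosed_iInter fun φ => isClosed_iInter fun _ => ?_
    exact isClosed_eq (ProbabilityMeasure.continuous_map (continuous_reindex φ)) continuous_id
  · refine isClosed_eq (ProbabilityMeasure.continuous_map
      ((continuous_reindex _).prodMk (continuous_reindex _))) ?_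
    exact ProbabilityMeasure.continuous_prod.comp (continuous_id.prodMk continuous_id)
  · refine isClosed_iInter fun i => isClosed_iInter fun j => isClosed_iInter fun k => ?_
    refine isClosed_eq ?_ continuous_const
    have h1 := continuous_subtype_val.comp (continuous_entry i k)
    have h2 := continuous_subtype_val.comp (continuous_entry i j)
    have h3 := continuous_subtype_val.comp (continuous_entry j k)
    exact ProbabilityMeasure.continuous_integral_continuousMap
      (⟨_, ((h1.sub h2).sub h3).max continuous_const⟩ : C(DistMatrix, ℝ))

theorem isSamplingLaw_of_mem_chiBar {ζ : ProbabilityMeasure DistMatrix} (h : ζ ∈ ChiBar) :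
    IsSamplingLaw (ζ : Measure DistMatrix) := by
  refine isClosed_isSamplingLaw.closure_subset_iff.2 ?_ h
  rintro _ ⟨X, rfl⟩
  rw [← X.toQMM_sampling]
  exact X.toQMM.isSamplingLaw_sampling

/-! ### Approximation of sampling laws by finite mm-spaces -/

/-- A type synonym for `Fin n` carrying the pseudometric of a distance matrix. -/
def SamplePoint (n : ℕ) : Type := Fin n

/-- The uniform probability measure on `Fin (n + 1)`. -/
def uniformFin (n : ℕ) : Measure (Fin (n + 1)) := uniformOn Set.univ

instance (n : ℕ) : IsProbabilityMeasure (uniformFin n) :=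
  isProbabilityMeasure_uniformOn Set.finite_univ Set.univ_nonempty

theorem uniformFin_singleton (n : ℕ) (i : Fin (n + 1)) :
    uniformFin n {i} = ((n : ℝ≥0∞) + 1)⁻¹ := by
  rw [uniformFin, uniformOn_univ]
  simp

/-- The first `n + 1` points of a matrix satisfying the triangle inequality, with the uniform
measure, form an mm-space whose sampling measure comes from independent uniform indices. -/
theorem exists_mmSpace_of_triangle (d : DistMatrix)
    (hd : ∀ i j k, (d.1 i k : ℝ) ≤ d.1 i j + d.1 j k) (n : ℕ) :
    ∃ X : MMSpace, (X.sampling : Measure DistMatrix) =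
      (Measure.infinitePi fun _ : ℕ => uniformFin n).map
        (fun w => reindex (fun i => (w i : ℕ)) d) := by
  let α : Type := SamplePoint (n + 1)
  let v : α → Fin (n + 1) := id
  let : PseudoMetricSpace α :=
    { dist := fun i j => (d.1 (v i) (v j) : ℝ)
      dist_self := fun i => by simp [d.2.2]
      dist_comm := fun i j => by rw [d.2.1]
      dist_triangle := fun i j k => hd _ _ _ }
  have hfin : Finite α := inferInstanceAs (Finite (Fin (n + 1)))
  -- Different indices may be at distance zero, so points are identified; the image of the uniform
  -- measure still charges every point.
  let Q := SeparationQuotient α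
  have hQ : Finite Q := Quotient.finite _
  let mQ : MeasurableSpace Q := borel Q
  have bQ : BorelSpace Q := ⟨rfl⟩
  let mk : Fin (n + 1) → Q := fun i => SeparationQuotient.mk (show α from i)
  have hmk : Measurable mk := measurable_of_countable mk
  have hsurj : ∀ x : Q, ∃ i, mk i = x := fun x => by
    obtain ⟨i, hi⟩ := SeparationQuotient.surjective_mk x
    exact ⟨i, hi⟩
  have hdist : ∀ i j : Fin (n + 1), dist (mk i) (mk j) = d.1 i j := fun i j => rfl
  let μ : Measure Q := (uniformFin n).map mk
  have hμ : IsProbabilityMeasure μ := Measure.isProbabilityMeasure_map hmk.aemeasurable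
  have hopen : μ.IsOpenPosMeasure := by
    refine ⟨fun U hU hne => ?_⟩
    obtain ⟨x, hx⟩ := hne
    obtain ⟨i, rfl⟩ := hsurj x
    rw [Measure.map_apply hmk hU.measurableSet]
    refine ne_of_gt (lt_of_lt_of_le ?_ (measure_mono (Set.singleton_subset_iff.2 hx)))
    rw [uniformFin_singleton]
    simp
  have hcomp : CompleteSpace Q := inferInstance
  let X : MMSpace :=
    { carrier := Q
      dist_le_one := fun x y => by
        obtain ⟨i, rfl⟩ := hsurj x
        obtain ⟨j, rfl⟩ := hsurj y
        rw [hdist]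
        exact (d.1 i j).2.2
      μ := μ }
  refine ⟨X, ?_⟩
  have h1 := Measure.infinitePi_map_pi (fun _ : ℕ => uniformFin n) (f := fun _ => mk)
    (fun _ => hmk)
  change (Measure.infinitePi fun _ : ℕ => μ).map X.distMatrix = _
  rw [← h1, Measure.map_map X.measurable_distMatrix (by fun_prop)]
  rfl

/-- The function depends only on the entries in the leading `k × k` block. -/
def DependsOnBlock (k : ℕ) (f : DistMatrix → ℝ) : Prop :=
  ∀ d e : DistMatrix, (∀ i < k, ∀ j < k, d.1 i j = e.1 i j) → f d = f e

/-- The matrix with all entries outside the leading `k × k` block replaced by zero. -/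
def DistMatrix.trunc (k : ℕ) (d : DistMatrix) : DistMatrix :=
  ⟨fun i j => if i < k ∧ j < k then d.1 i j else 0,
    fun i j => by simp only [d.2.1 i j, and_comm], fun i => by simp [d.2.2]⟩

theorem DistMatrix.continuous_trunc (k : ℕ) : Continuous (trunc k) := by
  refine Continuous.subtype_mk (continuous_pi fun i => continuous_pi fun j => ?_) _
  by_cases h : i < k ∧ j < k
  · simpa only [if_pos h] using continuous_entry i j
  · simpa only [if_neg h] using continuous_const

/-- By compactness: along an ultrafilter of counterexamples the matrices converge, and their
truncations converge entrywise to the same limit. -/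
theorem eventually_trunc_close (f : DistMatrix → ℝ) (hf : Continuous f) {ε : ℝ} (hε : 0 < ε) :
    ∀ᶠ k in atTop, ∀ d, |f d - f (trunc k d)| < ε := by
  by_contra hcon
  rw [not_eventually] at hcon
  have hcon' : ∃ᶠ k in (atTop : Filter ℕ), ∃ d, ε ≤ |f d - f (trunc k d)| := by
    refine hcon.mono fun k hk => ?_
    push Not at hk
    exact hk
  obtain ⟨U, hU, hUP⟩ := exists_ultrafilter_iff.2 (frequently_iff_neBot.1 hcon')
    |>.imp fun U hU => (⟨hU.trans inf_le_left, hU.trans inf_le_right⟩ : _ ∧ _)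
  have hex : ∀ᶠ k in (U : Filter ℕ), ∃ d, ε ≤ |f d - f (trunc k d)| := le_principal_iff.1 hUP
  obtain ⟨D, hD⟩ := hex.choice
  obtain ⟨d, -, hd⟩ := isCompact_univ.ultrafilter_le_nhds (U.map D) (by simp)
  have hd : Tendsto D U (𝓝 d) := hd
  have hd' : Tendsto (fun k => trunc k (D k)) U (𝓝 d) := by
    rw [tendsto_subtype_rng, tendsto_pi_nhds]
    intro i
    rw [tendsto_pi_nhds]
    intro j
    have h1 : Tendsto (fun k => (D k).1 i j) U (𝓝 (d.1 i j)) :=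
      ((continuous_entry i j).tendsto d).comp hd
    refine h1.congr' ?_
    filter_upwards [hU (eventually_gt_atTop (max i j))] with k hk
    simp [trunc, (le_max_left i j).trans_lt hk, (le_max_right i j).trans_lt hk]
  have hlim := (((hf.tendsto d).comp hd).sub ((hf.tendsto d).comp hd')).abs
  rw [sub_self, abs_zero] at hlim
  have := ge_of_tendsto hlim hD
  linarith

theorem measurable_reindex_uncurry (n : ℕ) :
    Measurable fun p : (ℕ → Fin (n + 1)) × DistMatrix => reindex (fun i => (p.1 i : ℕ)) p.2 := by
  refine Measurable.subtype_mk (measurable_pi_lambda _ fun i => measurable_pi_lambda _ fun j => ?_)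
  have h : Measurable fun q : (Fin (n + 1) × Fin (n + 1)) × DistMatrix =>
      q.2.1 (q.1.1 : ℕ) (q.1.2 : ℕ) :=
    measurable_from_prod_countable_right fun a => measurable_entry (a.1 : ℕ) (a.2 : ℕ)
  exact h.comp (f := fun p : (ℕ → Fin (n + 1)) × DistMatrix => ((p.1 i, p.1 j), p.2))
    (by fun_prop)

/-- For an exchangeable and dissociated law, the average of a centred block function over
independent uniform indices has small second moment. -/
theorem integral_sq_average_le {ζ : Measure DistMatrix} [IsProbabilityMeasure ζ]
    (hζ : IsSamplingLaw ζ) {g : DistMatrix → ℝ} (hg : Measurable g) {M : ℝ}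
    (hM : ∀ d, |g d| ≤ M) {k : ℕ} (hk : DependsOnBlock k g) (h0 : ∫ d, g d ∂ζ = 0) (n : ℕ) :
    ∫ d, (∫ w, g (reindex (fun i => (w i : ℕ)) d)
        ∂(Measure.infinitePi fun _ : ℕ => uniformFin n)) ^ 2 ∂ζ ≤
      M ^ 2 * ((2 * k) ^ 2 / (n + 1)) := by
  set U := Measure.infinitePi fun _ : ℕ => uniformFin n with hU
  have hM0 : 0 ≤ M := (abs_nonneg _).trans (hM (ofUpper fun _ => 0))
  have hsplit := infinitePi_map_prod_of_disjoint (fun _ : ℕ => uniformFin n)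
      (f := fun i : ℕ => 2 * i) (g := fun i : ℕ => 2 * i + 1)
      (fun a b h => by simpa using h) (fun a b h => by simpa using h) (fun i j => by omega)
  -- The square of an average is a double average over two independent index sequences, here the
  -- even and the odd terms of a single one.
  let G : (ℕ → Fin (n + 1)) × DistMatrix → ℝ := fun p =>
    g (reindex (fun i => (p.1 (2 * i) : ℕ)) p.2) * g (reindex (fun i => (p.1 (2 * i + 1) : ℕ)) p.2)
  have hGm : Measurable G := by
    refine (hg.comp ?_).mul (hg.comp ?_)
    · exact (measurable_reindex_uncurry n).comp
        (f := fun p : (ℕ → Fin (n + 1)) × DistMatrix => ((fun i => p.1 (2 * i)), p.2))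
        (by fun_prop)
    · exact (measurable_reindex_uncurry n).comp
        (f := fun p : (ℕ → Fin (n + 1)) × DistMatrix => ((fun i => p.1 (2 * i + 1)), p.2))
        (by fun_prop)
  have hGb : ∀ p, |G p| ≤ M ^ 2 := fun p => by
    rw [abs_mul, sq]
    exact mul_le_mul (hM _) (hM _) (abs_nonneg _) hM0
  have hGi : Integrable G (U.prod ζ) :=
    Integrable.of_bound hGm.aestronglyMeasurable (M ^ 2) (Eventually.of_forall hGb)
  have hsec : ∀ d, Measurable fun w : ℕ → Fin (n + 1) => g (reindex (fun i => (w i : ℕ)) d) :=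
    fun d => hg.comp ((measurable_reindex_uncurry n).comp (measurable_id.prodMk measurable_const))
  have h1 : ∀ d, (∫ w, g (reindex (fun i => (w i : ℕ)) d) ∂U) ^ 2 = ∫ τ, G (τ, d) ∂U := by
    intro d
    have h2 := integral_prod_mul (μ := U) (ν := U)
      (fun w => g (reindex (fun i => (w i : ℕ)) d)) (fun w => g (reindex (fun i => (w i : ℕ)) d))
    rw [sq, ← h2, hU, ← hsplit, integral_map (by fun_prop)]
    exact (((hsec d).comp measurable_fst).mul ((hsec d).comp measurable_snd)).aestronglyMeasurable
  simp_rw [h1]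
  rw [integral_integral_swap (f := fun d τ => G (τ, d)) hGi.swap]
  -- Collisions among the first `2 * k` indices, which are all that the two `k`-blocks see. Each
  -- pair collides with probability `1 / (n + 1)`.
  let B : Set (ℕ → Fin (n + 1)) :=
    ⋃ m ∈ Finset.range (2 * k), ⋃ m' ∈ Finset.range (2 * k), {τ | m ≠ m' ∧ τ m = τ m'}
  have hBm : MeasurableSet B := by
    refine Finset.measurableSet_biUnion _ fun m _ => Finset.measurableSet_biUnion _ fun m' _ => ?_
    by_cases h : m = m'
    · simp [h]
    · simp only [ne_eq, h, not_false_eq_true, true_and]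
      exact measurableSet_eq_fun (by fun_prop) (by fun_prop)
  have hBmeas : U B ≤ ENNReal.ofReal ((2 * k) ^ 2 / (n + 1)) := by
    have hone : ∀ m m' : ℕ, U {τ | m ≠ m' ∧ τ m = τ m'} ≤ ((n : ℝ≥0∞) + 1)⁻¹ := by
      intro m m'
      by_cases h : m = m'
      · simp [h]
      · simp only [ne_eq, h, not_false_eq_true, true_and]
        have hpr := Measure.infinitePi_map_eval_prod (P := fun _ : ℕ => uniformFin n) h
        have hdm : MeasurableSet {q : Fin (n + 1) × Fin (n + 1) | q.1 = q.2} :=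
          measurableSet_eq_fun measurable_fst measurable_snd
        have : U {τ | τ m = τ m'} = ((uniformFin n).prod (uniformFin n)) {q | q.1 = q.2} := by
          rw [← hpr, Measure.map_apply (by fun_prop) hdm]; rfl
        rw [this, Measure.prod_apply hdm]
        have : ∀ i : Fin (n + 1), Prod.mk i ⁻¹' {q : Fin (n + 1) × Fin (n + 1) | q.1 = q.2} = {i} := by
          intro i; ext j; simp [eq_comm]
        simp [this, uniformFin_singleton]
    calc U B ≤ ∑ m ∈ Finset.range (2 * k), ∑ m' ∈ Finset.range (2 * k),
          U {τ | m ≠ m' ∧ τ m = τ m'} :=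
          (measure_biUnion_finset_le _ _).trans
            (Finset.sum_le_sum fun m _ => measure_biUnion_finset_le _ _)
      _ ≤ ∑ m ∈ Finset.range (2 * k), ∑ m' ∈ Finset.range (2 * k), ((n : ℝ≥0∞) + 1)⁻¹ :=
          Finset.sum_le_sum fun m _ => Finset.sum_le_sum fun m' _ => hone m m'
      _ = ENNReal.ofReal ((2 * k) ^ 2 / (n + 1)) := by
          rw [ENNReal.ofReal_div_of_pos (by positivity)]
          simp only [Finset.sum_const, Finset.card_range, nsmul_eq_mul]
          rw [ENNReal.ofReal_pow (by positivity), ENNReal.ofReal_mul (by norm_num),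
            ENNReal.ofReal_add (by positivity) (by norm_num)]
          simp [div_eq_mul_inv, sq, mul_assoc]
  have hgood : ∀ τ ∉ B, ∫ d, G (τ, d) ∂ζ = 0 := by
    intro τ hτ
    simp only [B, Set.mem_iUnion, Finset.mem_range, Set.mem_ofPred_eq, not_exists, not_and] at hτ
    -- Without collisions the relevant indices extend to an injection; the values from `n + 1` on
    -- are not taken by `τ`. Exchangeability then removes `φ`, and dissociation factors the integral
    -- into a product of zero means.
    let φ : ℕ → ℕ := fun m => if m < 2 * k then (τ m : ℕ) else n + 1 + m
    have hφ : Function.Injective φ := by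
      intro a b hab
      by_contra hne
      simp only [φ] at hab
      split_ifs at hab with ha hb hb
      · exact hτ a ha b hb hne (Fin.ext hab)
      · have := (τ a).2; omega
      · have := (τ b).2; omega
      · omega
    have hGφ : ∀ d, G (τ, d) = g (reindex (fun i => 2 * i) (reindex φ d)) *
        g (reindex (fun i => 2 * i + 1) (reindex φ d)) := by
      intro d
      simp only [G]
      congr 1 <;>
      · refine hk _ _ fun i hi j hj => ?_
        simp only [reindex_apply, φ]
        rw [if_pos (by omega), if_pos (by omega)]
    simp_rw [hGφ]
    have e1 : ∫ d, g (reindex (fun i => 2 * i) (reindex φ d)) *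
        g (reindex (fun i => 2 * i + 1) (reindex φ d)) ∂ζ =
        ∫ d, g (reindex (fun i => 2 * i) d) * g (reindex (fun i => 2 * i + 1) d) ∂ζ := by
      conv_rhs => rw [← hζ.exchangeable φ hφ]
      rw [integral_map (by fun_prop)]
      exact Measurable.aestronglyMeasurable (by fun_prop)
    have e2 : ∫ d, g (reindex (fun i => 2 * i) d) * g (reindex (fun i => 2 * i + 1) d) ∂ζ =
        ∫ p : DistMatrix × DistMatrix, g p.1 * g p.2 ∂(ζ.prod ζ) := by
      rw [← hζ.dissociated, integral_map (by fun_prop)]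
      exact Measurable.aestronglyMeasurable (by fun_prop)
    rw [e1, e2, integral_prod_mul, h0, zero_mul]
  calc ∫ τ, ∫ d, G (τ, d) ∂ζ ∂U ≤ ∫ τ, B.indicator (fun _ => M ^ 2) τ ∂U := by
        refine integral_mono hGi.integral_prod_left
          ((integrable_const _).indicator hBm) fun τ => ?_
        by_cases hτ : τ ∈ B
        · rw [Set.indicator_of_mem hτ]
          refine (le_abs_self _).trans ?_
          have := norm_integral_le_of_norm_le_const (μ := ζ)
            (Eventually.of_forall fun d => (Real.norm_eq_abs (G (τ, d))).trans_le (hGb (τ, d)))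
          simpa using this
        · simp only [hgood τ hτ, Set.indicator_of_notMem hτ, le_refl]
    _ = M ^ 2 * U.real B := by
        rw [integral_indicator_const _ hBm, smul_eq_mul, mul_comm]
    _ ≤ M ^ 2 * ((2 * k) ^ 2 / (n + 1)) := by
        gcongr
        rw [Measure.real]
        exact ENNReal.toReal_le_of_le_ofReal (by positivity) hBmeas

/-- A law of large numbers for one random matrix: resampling from its first points reproduces the
averages of finitely many block functions. One matrix serves all the test functions because the sum
of their mean square errors is small. -/
theorem mem_chiBar_of_isSamplingLaw {ζ : ProbabilityMeasure DistMatrix}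
    (hζ : IsSamplingLaw (ζ : Measure DistMatrix)) : ζ ∈ ChiBar := by
  classical
  refine mem_closure_of_forall_finset fun F ε hε => ?_
  have hev : ∀ᶠ k in atTop, ∀ f ∈ F, ∀ d, |f d - f (trunc k d)| < ε / 3 :=
    (Finset.eventually_all F).2 fun f _ =>
      eventually_trunc_close f f.continuous (by positivity)
  obtain ⟨k, hk⟩ := hev.exists
  have hfm : ∀ f : DistMatrix →ᵇ ℝ, Measurable fun d => f (trunc k d) := fun f =>
    (f.continuous.comp (continuous_trunc k)).measurable
  let c : (DistMatrix →ᵇ ℝ) → ℝ := fun f => ∫ d, f (trunc k d) ∂(ζ : Measure DistMatrix)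
  let g : (DistMatrix →ᵇ ℝ) → DistMatrix → ℝ := fun f d => f (trunc k d) - c f
  have hfi : ∀ (f : DistMatrix →ᵇ ℝ) (η : Measure DistMatrix) [IsProbabilityMeasure η],
      Integrable (fun d => f (trunc k d)) η := fun f η _ =>
    Integrable.of_bound (hfm f).aestronglyMeasurable ‖f‖
      (Eventually.of_forall fun d => f.norm_coe_le_norm _)
  have hgm : ∀ f, Measurable (g f) := fun f => (hfm f).sub_const _
  have hgb : ∀ f d, |g f d| ≤ 2 * ‖f‖ := fun f d => by
    have h1 := f.norm_coe_le_norm (trunc k d)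
    have h2 : ‖c f‖ ≤ ‖f‖ := by
      have := norm_integral_le_of_norm_le_const (μ := (ζ : Measure DistMatrix))
        (Eventually.of_forall fun d => f.norm_coe_le_norm (trunc k d))
      simpa using this
    have := norm_sub_le (f (trunc k d)) (c f)
    rw [← Real.norm_eq_abs]
    simp only [g]
    linarith
  have hg0 : ∀ f, ∫ d, g f d ∂(ζ : Measure DistMatrix) = 0 := fun f => by
    simp only [g]
    rw [integral_sub (hfi f _) (integrable_const _)]
    simp [c]
  have hgk : ∀ f, DependsOnBlock k (g f) := fun f d d' h => by
    have : trunc k d = trunc k d' := by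
      apply Subtype.ext
      funext i j
      simp only [trunc]
      split_ifs with hij
      · exact h i hij.1 j hij.2
      · rfl
    simp only [g, this]
  have hsum : Tendsto (fun n : ℕ => ∑ f ∈ F, (2 * ‖f‖) ^ 2 * ((2 * (k : ℝ)) ^ 2 / (n + 1)))
      atTop (𝓝 0) := by
    have hz : (0 : ℝ) = ∑ f ∈ F, 0 := Finset.sum_const_zero.symm
    rw [hz]
    refine tendsto_finsetSum _ fun f _ => ?_
    have := (tendsto_one_div_add_atTop_nhds_zero_nat (𝕜 := ℝ)).const_mul
      ((2 * ‖f‖) ^ 2 * (2 * (k : ℝ)) ^ 2)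
    rw [mul_zero] at this
    refine this.congr fun n => by ring
  obtain ⟨n, hn⟩ := (hsum.eventually (gt_mem_nhds (show (0 : ℝ) < (ε / 3) ^ 2 by positivity))).exists
  let A : (DistMatrix →ᵇ ℝ) → DistMatrix → ℝ := fun f d =>
    ∫ w, g f (reindex (fun i => (w i : ℕ)) d) ∂(Measure.infinitePi fun _ : ℕ => uniformFin n)
  have hAb : ∀ f d, |A f d| ≤ 2 * ‖f‖ := fun f d => by
    have := norm_integral_le_of_norm_le_const
      (μ := Measure.infinitePi fun _ : ℕ => uniformFin n)
      (Eventually.of_forall fun w => (Real.norm_eq_abs _).trans_le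
        (hgb f (reindex (fun i => (w i : ℕ)) d)))
    simpa using this
  have hAm : ∀ f, StronglyMeasurable (A f) := fun f => by
    have := ((hgm f).comp (measurable_reindex_uncurry n)).stronglyMeasurable
    exact this.integral_prod_left' (μ := Measure.infinitePi fun _ : ℕ => uniformFin n)
  have hAi : ∀ f, Integrable (fun d => A f d ^ 2) (ζ : Measure DistMatrix) := fun f =>
    Integrable.of_bound ((hAm f).pow 2).aestronglyMeasurable ((2 * ‖f‖) ^ 2)
      (Eventually.of_forall fun d => by
        rw [Real.norm_eq_abs, abs_pow]
        exact pow_le_pow_left₀ (abs_nonneg _) (hAb f d) 2)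
  have hint : ∫ d, ∑ f ∈ F, A f d ^ 2 ∂(ζ : Measure DistMatrix) < (ε / 3) ^ 2 := by
    rw [integral_finsetSum _ fun f _ => hAi f]
    refine lt_of_le_of_lt (Finset.sum_le_sum fun f _ => ?_) hn
    exact integral_sq_average_le hζ (hgm f) (hgb f) (hgk f) (hg0 f) n
  -- Some matrix outside the null set of triangle violations has total square error at most the
  -- mean.
  obtain ⟨d, hdN, hd⟩ := exists_notMem_null_le_integral
    (μ := (ζ : Measure DistMatrix)) (N := {d | ¬ ∀ i j k, (d.1 i k : ℝ) ≤ d.1 i j + d.1 j k})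
    (integrable_finsetSum F fun f _ => hAi f) hζ.triangle
  have hdt : ∀ i j k, (d.1 i k : ℝ) ≤ d.1 i j + d.1 j k := not_not.1 hdN
  obtain ⟨X, hX⟩ := exists_mmSpace_of_triangle d hdt n
  refine ⟨X.sampling, ⟨X, rfl⟩, fun f hf => ?_⟩
  have hA : |A f d| ≤ ε / 3 := by
    refine abs_le_of_sq_le_sq' ?_ (by positivity) |> abs_le.2
    refine le_trans ?_ (hd.trans hint.le)
    exact Finset.single_le_sum (f := fun f => A f d ^ 2) (fun f _ => sq_nonneg _) hf
  have hAeq : A f d = ∫ ω, f (trunc k ω) ∂(X.sampling : Measure DistMatrix) - c f := by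
    have hw : Measurable fun w : ℕ → Fin (n + 1) => reindex (fun i => (w i : ℕ)) d :=
      (measurable_reindex_uncurry n).comp (measurable_id.prodMk measurable_const)
    have : A f d = ∫ ω, g f ω ∂(X.sampling : Measure DistMatrix) := by
      rw [hX, integral_map hw.aemeasurable (hgm f).aestronglyMeasurable]
    rw [this]
    simp only [g]
    rw [integral_sub (hfi f _) (integrable_const _)]
    simp
  have hclose : ∀ (η : Measure DistMatrix) [IsProbabilityMeasure η],
      |∫ ω, f ω ∂η - ∫ ω, f (trunc k ω) ∂η| ≤ ε / 3 := by
    intro η _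
    rw [← integral_sub (f.integrable η) (hfi f η)]
    have := norm_integral_le_of_norm_le_const (μ := η)
      (f := fun ω => f ω - f (trunc k ω)) (Eventually.of_forall fun ω => (hk f hf ω).le)
    simpa using this
  have h1 := hclose (X.sampling : Measure DistMatrix)
  have h2 := hclose (ζ : Measure DistMatrix)
  rw [hAeq] at hA
  rw [abs_le] at *
  simp only [c] at hA
  constructor <;> linarith [h1.1, h1.2, h2.1, h2.2, hA.1, hA.2]

/-! ### Conditional probabilities and measure preserving relabelling -/

section CondProb

variable {Ω A B E : Type*} [MeasurableSpace Ω] [MeasurableSpace A] [MeasurableSpace B]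
  [MeasurableSpace E] {P : Measure Ω}

/-- `h ∘ v` is a version of the conditional probability of the event `S` given `v`. -/
def IsCondProb (P : Measure Ω) (S : Set Ω) (v : Ω → A) (h : A → ℝ≥0∞) : Prop :=
  (P.restrict S).map v = (P.map v).withDensity h

theorem IsCondProb.lintegral_eq {S : Set Ω} {v : Ω → A} {h : A → ℝ≥0∞}
    (H : IsCondProb P S v h) (hv : Measurable v) (hh : Measurable h) {k : A → ℝ≥0∞}
    (hk : Measurable k) : ∫⁻ ω in S, k (v ω) ∂P = ∫⁻ ω, h (v ω) * k (v ω) ∂P := by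
  rw [← lintegral_map hk hv, H, lintegral_withDensity_eq_lintegral_mul _ hh hk,
    lintegral_map (hh.mul hk) hv]
  rfl

theorem IsCondProb.integral_eq {S : Set Ω} {v : Ω → A} {h : A → ℝ≥0∞}
    (H : IsCondProb P S v h) (hv : Measurable v) (hh : Measurable h) (h1 : ∀ a, h a ≤ 1)
    {k : A → ℝ} (hk : Measurable k) :
    ∫ ω in S, k (v ω) ∂P = ∫ ω, (h (v ω)).toReal * k (v ω) ∂P := by
  rw [← integral_map hv.aemeasurable hk.aestronglyMeasurable, H,
    integral_withDensity_eq_integral_toReal_smul hh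
      (Eventually.of_forall fun a => (h1 a).trans_lt ENNReal.one_lt_top),
    integral_map hv.aemeasurable]
  · rfl
  · exact (hh.ennreal_toReal.smul hk).aestronglyMeasurable

variable [IsProbabilityMeasure P]

theorem exists_isCondProb {S : Set Ω} (W : Ω → B) (hW : Measurable W) :
    ∃ H : B → ℝ≥0∞, Measurable H ∧ (∀ b, H b ≤ 1) ∧ IsCondProb P S W H := by
  have hle : (P.restrict S).map W ≤ P.map W := Measure.map_mono Measure.restrict_le_self hW
  have : IsProbabilityMeasure (P.map W) := Measure.isProbabilityMeasure_map hW.aemeasurable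
  -- The density is at most one almost everywhere; the minimum makes the bound hold everywhere.
  refine ⟨fun b => min (((P.restrict S).map W).rnDeriv (P.map W) b) 1,
    (Measure.measurable_rnDeriv _ _).min measurable_const, fun b => min_le_right _ _, ?_⟩
  have h1 := Measure.withDensity_rnDeriv_eq _ _ hle.absolutelyContinuous
  have h2 := Measure.rnDeriv_le_one_of_le hle
  unfold IsCondProb
  conv_lhs => rw [← h1]
  refine withDensity_congr_ae ?_
  filter_upwards [h2] with b hb
  exact (min_eq_left hb).symm

/-- Two bounded functions with vanishing mean square difference agree almost everywhere. -/
theorem ae_eq_of_integral_sq {f g : Ω → ℝ} (hf : Measurable f) (hg : Measurable g)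
    (hf1 : ∀ ω, |f ω| ≤ 1) (hg1 : ∀ ω, |g ω| ≤ 1) {c : ℝ}
    (hff : ∫ ω, f ω * f ω ∂P = c) (hfg : ∫ ω, f ω * g ω ∂P = c) (hgg : ∫ ω, g ω * g ω ∂P = c) :
    f =ᵐ[P] g := by
  have hi : ∀ {a b : Ω → ℝ}, Measurable a → Measurable b → (∀ ω, |a ω| ≤ 1) → (∀ ω, |b ω| ≤ 1) →
      Integrable (fun ω => a ω * b ω) P := fun {a b} ha hb ha1 hb1 =>
    Integrable.of_bound (ha.mul hb).aestronglyMeasurable 1 (Eventually.of_forall fun ω => by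
      rw [Real.norm_eq_abs, abs_mul]
      exact mul_le_one₀ (ha1 ω) (abs_nonneg _) (hb1 ω))
  have hz : ∫ ω, (f ω - g ω) ^ 2 ∂P = 0 := by
    have : ∀ ω, (f ω - g ω) ^ 2 = f ω * f ω - 2 * (f ω * g ω) + g ω * g ω := fun ω => by ring
    simp_rw [this]
    have i1 := hi hf hf hf1 hf1
    have i2 := (hi hf hg hf1 hg1).const_mul 2
    rw [integral_add (f := fun ω => f ω * f ω - 2 * (f ω * g ω)) (i1.sub i2)
      (hi hg hg hg1 hg1), integral_sub i1 i2, integral_const_mul, hff, hfg, hgg]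
    ring
  have hint : Integrable (fun ω => (f ω - g ω) ^ 2) P :=
    Integrable.of_bound ((hf.sub hg).pow_const 2).aestronglyMeasurable 4
      (Eventually.of_forall fun ω => by
        have h1 := abs_le.1 (hf1 ω)
        have h2 := abs_le.1 (hg1 ω)
        rw [Real.norm_eq_abs, abs_of_nonneg (sq_nonneg _)]
        nlinarith)
  rw [integral_eq_zero_iff_of_nonneg (fun ω => sq_nonneg _) hint] at hz
  filter_upwards [hz] with ω hω
  have : (f ω - g ω) ^ 2 = 0 := hω
  nlinarith [pow_eq_zero_iff (n := 2) (by norm_num) |>.1 this]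

/-- If a measure preserving map fixes the event `S` and turns the data `W` into a function of the
coarser data `v`, then `S` has the same conditional probability given `W` as given `v`. -/
theorem IsCondProb.of_measurePreserving {S : Set Ω} (hS : MeasurableSet S) {v : Ω → A} {W : Ω → B}
    {p : B → A} {u : A → B} {T : Ω → Ω} {h : A → ℝ≥0∞} (hv : Measurable v) (hW : Measurable W)
    (hp : Measurable p) (hu : Measurable u) (hT : MeasurePreserving T P P)
    (hpW : ∀ ω, p (W ω) = v ω) (hTS : T ⁻¹' S = S) (hTW : ∀ ω, W (T ω) = u (v ω))
    (hh : Measurable h) (h1 : ∀ a, h a ≤ 1) (H : IsCondProb P S v h) :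
    IsCondProb P S W (fun b => h (p b)) := by
  obtain ⟨G, hG, hG1, hGW⟩ := exists_isCondProb (P := P) (S := S) W hW
  have hb : ∀ {x : ℝ≥0∞}, x ≤ 1 → |x.toReal| ≤ 1 := fun {x} hx => by
    rw [abs_of_nonneg ENNReal.toReal_nonneg]
    exact ENNReal.toReal_le_of_le_ofReal (by norm_num) (by simpa using hx)
  let g : B → ℝ := fun b => (G b).toReal
  have hg : Measurable g := hG.ennreal_toReal
  let f : A → ℝ := fun a => (h a).toReal
  have hf : Measurable f := hh.ennreal_toReal
  have hTi : ∀ {k : Ω → ℝ}, Measurable k → ∫ ω, k (T ω) ∂P = ∫ ω, k ω ∂P := fun {k} hk => by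
    conv_rhs => rw [← hT.map_eq]
    rw [integral_map hT.measurable.aemeasurable hk.aestronglyMeasurable]
  have hTS' : ∀ {k : Ω → ℝ}, Measurable k → ∫ ω in S, k (T ω) ∂P = ∫ ω in S, k ω ∂P :=
    fun {k} hk => by
    rw [← integral_indicator hS, ← integral_indicator hS, ← hTi (hk.indicator hS)]
    congr 1
    funext ω
    have : T ω ∈ S ↔ ω ∈ S := by
      constructor
      · intro hω; rw [← hTS]; exact hω
      · intro hω; rw [← hTS] at hω; exact hω
    by_cases hω : ω ∈ S
    · rw [Set.indicator_of_mem hω, Set.indicator_of_mem (this.2 hω)]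
    · rw [Set.indicator_of_notMem hω, Set.indicator_of_notMem (fun h => hω (this.1 h))]
  -- Here `g ∘ W` is the conditional probability given `W`, and `g ∘ u ∘ v` is its composition with
  -- `T`, so the norms agree. As `v` is a function of `W`, their inner product is the integral of `g
  -- ∘ W ∘ T` over the invariant event `S`, that is, the square of the same norm.
  have e1 : (fun ω => g (W ω)) =ᵐ[P] fun ω => g (u (v ω)) := by
    refine ae_eq_of_integral_sq (c := ∫ ω, g (W ω) * g (W ω) ∂P) (hg.comp hW)
      (hg.comp (hu.comp hv)) (fun ω => hb (hG1 _)) (fun ω => hb (hG1 _)) rfl ?_ ?_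
    · have q1 := hGW.integral_eq hW hG hG1 (k := fun b => g (u (p b)))
        (hg.comp (hu.comp hp))
      have q2 := hGW.integral_eq hW hG hG1 (k := g) hg
      simp only [hpW] at q1
      rw [← q1, ← q2, ← hTS' (k := fun ω => g (W ω)) (hg.comp hW)]
      simp only [hTW]
    · rw [← hTi (k := fun ω => g (W ω) * g (W ω)) ((hg.comp hW).mul (hg.comp hW))]
      simp only [hTW]
  -- By `e1` the conditional probability given `W` is already a function of `v`, so it is the one
  -- given `v`.
  have e2 : (fun ω => f (v ω)) =ᵐ[P] fun ω => g (u (v ω)) := by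
    have key : ∀ {k : A → ℝ}, Measurable k →
        ∫ ω, f (v ω) * k (v ω) ∂P = ∫ ω, g (u (v ω)) * k (v ω) ∂P := fun {k} hk => by
      have q1 := H.integral_eq hv hh h1 (k := k) hk
      have q2 := hGW.integral_eq hW hG hG1 (k := fun b => k (p b)) (hk.comp hp)
      simp only [hpW] at q2
      rw [← q1, q2]
      refine integral_congr_ae ?_
      filter_upwards [e1] with ω hω
      change g (W ω) * _ = _
      rw [hω]
    refine ae_eq_of_integral_sq (c := ∫ ω, f (v ω) * f (v ω) ∂P) (hf.comp hv)
      (hg.comp (hu.comp hv)) (fun ω => hb (h1 _)) (fun ω => hb (hG1 _)) rfl ?_ ?_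
    · rw [key hf]
      simp only [mul_comm]
    · rw [← key (k := fun a => g (u a)) (hg.comp hu), key hf]
      simp only [mul_comm]
  unfold IsCondProb
  rw [hGW]
  refine withDensity_congr_ae ?_
  rw [EventuallyEq, ae_map_iff hW.aemeasurable
    (measurableSet_eq_fun (g := fun b => h (p b)) hG (hh.comp hp))]
  filter_upwards [e1, e2] with ω q1 q2
  rw [hpW]
  have : (G (W ω)).toReal = (h (v ω)).toReal := q1.trans q2.symm
  exact (ENNReal.toReal_eq_toReal_iff' ((hG1 _).trans_lt ENNReal.one_lt_top).ne
    ((h1 _).trans_lt ENNReal.one_lt_top).ne).1 this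

theorem isCondProb_condDistrib [StandardBorelSpace E] [Nonempty E] {e : Ω → E} (he : Measurable e)
    {v : Ω → A} (hv : Measurable v) {s : Set E} (hs : MeasurableSet s) :
    IsCondProb P (e ⁻¹' s) v (fun a => condDistrib e v P a s) := by
  unfold IsCondProb
  ext t ht
  rw [Measure.map_apply hv ht, Measure.restrict_apply (hv ht), withDensity_apply _ ht,
    Measure.restrict_map hv ht, lintegral_map ((condDistrib e v P).measurable_coe hs) hv,
    setLIntegral_preimage_condDistrib hv he.aemeasurable hs ht]

/-- The joint law of `v` and a countable family of random elements is determined by the conditional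
probabilities of finite-dimensional boxes. -/
theorem map_eq_compProd_of_box {ι : Type*} [Countable ι] {v : Ω → A} (hv : Measurable v)
    {z : Ω → ι → E} (hz : Measurable z) (κ : Kernel A (ι → E)) [IsMarkovKernel κ]
    (h : ∀ (J : Finset ι) (t : ι → Set E), (∀ i, MeasurableSet (t i)) → ∀ B, MeasurableSet B →
      P (v ⁻¹' B ∩ z ⁻¹' ((J : Set ι).pi t)) = ∫⁻ ω in v ⁻¹' B, κ (v ω) ((J : Set ι).pi t) ∂P) :
    P.map (fun ω => (v ω, z ω)) = (P.map v) ⊗ₘ κ := by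
  have : IsProbabilityMeasure (P.map v) := Measure.isProbabilityMeasure_map hv.aemeasurable
  refine Measure.ext_prod fun {B C} hB hC => ?_
  rw [Measure.map_apply (hv.prodMk hz) (hB.prod hC), Measure.compProd_apply_prod hB hC,
    Measure.restrict_map hv hB, lintegral_map (κ.measurable_coe hC) hv]
  have hm : Measurable fun ω => κ (v ω) := κ.measurable.comp hv
  have key : (P.restrict (v ⁻¹' B)).map z = (P.restrict (v ⁻¹' B)).bind fun ω => κ (v ω) := by
    refine ext_of_generate_finite _ (generateFrom_squareCylinders (α := fun _ : ι => E)).symm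
      (isPiSystem_squareCylinders (fun _ => MeasurableSpace.isPiSystem_measurableSet)
      (fun _ => MeasurableSet.univ (α := E))) ?_ ?_
    · rintro _ ⟨J, t, ht, rfl⟩
      have hbox : MeasurableSet ((J : Set ι).pi t) :=
        .pi J.countable_toSet fun p _ => ht p (Set.mem_univ p)
      rw [Measure.map_apply hz hbox, Measure.restrict_apply (hz hbox),
        Measure.bind_apply hbox hm.aemeasurable, Set.inter_comm]
      exact h J t (fun i => ht i (Set.mem_univ i)) B hB
    · rw [Measure.map_apply hz .univ, Measure.bind_apply .univ hm.aemeasurable]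
      simp
  have := congrArg (fun m => m C) key
  simp only [Measure.map_apply hz hC, Measure.bind_apply hC hm.aemeasurable,
    Measure.restrict_apply (hz hC)] at this
  rw [← this, Set.inter_comm]
  rfl

end CondProb

/-! ### Representation of sampling laws by qmm-spaces -/

theorem IsCondProb.comp_measurePreserving {Ω A : Type*} [MeasurableSpace Ω] [MeasurableSpace A]
    {P : Measure Ω} {S : Set Ω} (hS : MeasurableSet S) {v : Ω → A} (hv : Measurable v)
    {h : A → ℝ≥0∞} {T : Ω → Ω} (hT : MeasurePreserving T P P) (H : IsCondProb P S v h) :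
    IsCondProb P (T ⁻¹' S) (v ∘ T) h := by
  unfold IsCondProb at *
  rw [← Measure.map_map hv hT.measurable, ← Measure.map_map hv hT.measurable,
    ← Measure.restrict_map hT.measurable hS, hT.map_eq, H]

theorem IsSamplingLaw.measurePreserving {ζ : Measure DistMatrix} (hζ : IsSamplingLaw ζ)
    {φ : ℕ → ℕ} (hφ : Function.Injective φ) : MeasurePreserving (reindex φ) ζ ζ :=
  ⟨measurable_reindex φ, hζ.exchangeable φ hφ⟩

/-- The subarray at odd positions. -/
def oddPart (w : ℕ → ℕ → I) : ℕ → ℕ → I := fun i j => w (2 * i + 1) (2 * j + 1)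

/-- The entries of the even row `2 * p` at odd positions. -/
def oddRow (p : ℕ) (w : ℕ → ℕ → I) : ℕ → I := fun k => w (2 * p) (2 * k + 1)

/-- The array with the entries at the pair `{2 * p, 2 * q}` erased. -/
def erasePair (p q : ℕ) (w : ℕ → ℕ → I) : ℕ → ℕ → I := fun i j =>
  if (i = 2 * p ∧ j = 2 * q) ∨ (i = 2 * q ∧ j = 2 * p) then 0 else w i j

/-- The array with the row and the column at `2 * p` erased. -/
def eraseRow (p : ℕ) (w : ℕ → ℕ → I) : ℕ → ℕ → I := fun i j =>
  if i = 2 * p ∨ j = 2 * p then 0 else w i j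

@[fun_prop] theorem measurable_oddPart : Measurable oddPart := by unfold oddPart; fun_prop

@[fun_prop] theorem measurable_oddRow (p : ℕ) : Measurable (oddRow p) := by
  unfold oddRow; fun_prop

theorem measurable_erasePair (p q : ℕ) : Measurable (erasePair p q) := by
  refine measurable_pi_lambda _ fun i => measurable_pi_lambda _ fun j => ?_
  unfold erasePair
  split_ifs <;> fun_prop

theorem measurable_eraseRow (p : ℕ) : Measurable (eraseRow p) := by
  refine measurable_pi_lambda _ fun i => measurable_pi_lambda _ fun j => ?_
  unfold eraseRow
  split_ifs <;> fun_prop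

theorem oddPart_erasePair (p q : ℕ) (w : ℕ → ℕ → I) : oddPart (erasePair p q w) = oddPart w := by
  funext i j
  simp only [oddPart, erasePair]
  rw [if_neg (by omega)]

theorem oddRow_erasePair (p q r : ℕ) (w : ℕ → ℕ → I) :
    oddRow r (erasePair p q w) = oddRow r w := by
  funext i
  simp only [oddRow, erasePair]
  rw [if_neg (by omega)]

theorem oddPart_eraseRow (p : ℕ) (w : ℕ → ℕ → I) : oddPart (eraseRow p w) = oddPart w := by
  funext i j
  simp only [oddPart, eraseRow]
  rw [if_neg (by omega)]

theorem oddRow_eraseRow {p r : ℕ} (h : r ≠ p) (w : ℕ → ℕ → I) :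
    oddRow r (eraseRow p w) = oddRow r w := by
  funext i
  simp only [oddRow, eraseRow]
  rw [if_neg (by omega)]

/-! ### Conditional independence of rows and entries -/

section

variable (ζ : Measure DistMatrix) [IsProbabilityMeasure ζ]

/-- The conditional law of an even-odd row given the odd subarray. -/
def rowKernel : Kernel (ℕ → ℕ → I) (ℕ → I) :=
  condDistrib (fun d : DistMatrix => oddRow 0 d.1) (fun d => oddPart d.1) ζ

/-- The conditional law of an entry at an even-even position given the odd subarray and the two
rows at its position. -/
def entryKernel : Kernel ((ℕ → ℕ → I) × (ℕ → I) × (ℕ → I)) I :=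
  condDistrib (fun d : DistMatrix => d.1 (2 * 0) (2 * 1))
    (fun d => (oddPart d.1, oddRow 0 d.1, oddRow 1 d.1)) ζ

instance : IsMarkovKernel (rowKernel ζ) := by unfold rowKernel; infer_instance

instance : IsMarkovKernel (entryKernel ζ) := by unfold entryKernel; infer_instance

variable {ζ}

/-- The relabelling fixes `2 * p` and `2 * q` and sends all other indices to odd ones. The entry
stays, while the rest of the array becomes a function of the odd subarray and the two rows, so the
rest carries no further information on the entry. -/
theorem isCondProb_entry (hζ : IsSamplingLaw ζ) {p q : ℕ} (hpq : p ≠ q) {s : Set I}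
    (hs : MeasurableSet s) :
    IsCondProb ζ {d | d.1 (2 * p) (2 * q) ∈ s} (fun d => erasePair p q d.1)
      (fun w => entryKernel ζ (oddPart w, oddRow p w, oddRow q w) s) := by
  have hv : ∀ p q : ℕ, Measurable fun d : DistMatrix => (oddPart d.1, oddRow p d.1, oddRow q d.1) :=
    fun p q => by fun_prop
  have h0 : IsCondProb ζ ((fun d : DistMatrix => d.1 (2 * 0) (2 * 1)) ⁻¹' s)
      (fun d => (oddPart d.1, oddRow 0 d.1, oddRow 1 d.1)) (fun a => entryKernel ζ a s) :=
    isCondProb_condDistrib (measurable_entry _ _) (hv 0 1) hs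
  have h1 : IsCondProb ζ {d | d.1 (2 * p) (2 * q) ∈ s}
      (fun d => (oddPart d.1, oddRow p d.1, oddRow q d.1)) (fun a => entryKernel ζ a s) := by
    -- Fixes the odd indices and carries the pair 0, 2 in the definition of `entryKernel` to the
    -- given pair; the shift keeps the other even indices away from it.
    let ψ : ℕ → ℕ := fun n => if n % 2 = 1 then n else if n = 0 then 2 * p else
      if n = 2 then 2 * q else n + 2 * (p + q + 1)
    have hψ : Function.Injective ψ := by
      intro a b hab
      simp only [ψ] at hab
      split_ifs at hab <;> omega
    have hψo : ∀ n, ψ (2 * n + 1) = 2 * n + 1 := fun n => by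
      simp only [ψ]; rw [if_pos (by omega)]
    have hψ0 : ψ (2 * 0) = 2 * p := by simp [ψ]
    have hψ1 : ψ (2 * 1) = 2 * q := by simp [ψ]
    have := h0.comp_measurePreserving (measurable_entry _ _ hs) (hv 0 1) (hζ.measurePreserving hψ)
    have e1 : {d : DistMatrix | d.1 (2 * p) (2 * q) ∈ s} =
        reindex ψ ⁻¹' ((fun d : DistMatrix => d.1 (2 * 0) (2 * 1)) ⁻¹' s) := by
      ext d
      simp only [Set.mem_ofPred_eq, Set.mem_preimage, reindex_apply, hψ0, hψ1]
    have e2 : (fun d : DistMatrix => (oddPart d.1, oddRow p d.1, oddRow q d.1)) =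
        (fun d : DistMatrix => (oddPart d.1, oddRow 0 d.1, oddRow 1 d.1)) ∘ reindex ψ := by
      funext d
      refine Prod.ext ?_ (Prod.ext ?_ ?_)
      · funext i j; simp only [Function.comp_apply, oddPart, reindex_apply, hψo]
      · funext i; simp only [Function.comp_apply, oddRow, reindex_apply, hψo, hψ0]
      · funext i; simp only [Function.comp_apply, oddRow, reindex_apply, hψo, hψ1]
    rw [e1, e2]
    exact this
  obtain ⟨φ, hφ, hφp, hφq, hφn⟩ : ∃ φ : ℕ → ℕ, Function.Injective φ ∧ φ (2 * p) = 2 * p ∧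
      φ (2 * q) = 2 * q ∧ ∀ n, n ≠ 2 * p → n ≠ 2 * q → φ n = 2 * n + 1 := by
    refine ⟨fun n => if n = 2 * p then 2 * p else if n = 2 * q then 2 * q else 2 * n + 1,
      fun a b hab => ?_, by simp, ?_, fun n h1 h2 => ?_⟩
    · simp only at hab
      split_ifs at hab <;> omega
    · simp only
      split_ifs <;> omega
    · simp only [if_neg h1, if_neg h2]
  -- Reconstructs the relabelled array. The zeros are the erased pair and the two diagonal entries.
  let u : (ℕ → ℕ → I) × (ℕ → I) × (ℕ → I) → ℕ → ℕ → I := fun a i j =>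
    if i = 2 * p then (if j = 2 * p ∨ j = 2 * q then 0 else a.2.1 j)
    else if i = 2 * q then (if j = 2 * p ∨ j = 2 * q then 0 else a.2.2 j)
    else if j = 2 * p then a.2.1 i
    else if j = 2 * q then a.2.2 i
    else a.1 i j
  have hu : Measurable u := by
    refine measurable_pi_lambda _ fun i => measurable_pi_lambda _ fun j => ?_
    simp only [u]
    split_ifs <;> fun_prop
  have hpq' : 2 * q ≠ 2 * p := by omega
  have hTW : ∀ d : DistMatrix,
      erasePair p q (reindex φ d).1 = u (oddPart d.1, oddRow p d.1, oddRow q d.1) := by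
    intro d
    have hsym : ∀ a b, d.1 a b = d.1 b a := d.2.1
    have hz : ∀ a, d.1 a a = 0 := d.2.2
    funext i j
    simp only [erasePair, reindex_apply, u, oddPart, oddRow]
    rcases eq_or_ne i (2 * p) with rfl | hip
    · rcases eq_or_ne j (2 * p) with rfl | hjp
      · simp [hφp, hz]
      rcases eq_or_ne j (2 * q) with rfl | hjq
      · simp
      · rw [if_neg (by omega), if_pos rfl, if_neg (by omega), hφp, hφn j hjp hjq]
    rcases eq_or_ne i (2 * q) with rfl | hiq
    · rcases eq_or_ne j (2 * p) with rfl | hjp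
      · simp [hpq']
      rcases eq_or_ne j (2 * q) with rfl | hjq
      · simp [hpq', hφq, hz]
      · rw [if_neg (by omega), if_neg hip, if_pos rfl, if_neg (by omega), hφq, hφn j hjp hjq]
    rw [if_neg (by omega), if_neg hip, if_neg hiq, hφn i hip hiq]
    rcases eq_or_ne j (2 * p) with rfl | hjp
    · rw [if_pos rfl, hφp, hsym]
    rcases eq_or_ne j (2 * q) with rfl | hjq
    · rw [if_neg hjp, if_pos rfl, hφq, hsym]
    · rw [if_neg hjp, if_neg hjq, hφn j hjp hjq]
  have hTS : reindex φ ⁻¹' {d : DistMatrix | d.1 (2 * p) (2 * q) ∈ s} =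
      {d : DistMatrix | d.1 (2 * p) (2 * q) ∈ s} := by
    ext d
    simp only [Set.mem_ofPred_eq, Set.mem_preimage, reindex_apply, hφp, hφq]
  have hp : Measurable fun w : ℕ → ℕ → I => (oddPart w, oddRow p w, oddRow q w) := by fun_prop
  have hpW : ∀ d : DistMatrix, (fun w : ℕ → ℕ → I => (oddPart w, oddRow p w, oddRow q w))
      (erasePair p q d.1) = (oddPart d.1, oddRow p d.1, oddRow q d.1) := fun d => by
    simp only [oddPart_erasePair, oddRow_erasePair]
  have hS : MeasurableSet {d : DistMatrix | d.1 (2 * p) (2 * q) ∈ s} := measurable_entry _ _ hs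
  have hW : Measurable fun d : DistMatrix => erasePair p q d.1 :=
    (measurable_erasePair p q).comp measurable_subtype_coe
  have hk : Measurable fun a => entryKernel ζ a s := (entryKernel ζ).measurable_coe hs
  have hk1 : ∀ a, entryKernel ζ a s ≤ 1 := fun a => prob_le_one
  have hT := hζ.measurePreserving hφ
  exact IsCondProb.of_measurePreserving (P := ζ)
    (S := {d : DistMatrix | d.1 (2 * p) (2 * q) ∈ s})
    (v := fun d => (oddPart d.1, oddRow p d.1, oddRow q d.1)) (W := fun d => erasePair p q d.1)
    (p := fun w => (oddPart w, oddRow p w, oddRow q w)) (u := u) (T := reindex φ)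
    (h := fun a => entryKernel ζ a s) hS (hv p q) hW hp hu hT hpW hTS hTW hk hk1 h1

/-- A relabelling cannot fix all odd indices and still push the remaining ones into odd positions
injectively. It can do so while fixing only finitely many of them, which suffices for cylinder
events; these determine the conditional law of the whole row. -/
theorem isCondProb_row (hζ : IsSamplingLaw ζ) (p : ℕ) {s : Set (ℕ → I)}
    (hs : MeasurableSet s) :
    IsCondProb ζ {d | oddRow p d.1 ∈ s} (fun d => eraseRow p d.1)
      (fun w => rowKernel ζ (oddPart w) s) := by
  have hv : Measurable fun d : DistMatrix => oddPart d.1 := by fun_prop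
  have hr : ∀ p, Measurable fun d : DistMatrix => oddRow p d.1 := fun p => by fun_prop
  have hW : Measurable fun d : DistMatrix => eraseRow p d.1 :=
    (measurable_eraseRow p).comp measurable_subtype_coe
  have h1 : ∀ {s : Set (ℕ → I)}, MeasurableSet s → IsCondProb ζ {d | oddRow p d.1 ∈ s}
      (fun d => oddPart d.1) (fun a => rowKernel ζ a s) := fun {s} hs => by
    have h0 : IsCondProb ζ ((fun d : DistMatrix => oddRow 0 d.1) ⁻¹' s)
      (fun d => oddPart d.1) (fun a => rowKernel ζ a s) :=
      isCondProb_condDistrib (hr 0) hv hs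
    let ψ : ℕ → ℕ := fun n => if n % 2 = 1 then n else if n = 0 then 2 * p else n + 2 * p
    have hψ : Function.Injective ψ := by
      intro a b hab
      simp only [ψ] at hab
      split_ifs at hab <;> omega
    have hψo : ∀ n, ψ (2 * n + 1) = 2 * n + 1 := fun n => by
      simp only [ψ]; rw [if_pos (by omega)]
    have hψ0 : ψ (2 * 0) = 2 * p := by simp [ψ]
    have := h0.comp_measurePreserving (hr 0 hs) hv (hζ.measurePreserving hψ)
    have e1 : {d : DistMatrix | oddRow p d.1 ∈ s} =
        reindex ψ ⁻¹' ((fun d : DistMatrix => oddRow 0 d.1) ⁻¹' s) := by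
      ext d
      have : oddRow 0 (reindex ψ d).1 = oddRow p d.1 := by
        funext i; simp only [oddRow, reindex_apply, hψo, hψ0]
      simp only [Set.mem_ofPred_eq, Set.mem_preimage, this]
    have e2 : (fun d : DistMatrix => oddPart d.1) =
        (fun d : DistMatrix => oddPart d.1) ∘ reindex ψ := by
      funext d i j
      simp only [Function.comp_apply, oddPart, reindex_apply, hψo]
    rw [e1, e2]
    exact this
  have hcyl : ∀ (J : Finset ℕ) (t : ℕ → Set I), (∀ i, MeasurableSet (t i)) →
      IsCondProb ζ {d | oddRow p d.1 ∈ (J : Set ℕ).pi t} (fun d => eraseRow p d.1)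
        (fun w => rowKernel ζ (oddPart w) ((J : Set ℕ).pi t)) := by
    intro J t ht
    have hbox : MeasurableSet ((J : Set ℕ).pi t) := .pi J.countable_toSet fun i _ => ht i
    obtain ⟨k, hk⟩ : ∃ k, ∀ j ∈ J, j < k := ⟨J.sup id + 1, fun j hj =>
      Nat.lt_succ_of_le (Finset.le_sup (f := id) hj)⟩
    obtain ⟨φ', hφ', hφ'k⟩ : ∃ φ' : ℕ → ℕ, (∀ a b, φ' a = φ' b → a = b) ∧
        ∀ j < k, φ' (2 * j + 1) = j := by
      -- The values below `k` are reserved for the first `k` odd indices, which `φ` must fix.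
      refine ⟨fun n => if n % 2 = 1 ∧ n / 2 < k then n / 2 else n + k, fun a b hab => ?_,
        fun j hj => ?_⟩
      · simp only at hab
        split_ifs at hab <;> omega
      · simp only
        rw [if_pos (by omega)]
        omega
    obtain ⟨φ, hφ, hφp, hφn⟩ : ∃ φ : ℕ → ℕ, Function.Injective φ ∧ φ (2 * p) = 2 * p ∧
        ∀ n, n ≠ 2 * p → φ n = 2 * φ' n + 1 := by
      refine ⟨fun n => if n = 2 * p then 2 * p else 2 * φ' n + 1, fun a b hab => ?_, by simp,
        fun n h => by simp only [if_neg h]⟩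
      simp only at hab
      split_ifs at hab with h1 h2 h2
      · omega
      · omega
      · omega
      · exact hφ' a b (by omega)
    let u : (ℕ → ℕ → I) → ℕ → ℕ → I := fun a i j =>
      if i = 2 * p ∨ j = 2 * p then 0 else a (φ' i) (φ' j)
    have hu : Measurable u := by
      refine measurable_pi_lambda _ fun i => measurable_pi_lambda _ fun j => ?_
      simp only [u]
      split_ifs <;> fun_prop
    have hTS : reindex φ ⁻¹' {d : DistMatrix | oddRow p d.1 ∈ (J : Set ℕ).pi t} =
        {d : DistMatrix | oddRow p d.1 ∈ (J : Set ℕ).pi t} := by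
      ext d
      simp only [Set.mem_ofPred_eq, Set.mem_preimage, Set.mem_pi]
      refine forall₂_congr fun j hj => ?_
      have : oddRow p (reindex φ d).1 j = oddRow p d.1 j := by
        simp only [oddRow, reindex_apply, hφp, hφn (2 * j + 1) (by omega), hφ'k j (hk j hj)]
      rw [this]
    have hTW : ∀ d : DistMatrix, eraseRow p (reindex φ d).1 = u (oddPart d.1) := by
      intro d
      funext i j
      simp only [eraseRow, reindex_apply, u, oddPart]
      by_cases h : i = 2 * p ∨ j = 2 * p
      · rw [if_pos h, if_pos h]
      · rw [if_neg h, if_neg h, hφn i (by omega), hφn j (by omega)]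
    have hS : MeasurableSet {d : DistMatrix | oddRow p d.1 ∈ (J : Set ℕ).pi t} := hr p hbox
    have hk : Measurable fun a => rowKernel ζ a ((J : Set ℕ).pi t) :=
      (rowKernel ζ).measurable_coe hbox
    have hk1 : ∀ a, rowKernel ζ a ((J : Set ℕ).pi t) ≤ 1 := fun a => prob_le_one
    have hT := hζ.measurePreserving hφ
    exact IsCondProb.of_measurePreserving (P := ζ)
      (S := {d : DistMatrix | oddRow p d.1 ∈ (J : Set ℕ).pi t})
      (v := fun d => oddPart d.1) (W := fun d => eraseRow p d.1) (p := oddPart) (u := u)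
      (T := reindex φ) (h := fun a => rowKernel ζ a ((J : Set ℕ).pi t))
      hS hv hW measurable_oddPart hu hT (fun d => oddPart_eraseRow p d.1) hTS hTW hk hk1 (h1 hbox)
  have key := map_eq_compProd_of_box (P := ζ) hW (hr p)
    ((rowKernel ζ).comap oddPart measurable_oddPart) (fun J t ht B hB => by
      have hbox : MeasurableSet ((J : Set ℕ).pi t) := .pi J.countable_toSet fun i _ => ht i
      have hm : Measurable fun w : ℕ → ℕ → I => rowKernel ζ (oddPart w) ((J : Set ℕ).pi t) :=
        ((rowKernel ζ).measurable_coe hbox).comp measurable_oddPart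
      have := congrArg (fun m => m B) (hcyl J t ht)
      simp only [Measure.map_apply hW hB, Measure.restrict_apply (hW hB), withDensity_apply _ hB,
        Measure.restrict_map hW hB, lintegral_map hm hW] at this
      exact this)
  unfold IsCondProb
  ext B hB
  have hm : Measurable fun w : ℕ → ℕ → I => rowKernel ζ (oddPart w) s :=
        ((rowKernel ζ).measurable_coe hs).comp measurable_oddPart
  have := congrArg (fun m => m (B ×ˢ s)) key
  simp only [Measure.map_apply (hW.prodMk (hr p)) (hB.prod hs),
    Measure.compProd_apply_prod hB hs] at this
  rw [Measure.map_apply hW hB, Measure.restrict_apply (hW hB), withDensity_apply _ hB]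
  exact this

/-- The symmetrised conditional law of an entry. -/
def symmEntryKernel (ζ : Measure DistMatrix) [IsProbabilityMeasure ζ] :
    Kernel ((ℕ → ℕ → I) × (ℕ → I) × (ℕ → I)) I where
  -- The conditional law is symmetric in the two rows only up to null sets, whereas a qmm-space
  -- needs exact symmetry; averaging the two orders gives a symmetric version.
  toFun z := (2⁻¹ : ℝ≥0∞) • (entryKernel ζ z + entryKernel ζ (z.1, z.2.2, z.2.1))
  measurable' := by
    refine Measure.measurable_of_measurable_coe _ fun s hs => ?_
    simp only [Measure.smul_apply, Measure.add_apply, smul_eq_mul]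
    have h1 := (entryKernel ζ).measurable_coe hs
    have h2 : Measurable fun z : (ℕ → ℕ → I) × (ℕ → I) × (ℕ → I) =>
        entryKernel ζ (z.1, z.2.2, z.2.1) s :=
      h1.comp (by fun_prop : Measurable fun z : (ℕ → ℕ → I) × (ℕ → I) × (ℕ → I) =>
        (z.1, z.2.2, z.2.1))
    exact (h1.add h2).const_mul _

theorem symmEntryKernel_apply (z : (ℕ → ℕ → I) × (ℕ → I) × (ℕ → I)) (s : Set I) :
    symmEntryKernel ζ z s =
      2⁻¹ * (entryKernel ζ z s + entryKernel ζ (z.1, z.2.2, z.2.1) s) := rfl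

theorem symmEntryKernel_comm (a : ℕ → ℕ → I) (r r' : ℕ → I) :
    symmEntryKernel ζ (a, r, r') = symmEntryKernel ζ (a, r', r) := by
  ext s
  simp only [symmEntryKernel_apply, add_comm]

instance : IsMarkovKernel (symmEntryKernel ζ) := ⟨fun z => ⟨by
  rw [symmEntryKernel_apply]
  simp only [measure_univ]
  rw [one_add_one_eq_two]
  exact ENNReal.inv_mul_cancel (by norm_num) (by norm_num)⟩⟩

/-- Conditional independence of the even-even entries, by induction on the positions: the factors at
other positions survive erasing the current one, so `isCondProb_entry` replaces one indicator by its
conditional law, and `k` absorbs it. -/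
theorem lintegral_entries (hζ : IsSamplingLaw ζ) (t : Upper → Set I)
    (ht : ∀ p, MeasurableSet (t p)) (P : Finset Upper) :
    ∀ k : (ℕ → ℕ → I) × (ℕ → ℕ → I) → ℝ≥0∞, Measurable k →
    ∫⁻ d, k (oddPart d.1, fun p => oddRow p d.1) *
        ∏ p ∈ P, (t p).indicator 1 (d.1 (2 * p.1.1) (2 * p.1.2)) ∂ζ =
      ∫⁻ d, k (oddPart d.1, fun p => oddRow p d.1) *
        ∏ p ∈ P, symmEntryKernel ζ (oddPart d.1, oddRow p.1.1 d.1, oddRow p.1.2 d.1) (t p) ∂ζ := by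
  classical
  induction P using Finset.induction_on with
  | empty => intro k _; simp
  | insert p P hp ih =>
    intro k hk
    obtain ⟨⟨a, b⟩, hab⟩ := p
    have hab' : a < b := hab
    let K : (ℕ → ℕ → I) → ℝ≥0∞ := fun w => k (oddPart w, fun p => oddRow p w) *
      ∏ p ∈ P, (t p).indicator 1 (w (2 * p.1.1) (2 * p.1.2))
    have hK : Measurable K := by
      refine Measurable.mul (hk.comp (by fun_prop)) ?_
      refine Finset.measurable_prod _ fun p _ => ?_
      exact (measurable_one.indicator (ht p)).comp (by fun_prop)
    have hKe : ∀ d : DistMatrix, K (erasePair a b d.1) = K d.1 := by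
      intro d
      simp only [K, oddPart_erasePair, oddRow_erasePair]
      congr 1
      refine Finset.prod_congr rfl fun q hq => ?_
      have hne : q ≠ ⟨(a, b), hab⟩ := fun h => hp (h ▸ hq)
      have hq2 := q.2
      have : erasePair a b d.1 (2 * q.1.1) (2 * q.1.2) = d.1 (2 * q.1.1) (2 * q.1.2) := by
        simp only [erasePair]
        rw [if_neg]
        rintro (⟨h1, h2⟩ | ⟨h1, h2⟩)
        · exact hne (Subtype.ext (Prod.ext (by simpa using h1) (by simpa using h2)))
        · omega
      rw [this]
    have hKe' : ∀ d : DistMatrix, K (erasePair b a d.1) = K d.1 := by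
      intro d
      have : erasePair b a d.1 = erasePair a b d.1 := by
        funext i j; simp only [erasePair, or_comm]
      rw [this, hKe]
    have hS : MeasurableSet {d : DistMatrix | d.1 (2 * a) (2 * b) ∈ t ⟨(a, b), hab⟩} :=
      measurable_entry _ _ (ht _)
    have hW : ∀ a b, Measurable fun d : DistMatrix => erasePair a b d.1 := fun a b =>
      (measurable_erasePair a b).comp measurable_subtype_coe
    have hD : ∀ a b : ℕ, Measurable fun w : ℕ → ℕ → I =>
        entryKernel ζ (oddPart w, oddRow a w, oddRow b w) (t ⟨(_, _), hab⟩) := fun a b =>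
      ((entryKernel ζ).measurable_coe (ht _)).comp (by fun_prop)
    -- The same event is conditioned with its rows in both orders; the mean of the two identities
    -- involves the symmetrised kernel.
    have q1 := (isCondProb_entry hζ hab'.ne (ht ⟨(a, b), hab⟩)).lintegral_eq (hW a b)
      (hD a b) hK
    have q2 := (isCondProb_entry hζ hab'.ne' (ht ⟨(a, b), hab⟩)).lintegral_eq (hW b a)
      (hD b a) hK
    have hSs : {d : DistMatrix | d.1 (2 * b) (2 * a) ∈ t ⟨(a, b), hab⟩} =
        {d : DistMatrix | d.1 (2 * a) (2 * b) ∈ t ⟨(a, b), hab⟩} := by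
      ext d; rw [Set.mem_ofPred_eq, Set.mem_ofPred_eq, d.2.1]
    rw [hSs] at q2
    simp only [hKe, hKe', oddPart_erasePair, oddRow_erasePair] at q1 q2
    have q3 : ∫⁻ d in {d : DistMatrix | d.1 (2 * a) (2 * b) ∈ t ⟨(a, b), hab⟩}, K d.1 ∂ζ =
        ∫⁻ d, symmEntryKernel ζ (oddPart d.1, oddRow a d.1, oddRow b d.1) (t ⟨(a, b), hab⟩) *
          K d.1 ∂ζ := by
      simp only [symmEntryKernel_apply, mul_assoc, add_mul]
      have m1 : Measurable fun d : DistMatrix =>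
          entryKernel ζ (oddPart d.1, oddRow a d.1, oddRow b d.1) (t ⟨(a, b), hab⟩) * K d.1 :=
        ((hD a b).mul hK).comp measurable_subtype_coe
      rw [lintegral_const_mul' _ _ (by norm_num), lintegral_add_left m1, ← q1, ← q2, ← two_mul,
        ← mul_assoc, ENNReal.inv_mul_cancel (by norm_num) (by norm_num), one_mul]
    have q4 := ih (fun z => k z * symmEntryKernel ζ (z.1, z.2 a, z.2 b) (t ⟨(a, b), hab⟩))
      (hk.mul (((symmEntryKernel ζ).measurable_coe (ht _)).comp (by fun_prop)))
    simp only [Finset.prod_insert hp]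
    calc _ = ∫⁻ d in {d : DistMatrix | d.1 (2 * a) (2 * b) ∈ t ⟨(a, b), hab⟩}, K d.1 ∂ζ := by
          rw [← lintegral_indicator hS]
          refine lintegral_congr fun d => ?_
          simp only [Set.indicator_apply, Set.mem_ofPred_eq, Pi.one_apply]
          split_ifs <;> simp [K, Set.indicator_apply]
      _ = _ := by
          rw [q3]
          simp only [K]
          refine Eq.trans (lintegral_congr fun d => ?_) (q4.trans (lintegral_congr fun d => ?_))
          · ring
          · ring

/-- Conditional independence of the rows given the odd subarray, by the same induction with
`isCondProb_row`; the kernel does not depend on the row, so they are also identically distributed.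
-/
theorem lintegral_rows (hζ : IsSamplingLaw ζ) (t : ℕ → Set (ℕ → I))
    (ht : ∀ p, MeasurableSet (t p)) (S : Finset ℕ) :
    ∀ k : (ℕ → ℕ → I) → ℝ≥0∞, Measurable k →
    ∫⁻ d, k (oddPart d.1) * ∏ p ∈ S, (t p).indicator 1 (oddRow p d.1) ∂ζ =
      ∫⁻ d, k (oddPart d.1) * ∏ p ∈ S, rowKernel ζ (oddPart d.1) (t p) ∂ζ := by
  classical
  induction S using Finset.induction_on with
  | empty => intro k _; simp
  | insert p S hp ih =>
    intro k hk
    let K : (ℕ → ℕ → I) → ℝ≥0∞ := fun w => k (oddPart w) *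
      ∏ q ∈ S, (t q).indicator 1 (oddRow q w)
    have hK : Measurable K := by
      refine Measurable.mul (hk.comp (by fun_prop)) ?_
      refine Finset.measurable_prod _ fun p _ => ?_
      exact (measurable_one.indicator (ht p)).comp (by fun_prop)
    have hKe : ∀ d : DistMatrix, K (eraseRow p d.1) = K d.1 := by
      intro d
      simp only [K, oddPart_eraseRow]
      congr 1
      refine Finset.prod_congr rfl fun q hq => ?_
      have hne : q ≠ p := by
        rintro rfl
        exact hp hq
      rw [oddRow_eraseRow hne]
    have hS : MeasurableSet {d : DistMatrix | oddRow p d.1 ∈ t p} :=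
      (by fun_prop : Measurable fun d : DistMatrix => oddRow p d.1) (ht p)
    have hW : Measurable fun d : DistMatrix => eraseRow p d.1 :=
      (measurable_eraseRow p).comp measurable_subtype_coe
    have q1 := (isCondProb_row hζ p (ht p)).lintegral_eq hW
      (((rowKernel ζ).measurable_coe (ht p)).comp measurable_oddPart) hK
    simp only [hKe, oddPart_eraseRow] at q1
    have q4 := ih (fun z => k z * rowKernel ζ z (t p))
      (hk.mul ((rowKernel ζ).measurable_coe (ht p)))
    simp only [Finset.prod_insert hp]
    calc _ = ∫⁻ d in {d : DistMatrix | oddRow p d.1 ∈ t p}, K d.1 ∂ζ := by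
          rw [← lintegral_indicator hS]
          refine lintegral_congr fun d => ?_
          simp only [Set.indicator_apply, Set.mem_ofPred_eq, Pi.one_apply]
          split_ifs <;> simp [K, Set.indicator_apply]
      _ = _ := by
          rw [q1]
          simp only [K]
          refine Eq.trans (lintegral_congr fun d => ?_) (q4.trans (lintegral_congr fun d => ?_))
          · ring
          · ring

end

/-! ### The directing random points and their qmm-space -/

/-- The kernel of countable products of the laws of a family of kernels. -/
def infinitePiKernel {A E ι : Type*} [MeasurableSpace A] [MeasurableSpace E] [Countable ι]
    (κ : ι → Kernel A E) [∀ i, IsMarkovKernel (κ i)] : Kernel A (ι → E) where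
  toFun a := Measure.infinitePi fun i => κ i a
  measurable' := by
    refine Measurable.measure_of_isPiSystem_of_isProbabilityMeasure
      (generateFrom_squareCylinders (α := fun _ : ι => E)).symm
      (isPiSystem_squareCylinders (fun _ => MeasurableSpace.isPiSystem_measurableSet)
        (fun _ => MeasurableSet.univ (α := E))) ?_
    rintro _ ⟨s, t, ht, rfl⟩
    have h : ∀ a : A, (Measure.infinitePi fun i => κ i a) ((s : Set ι).pi t) =
        ∏ i ∈ s, κ i a (t i) := fun a =>
      Measure.infinitePi_pi _ fun p _ => ht p (Set.mem_univ p)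
    simp only [h]
    exact Finset.measurable_prod _ fun i _ => (κ i).measurable_coe (ht i (Set.mem_univ i))

theorem infinitePiKernel_apply {A E ι : Type*} [MeasurableSpace A] [MeasurableSpace E] [Countable ι]
    (κ : ι → Kernel A E) [∀ i, IsMarkovKernel (κ i)] (a : A) :
    infinitePiKernel κ a = Measure.infinitePi fun i => κ i a := rfl

instance {A E ι : Type*} [MeasurableSpace A] [MeasurableSpace E] [Countable ι]
    (κ : ι → Kernel A E) [∀ i, IsMarkovKernel (κ i)] : IsMarkovKernel (infinitePiKernel κ) :=
  ⟨fun a => by rw [infinitePiKernel_apply]; infer_instance⟩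

theorem prod_indicator_one_eq {Ω E ι : Type*} (S : Finset ι) (t : ι → Set E) (z : Ω → ι → E)
    (ω : Ω) : ∏ i ∈ S, (t i).indicator (1 : E → ℝ≥0∞) (z ω i) =
      (z ⁻¹' ((S : Set ι).pi t)).indicator 1 ω := by
  classical
  by_cases h : ∀ i ∈ S, z ω i ∈ t i
  · rw [Set.indicator_of_mem (a := ω) (by exact h)]
    exact Finset.prod_eq_one fun i hi => Set.indicator_of_mem (h i hi) _
  · rw [Set.indicator_of_notMem (a := ω) (by exact h)]
    push Not at h
    obtain ⟨i, hi, hi'⟩ := h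
    exact Finset.prod_eq_zero hi (Set.indicator_of_notMem hi' _)

section

variable {ζ : Measure DistMatrix} [IsProbabilityMeasure ζ]

theorem map_oddPart_rows (hζ : IsSamplingLaw ζ) :
    ζ.map (fun d => (oddPart d.1, fun p => oddRow p d.1)) =
      ζ.map (fun d => oddPart d.1) ⊗ₘ infinitePiKernel fun _ : ℕ => rowKernel ζ := by
  have hv : Measurable fun d : DistMatrix => oddPart d.1 := by fun_prop
  have hz : Measurable fun (d : DistMatrix) (p : ℕ) => oddRow p d.1 := by fun_prop
  refine map_eq_compProd_of_box hv hz _ fun J t ht B hB => ?_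
  have hbox : MeasurableSet ((J : Set ℕ).pi t) := .pi J.countable_toSet fun i _ => ht i
  have h := lintegral_rows hζ t ht J (B.indicator 1) (measurable_one.indicator hB)
  rw [← lintegral_indicator (hv hB)]
  calc _ = ∫⁻ d, ((fun d : DistMatrix => oddPart d.1) ⁻¹' B ∩ (fun (d : DistMatrix) (p : ℕ) =>
        oddRow p d.1) ⁻¹' ((J : Set ℕ).pi t)).indicator 1 d ∂ζ := by
        rw [lintegral_indicator_one ((hv hB).inter (hz hbox))]
    _ = _ := by
        refine Eq.trans (lintegral_congr fun d => ?_) (h.trans (lintegral_congr fun d => ?_))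
        · rw [prod_indicator_one_eq J t (fun (d : DistMatrix) (p : ℕ) => oddRow p d.1) d,
            Set.inter_indicator_one]
          rfl
        · by_cases hd : oddPart d.1 ∈ B
          · rw [Set.indicator_of_mem hd, Set.indicator_of_mem (a := d) (by exact hd)]
            rw [infinitePiKernel_apply, Measure.infinitePi_pi _ fun i _ => ht i]
            simp
          · rw [Set.indicator_of_notMem hd, Set.indicator_of_notMem (a := d) (by exact hd)]
            simp

/-- The conditional law of the even-even entries given the odd subarray and all rows. -/
def upperKernel (ζ : Measure DistMatrix) [IsProbabilityMeasure ζ] :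
    Kernel ((ℕ → ℕ → I) × (ℕ → ℕ → I)) (Upper → I) :=
  infinitePiKernel fun p : Upper => (symmEntryKernel ζ).comap
    (fun z : (ℕ → ℕ → I) × (ℕ → ℕ → I) => (z.1, z.2 p.1.1, z.2 p.1.2)) (by fun_prop)

instance : IsMarkovKernel (upperKernel ζ) := by unfold upperKernel; infer_instance

theorem map_rows_upper (hζ : IsSamplingLaw ζ) :
    ζ.map (fun d => ((oddPart d.1, fun p => oddRow p d.1),
        fun p : Upper => d.1 (2 * p.1.1) (2 * p.1.2))) =
      ζ.map (fun d => (oddPart d.1, fun p => oddRow p d.1)) ⊗ₘ upperKernel ζ := by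
  have hv : Measurable fun d : DistMatrix => (oddPart d.1, fun p => oddRow p d.1) := by fun_prop
  have hz : Measurable fun (d : DistMatrix) (p : Upper) => d.1 (2 * p.1.1) (2 * p.1.2) :=
    measurable_pi_lambda _ fun p => measurable_entry _ _
  refine map_eq_compProd_of_box hv hz _ fun J t ht B hB => ?_
  have hbox : MeasurableSet ((J : Set Upper).pi t) := .pi J.countable_toSet fun i _ => ht i
  have h := lintegral_entries hζ t ht J (B.indicator 1) (measurable_one.indicator hB)
  rw [← lintegral_indicator (hv hB)]
  calc _ = ∫⁻ d, ((fun d : DistMatrix => (oddPart d.1, fun p => oddRow p d.1)) ⁻¹' B ∩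
        (fun (d : DistMatrix) (p : Upper) =>
          d.1 (2 * p.1.1) (2 * p.1.2)) ⁻¹' ((J : Set Upper).pi t)).indicator 1 d ∂ζ := by
        rw [lintegral_indicator_one ((hv hB).inter (hz hbox))]
    _ = _ := by
        refine Eq.trans (lintegral_congr fun d => ?_) (h.trans (lintegral_congr fun d => ?_))
        · rw [prod_indicator_one_eq J t
            (fun (d : DistMatrix) (p : Upper) => d.1 (2 * p.1.1) (2 * p.1.2)) d,
            Set.inter_indicator_one]
          rfl
        · by_cases hd : (oddPart d.1, fun p => oddRow p d.1) ∈ B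
          · rw [Set.indicator_of_mem hd, Set.indicator_of_mem (a := d) (by exact hd)]
            rw [upperKernel, infinitePiKernel_apply, Measure.infinitePi_pi _ fun i _ => ht i]
            simp [Kernel.comap_apply]
          · rw [Set.indicator_of_notMem hd, Set.indicator_of_notMem (a := d) (by exact hd)]
            simp

/-- A sampling law is a mixture of product laws of independent entries, directed by an independent
sequence of random points. -/
theorem exists_mixture (hζ : IsSamplingLaw ζ) :
    ∃ (ρ : Measure (ℕ → I)) (_ : IsProbabilityMeasure ρ) (η : Kernel ((ℕ → I) × (ℕ → I)) I)
      (_ : IsMarkovKernel η), (∀ r r', η (r, r') = η (r', r)) ∧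
      ζ.map upper = (infinitePiKernel fun p : Upper => η.comap
        (fun r : ℕ → ℕ → I => (r p.1.1, r p.1.2)) (by fun_prop)) ∘ₘ
          (Measure.infinitePi fun _ : ℕ => ρ) := by
  have hv : Measurable fun d : DistMatrix => oddPart d.1 := by fun_prop
  have hz : Measurable fun (d : DistMatrix) (p : Upper) => d.1 (2 * p.1.1) (2 * p.1.2) :=
    measurable_pi_lambda _ fun p => measurable_entry _ _
  have hr : Measurable fun d : DistMatrix => (oddPart d.1, fun p => oddRow p d.1) := by fun_prop
  have : IsProbabilityMeasure (ζ.map (fun d => oddPart d.1)) :=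
    Measure.isProbabilityMeasure_map hv.aemeasurable
  have : IsProbabilityMeasure (ζ.map upper) :=
    Measure.isProbabilityMeasure_map measurable_upper.aemeasurable
  have e1 : ζ.map (fun d => (oddPart d.1, fun p : Upper => d.1 (2 * p.1.1) (2 * p.1.2))) =
      ζ.map (fun d => oddPart d.1) ⊗ₘ
        ((infinitePiKernel fun _ : ℕ => rowKernel ζ) ⊗ₖ upperKernel ζ).snd := by
    rw [Kernel.snd_eq, Measure.compProd_map measurable_snd, ← Measure.compProd_assoc',
      ← map_oddPart_rows hζ, ← map_rows_upper hζ, Measure.map_map (by fun_prop) (by fun_prop),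
      Measure.map_map (by fun_prop) (hr.prodMk hz)]
    rfl
  -- Dissociation: the even-even block is independent of the odd subarray and has the law of the
  -- whole matrix.
  have e2 : ζ.map (fun d => (oddPart d.1, fun p : Upper => d.1 (2 * p.1.1) (2 * p.1.2))) =
      ζ.map (fun d => oddPart d.1) ⊗ₘ Kernel.const _ (ζ.map upper) := by
    have hodd : Measurable fun d : DistMatrix => (d.1 : ℕ → ℕ → I) := measurable_subtype_coe
    have hp : Measurable fun z : DistMatrix × DistMatrix => (z.2.1, upper z.1) := by fun_prop
    have hq : Measurable fun d : DistMatrix =>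
      (reindex (fun i => 2 * i) d, reindex (fun i => 2 * i + 1) d) := by fun_prop
    have h := congrArg (Measure.map fun z : DistMatrix × DistMatrix => (z.2.1, upper z.1))
      hζ.dissociated
    rw [Measure.map_map hp hq] at h
    have h' : (ζ.prod ζ).map (fun z : DistMatrix × DistMatrix => (z.2.1, upper z.1)) =
        (ζ.map fun d => (d.1 : ℕ → ℕ → I)).prod (ζ.map upper) := by
      rw [Measure.map_prod_map ζ ζ hodd measurable_upper]
      conv_rhs => rw [← Measure.prod_swap, Measure.map_map (hodd.prodMap measurable_upper)
        measurable_swap]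
      rfl
    have h'' : ζ.map (fun d => oddPart d.1) = ζ.map fun d => (d.1 : ℕ → ℕ → I) := by
      conv_rhs => rw [← hζ.exchangeable (fun i => 2 * i + 1) (fun a b h => by simpa using h)]
      rw [Measure.map_map hodd (by fun_prop)]
      rfl
    rw [Measure.compProd_const, h'', ← h', ← h]
    rfl
  -- So the conditional law of the even-even block is the unconditional one for almost every odd
  -- subarray; one such subarray `a` is frozen.
  have e3 := Kernel.ae_eq_of_compProd_eq (e1.symm.trans e2)
  obtain ⟨a, ha⟩ := e3.exists
  refine ⟨rowKernel ζ a, inferInstance, (symmEntryKernel ζ).comap (fun z => (a, z.1, z.2))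
    (by fun_prop), inferInstance, fun r r' => ?_, ?_⟩
  · simp only [Kernel.comap_apply, symmEntryKernel_comm]
  · rw [Kernel.const_apply] at ha
    rw [← ha]
    ext s hs
    rw [Kernel.snd_apply' _ _ hs, Kernel.compProd_apply (measurable_snd hs),
      Measure.bind_apply hs (Kernel.aemeasurable _)]
    rfl

end

theorem ae_ne_prod_volume : ∀ᵐ p : I × I ∂(volume.prod volume), p.1 ≠ p.2 := by
  have h : MeasurableSet {p : I × I | p.1 ≠ p.2} :=
    (measurableSet_eq_fun measurable_fst measurable_snd).compl
  rw [Measure.ae_prod_iff_ae_ae h]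
  refine Eventually.of_forall fun x => ?_
  rw [ae_iff]
  have : {y : I | ¬ x ≠ y} = {x} := by ext y; simp [eq_comm]
  rw [this]
  exact measure_singleton x

/-- Every sampling law comes from a qmm-space. -/
theorem exists_qmmSpace_of_isSamplingLaw {ζ : ProbabilityMeasure DistMatrix}
    (hζ : IsSamplingLaw (ζ : Measure DistMatrix)) : ∃ X : QMMSpace, X.sampling = ζ := by
  obtain ⟨ρ, hρ, η, hη, hsymm, hmix⟩ := exists_mixture hζ
  set K : Kernel (ℕ → ℕ → I) (Upper → I) := infinitePiKernel fun p : Upper => η.comap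
        (fun r : ℕ → ℕ → I => (r p.1.1, r p.1.2)) (by fun_prop) with hK
  -- the triangle inequality for the directing points
  have htri : ∀ᵐ p ∂(ρ.prod (ρ.prod ρ)),
      ∀ᵐ l ∂((η (p.1, p.2.1)).prod ((η (p.2.1, p.2.2)).prod (η (p.1, p.2.2)))),
        (l.2.2 : ℝ) ≤ l.1 + l.2.1 ∧ (l.1 : ℝ) ≤ l.2.1 + l.2.2 ∧ (l.2.1 : ℝ) ≤ l.1 + l.2.2 := by
    let G : Set (I × I × I) :=
      {l | (l.2.2 : ℝ) ≤ l.1 + l.2.1 ∧ (l.1 : ℝ) ≤ l.2.1 + l.2.2 ∧ (l.2.1 : ℝ) ≤ l.1 + l.2.2}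
    have hG : MeasurableSet G := by
      have m1 : Measurable fun l : I × I × I => (l.1 : ℝ) := by fun_prop
      have m2 : Measurable fun l : I × I × I => (l.2.1 : ℝ) := by fun_prop
      have m3 : Measurable fun l : I × I × I => (l.2.2 : ℝ) := by fun_prop
      exact (measurableSet_le m3 (m1.add m2)).inter
        ((measurableSet_le m1 (m2.add m3)).inter (measurableSet_le m2 (m1.add m3)))
    let u01 : Upper := ⟨(0, 1), by norm_num⟩
    let u12 : Upper := ⟨(1, 2), by norm_num⟩
    let u02 : Upper := ⟨(0, 2), by norm_num⟩
    have ev : Measurable fun ω : Upper → I => (ω u01, ω u12, ω u02) := by fun_prop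
    have h1 : ∀ᵐ ω ∂((ζ : Measure DistMatrix).map upper), (ω u01, ω u12, ω u02) ∈ G := by
      rw [ae_map_iff measurable_upper.aemeasurable (ev hG)]
      filter_upwards [hζ.triangle] with d hd
      have s1 := d.2.1 0 1
      have s2 := d.2.1 1 2
      have s3 := d.2.1 0 2
      refine ⟨hd 0 1 2, ?_, ?_⟩
      · have := hd 0 2 1
        rw [d.2.1 2 1] at this
        change ((d.1 0 1 : I) : ℝ) ≤ d.1 1 2 + d.1 0 2
        linarith
      · have := hd 1 0 2
        rw [d.2.1 1 0] at this
        exact this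
    rw [hmix] at h1
    have h2 := Measure.ae_ae_of_ae_bind (Kernel.aemeasurable _) h1
    let T : Kernel ((ℕ → I) × (ℕ → I) × (ℕ → I)) (I × I × I) :=
      (η.comap (fun p => (p.1, p.2.1)) (by fun_prop)) ×ₖ
        ((η.comap (fun p => (p.2.1, p.2.2)) (by fun_prop)) ×ₖ
          (η.comap (fun p => (p.1, p.2.2)) (by fun_prop)))
    have hT : ∀ p, T p = (η (p.1, p.2.1)).prod ((η (p.2.1, p.2.2)).prod (η (p.1, p.2.2))) := by
      intro p
      simp only [T, Kernel.prod_apply, Kernel.comap_apply]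
    have h3 : ∀ᵐ r ∂(Measure.infinitePi fun _ : ℕ => ρ), T (r 0, r 1, r 2) Gᶜ = 0 := by
      filter_upwards [h2] with r hr
      have e := infinitePi_map_eval_triple (fun p : Upper => η (r p.1.1, r p.1.2))
        (i := u01) (j := u12) (k := u02) (by simp [u01, u12]) (by simp [u01, u02])
        (by simp [u12, u02])
      have e' : T (r 0, r 1, r 2) = (K r).map fun ω => (ω u01, ω u12, ω u02) := by
        rw [hT]
        exact e.symm
      rw [e', Measure.map_apply ev hG.compl]
      exact hr
    have hTm : Measurable fun p => T p Gᶜ := T.measurable_coe hG.compl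
    have h4 : ∀ᵐ p ∂(ρ.prod (ρ.prod ρ)), T p Gᶜ = 0 := by
      rw [← infinitePi_map_eval_triple (fun _ : ℕ => ρ) (i := 0) (j := 1) (k := 2)
        (by norm_num) (by norm_num) (by norm_num), ae_map_iff (p := fun p => T p Gᶜ = 0)
        (by fun_prop) (hTm (measurableSet_singleton 0))]
      exact h3
    filter_upwards [h4] with p hp
    rw [hT] at hp
    exact hp
  -- the qmm-space
  let D : Set (((ℕ → I) × I) × ((ℕ → I) × I)) := {p | p.1.2 = p.2.2}
  have hD : MeasurableSet D := measurableSet_eq_fun (by fun_prop) (by fun_prop)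
  let δ : Kernel (((ℕ → I) × I) × ((ℕ → I) × I)) I := Kernel.const _ (Measure.dirac 0)
  let η' : Kernel (((ℕ → I) × I) × ((ℕ → I) × I)) I := η.comap (fun p => (p.1.1, p.2.1)) (by fun_prop)
  classical
  let dS : Kernel (((ℕ → I) × I) × ((ℕ → I) × I)) I := Kernel.piecewise hD δ η'
  have hdS : ∀ p : ((ℕ → I) × I) × ((ℕ → I) × I), p.1.2 ≠ p.2.2 → dS p = η (p.1.1, p.2.1) := fun p hp => by
    simp only [dS]
    rw [Kernel.piecewise_apply, if_neg (by exact hp)]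
    rfl
  let μ : Measure ((ℕ → I) × I) := ρ.prod volume
  have hne : ∀ᵐ p ∂(μ.prod μ), p.1.2 ≠ p.2.2 := by
    have hp : MeasurePreserving (Prod.map Prod.snd Prod.snd) (μ.prod μ)
        ((volume : Measure I).prod volume) :=
      MeasurePreserving.prod measurePreserving_snd measurePreserving_snd
    exact hp.quasiMeasurePreserving.ae ae_ne_prod_volume
  let X : QMMSpace :=
    { carrier := (ℕ → I) × I
      μ := μ
      dStar := dS
      dStar_self := fun x => by
        simp only [dS]
        rw [Kernel.piecewise_apply, if_pos (by exact rfl)]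
        rfl
      dStar_comm := fun x y => by
        by_cases h : x.2 = y.2
        · simp only [dS]
          rw [Kernel.piecewise_apply, Kernel.piecewise_apply, if_pos (by exact h),
            if_pos (by exact h.symm)]
          rfl
        · rw [hdS _ h, hdS _ (Ne.symm h), hsymm]
      triangle := by
        have q1 : ∀ᵐ p ∂(μ.prod (μ.prod μ)), p.2.1.2 ≠ p.2.2.2 :=
          (Measure.quasiMeasurePreserving_snd (μ := μ) (ν := μ.prod μ)).ae hne
        have q2 : ∀ᵐ p ∂(μ.prod (μ.prod μ)), p.1.2 ≠ p.2.1.2 :=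
          ((MeasurePreserving.id μ).prod
            (measurePreserving_fst (μ := μ) (ν := μ))).quasiMeasurePreserving.ae hne
        have q3 : ∀ᵐ p ∂(μ.prod (μ.prod μ)), p.1.2 ≠ p.2.2.2 :=
          ((MeasurePreserving.id μ).prod
            (measurePreserving_snd (μ := μ) (ν := μ))).quasiMeasurePreserving.ae hne
        have hf : MeasurePreserving Prod.fst μ ρ := measurePreserving_fst
        have q4 := (hf.prod (hf.prod hf)).quasiMeasurePreserving.ae htri
        filter_upwards [q1, q2, q3, q4] with p h1 h2 h3 h4
        rw [hdS _ h1, hdS _ h2, hdS _ h3]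
        exact h4 }
  refine ⟨X, Subtype.ext ?_⟩
  have hX : IsProbabilityMeasure (X.sampling : Measure DistMatrix) := X.sampling.2
  have hζ1 : IsProbabilityMeasure (ζ : Measure DistMatrix) := ζ.2
  refine ext_of_cylinder (ζ := (X.sampling : Measure DistMatrix))
    (ζ' := (ζ : Measure DistMatrix)) fun P t ht => ?_
  rw [X.sampling_cylinder P t ht]
  have hcyl : {d : DistMatrix | ∀ p ∈ P, d.1 p.1.1 p.1.2 ∈ t p} =
      upper ⁻¹' ((P : Set Upper).pi t) := rfl
  have hbox : MeasurableSet ((P : Set Upper).pi t) := .pi P.countable_toSet fun i _ => ht i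
  have hR : ((ζ : Measure DistMatrix)) {d | ∀ p ∈ P, d.1 p.1.1 p.1.2 ∈ t p} =
      ∫⁻ r, ∏ p ∈ P, η (r p.1.1, r p.1.2) (t p) ∂(Measure.infinitePi fun _ : ℕ => ρ) := by
    rw [hcyl, ← Measure.map_apply measurable_upper hbox, hmix,
      Measure.bind_apply hbox (Kernel.aemeasurable _)]
    refine lintegral_congr fun r => ?_
    rw [hK, infinitePiKernel_apply, Measure.infinitePi_pi _ fun i _ => ht i]
    rfl
  refine Eq.trans ?_ hR.symm
  have hmap : (Measure.infinitePi fun _ : ℕ => μ).map (fun x i => (x i).1) =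
      Measure.infinitePi fun _ : ℕ => ρ := by
    have hf : MeasurePreserving Prod.fst μ ρ := measurePreserving_fst
    have := Measure.infinitePi_map_pi (μ := fun _ : ℕ => μ) (f := fun _ => Prod.fst)
      (fun _ => measurable_fst)
    simp only [hf.map_eq] at this
    exact this
  have hm : Measurable fun r : ℕ → ℕ → I => ∏ p ∈ P, η (r p.1.1, r p.1.2) (t p) :=
    Finset.measurable_prod _ fun p _ => (η.measurable_coe (ht p)).comp (by fun_prop)
  rw [← hmap, lintegral_map hm (by fun_prop)]
  have hae : ∀ᵐ x ∂(Measure.infinitePi fun _ : ℕ => μ),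
      ∀ p : Upper, (x p.1.1).2 ≠ (x p.1.2).2 := by
    rw [ae_all_iff]
    intro p
    have hq : MeasurePreserving (fun x : ℕ → ((ℕ → I) × I) => (x p.1.1, x p.1.2))
        (Measure.infinitePi fun _ : ℕ => μ) (μ.prod μ) :=
      ⟨by fun_prop, Measure.infinitePi_map_eval_prod p.2.ne⟩
    exact hq.quasiMeasurePreserving.ae hne
  refine lintegral_congr_ae ?_
  filter_upwards [hae] with x hx
  refine Finset.prod_congr rfl fun p _ => ?_
  change dS (x p.1.1, x p.1.2) (t p) = _
  rw [hdS _ (hx p)]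

/-! ### Partial diameters under weak convergence -/

section PartialDiam

variable {Y : Type*} [MetricSpace Y] [MeasurableSpace Y]

theorem partialDiam_le_of_le {ν : Measure Y} {κ : ℝ} {A : Set Y} (hA : MeasurableSet A)
    (h : ENNReal.ofReal (1 - κ) ≤ ν A) : partialDiam ν κ ≤ Metric.ediam A :=
  iInf₂_le A ⟨hA, h⟩

theorem exists_of_partialDiam_lt {ν : Measure Y} {κ : ℝ} {c : ℝ≥0∞} (h : partialDiam ν κ < c) :
    ∃ A : Set Y, MeasurableSet A ∧ ENNReal.ofReal (1 - κ) ≤ ν A ∧ Metric.ediam A < c := by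
  unfold partialDiam at h
  simp only [iInf_lt_iff] at h
  obtain ⟨A, ⟨h1, h2⟩, h3⟩ := h
  exact ⟨A, h1, h2, h3⟩

variable [BorelSpace Y]

/-- The partial diameter is essentially upper semicontinuous. -/
theorem eventually_partialDiam_lt {ι : Type*} {L : Filter ι} {ν : ι → ProbabilityMeasure Y}
    {ν₀ : ProbabilityMeasure Y} (h : Tendsto ν L (𝓝 ν₀)) {κ κ' : ℝ} (hκ : κ' < κ) (hκ1 : κ < 1)
    {c : ℝ≥0∞} (hc : partialDiam (ν₀ : Measure Y) κ' < c) :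
    ∀ᶠ i in L, partialDiam (ν i : Measure Y) κ < c := by
  obtain ⟨A, hA, hA1, hA2⟩ := exists_of_partialDiam_lt hc
  obtain ⟨δ, hδ, hδ'⟩ : ∃ δ : ℝ, 0 < δ ∧ Metric.ediam A + 2 * ENNReal.ofReal δ < c := by
    obtain ⟨r, hr, hr'⟩ := ENNReal.lt_iff_exists_add_pos_lt.1 hA2
    refine ⟨r / 2, by positivity, lt_of_le_of_lt ?_ hr'⟩
    gcongr
    rw [← ENNReal.ofReal_ofNat, ← ENNReal.ofReal_mul (by norm_num), mul_div_cancel₀ _ (by norm_num)]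
    simp
  have hG : IsOpen (Metric.thickening δ A) := Metric.isOpen_thickening
  have h1 := ProbabilityMeasure.le_liminf_measure_open_of_tendsto h hG
  -- The passage to an open thickening permits the portmanteau theorem at the cost of `2 * δ` in
  -- diameter; the gap between `κ'` and `κ` makes the inequality strict.
  have h2 : ENNReal.ofReal (1 - κ) < liminf (fun i => (ν i : Measure Y) (Metric.thickening δ A)) L :=
    calc ENNReal.ofReal (1 - κ) < ENNReal.ofReal (1 - κ') :=
          (ENNReal.ofReal_lt_ofReal_iff (by linarith)).2 (by linarith)
      _ ≤ (ν₀ : Measure Y) A := hA1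
      _ ≤ (ν₀ : Measure Y) (Metric.thickening δ A) :=
          measure_mono (Metric.self_subset_thickening hδ A)
      _ ≤ _ := h1
  filter_upwards [eventually_lt_of_lt_liminf h2] with i hi
  refine (partialDiam_le_of_le hG.measurableSet hi.le).trans_lt (lt_of_le_of_lt ?_ hδ')
  refine Metric.ediam_le fun x hx y hy => ?_
  obtain ⟨x', hx', hxx'⟩ := Metric.mem_thickening_iff.1 hx
  obtain ⟨y', hy', hyy'⟩ := Metric.mem_thickening_iff.1 hy
  calc edist x y ≤ edist x x' + edist x' y' + edist y' y := edist_triangle4 _ _ _ _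
    _ ≤ ENNReal.ofReal δ + Metric.ediam A + ENNReal.ofReal δ := by
        gcongr
        · rw [edist_dist]; exact ENNReal.ofReal_le_ofReal hxx'.le
        · exact Metric.edist_le_ediam_of_mem hx' hy'
        · rw [edist_comm, edist_dist]; exact ENNReal.ofReal_le_ofReal hyy'.le
    _ = Metric.ediam A + 2 * ENNReal.ofReal δ := by ring

/-- On a compact space, upper bounds for the partial diameter pass to weak limits. -/
theorem partialDiam_le_of_mem_closure [CompactSpace Y] {S : Set (ProbabilityMeasure Y)}
    {ν : ProbabilityMeasure Y} (hν : ν ∈ closure S) {κ : ℝ} {c : ℝ≥0∞}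
    (h : ∀ ν' ∈ S, partialDiam (ν' : Measure Y) κ ≤ c) : partialDiam (ν : Measure Y) κ ≤ c := by
  refine ENNReal.le_of_forall_pos_le_add fun δ hδ hc => ?_
  have hcδ : c < c + δ := ENNReal.lt_add_right hc.ne (by simpa using hδ.ne')
  -- Closed sets nearly realising the partial diameter have a limit in the compact Hausdorff
  -- hyperspace; outside `S` any value would do.
  have hex : ∀ ν' : ProbabilityMeasure Y, ∃ A : TopologicalSpace.Closeds Y, ν' ∈ S →
      ENNReal.ofReal (1 - κ) ≤ (ν' : Measure Y) A ∧ Metric.ediam (A : Set Y) ≤ c + δ := by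
    intro ν'
    by_cases hν' : ν' ∈ S
    · obtain ⟨A, _, hA1, hA2⟩ := exists_of_partialDiam_lt ((h ν' hν').trans_lt hcδ)
      refine ⟨⟨closure A, isClosed_closure⟩, fun _ => ⟨hA1.trans (measure_mono subset_closure), ?_⟩⟩
      change Metric.ediam (closure A) ≤ _
      rw [Metric.ediam_closure]
      exact hA2.le
    · exact ⟨⊥, fun h => absurd h hν'⟩
  choose A hA using hex
  obtain ⟨u, hu, huν⟩ := mem_closure_iff_ultrafilter.1 hν
  obtain ⟨K, -, hK⟩ := isCompact_univ (X := TopologicalSpace.Closeds Y).ultrafilter_le_nhds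
    (u.map A) (by simp)
  have hKt : Tendsto A u (𝓝 K) := hK
  have hd : ∀ ε : ℝ≥0∞, 0 < ε → ∀ᶠ ν' in (u : Filter (ProbabilityMeasure Y)),
      Metric.hausdorffEDist (A ν' : Set Y) K < ε := fun ε hε =>
    EMetric.tendsto_nhds.1 hKt ε hε
  have hdiam : Metric.ediam (K : Set Y) ≤ c + δ := by
    refine Metric.ediam_le fun x hx y hy => ?_
    refine ENNReal.le_of_forall_pos_le_add fun ε hε _ => ?_
    have hε' : (0 : ℝ≥0∞) < (ε / 2 : NNReal) := by simpa using hε.ne'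
    obtain ⟨ν', h1, h2⟩ := ((hd _ hε').and hu).exists
    rw [Metric.hausdorffEDist_comm] at h1
    obtain ⟨x', hx', hxx'⟩ := Metric.exists_edist_lt_of_hausdorffEDist_lt hx h1
    obtain ⟨y', hy', hyy'⟩ := Metric.exists_edist_lt_of_hausdorffEDist_lt hy h1
    calc edist x y ≤ edist x x' + edist x' y' + edist y' y := edist_triangle4 _ _ _ _
      _ ≤ (ε / 2 : NNReal) + (c + δ) + (ε / 2 : NNReal) := by
          gcongr
          · exact (Metric.edist_le_ediam_of_mem hx' hy').trans (hA ν' h2).2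
          · rw [edist_comm]; exact hyy'.le
      _ = c + δ + ((ε / 2 + ε / 2 : NNReal) : ℝ≥0∞) := by push_cast; ring
      _ = c + δ + ε := by rw [add_halves]
  have hmeas : ENNReal.ofReal (1 - κ) ≤ (ν : Measure Y) K := by
    -- The near-optimal sets eventually lie in every closed thickening of their limit, so the mass
    -- bound survives with the same `κ`.
    have h1 : ∀ ε : ℝ, 0 < ε → ENNReal.ofReal (1 - κ) ≤
        (ν : Measure Y) (Metric.cthickening ε (K : Set Y)) := by
      intro ε hε
      have hid : Tendsto (fun ν' : ProbabilityMeasure Y => ν') u (𝓝 ν) := huν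
      refine le_trans ?_ (ProbabilityMeasure.limsup_measure_closed_le_of_tendsto hid
        (Metric.isClosed_cthickening (δ := ε) (E := (K : Set Y))))
      refine le_limsup_of_frequently_le (Eventually.frequently ?_)
      filter_upwards [hd (ENNReal.ofReal ε) (by simpa using hε), hu] with ν' h1 h2
      refine (hA ν' h2).1.trans (measure_mono fun x hx => ?_)
      obtain ⟨y, hy, hxy⟩ := Metric.exists_edist_lt_of_hausdorffEDist_lt hx h1
      refine Metric.mem_cthickening_of_edist_le x y ε _ hy hxy.le
    have h2 : Tendsto (fun r => (ν : Measure Y) (Metric.cthickening r (K : Set Y))) (𝓝[>] 0)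
        (𝓝 ((ν : Measure Y) K)) :=
      (tendsto_measure_cthickening_of_isClosed ⟨1, one_pos, measure_ne_top _ _⟩
        K.isClosed).mono_left nhdsWithin_le_nhds
    exact ge_of_tendsto h2 (eventually_mem_nhdsWithin.mono fun r hr => h1 r hr)
  exact (partialDiam_le_of_le K.isClosed.measurableSet hmeas).trans hdiam

end PartialDiam

/-! ### Labelled samples -/

/-- Chebyshev's inequality for empirical means of independent samples. -/
theorem measure_empirical_sub_ge_le {Ω : Type*} [MeasurableSpace Ω] (μ : Measure Ω)
    [IsProbabilityMeasure μ] {a : Ω → ℝ} (ha : Measurable a) {C : ℝ} (hC : ∀ ω, |a ω| ≤ C) {N : ℕ}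
    (hN : 0 < N) {δ : ℝ} (hδ : 0 < δ) :
    (Measure.infinitePi fun _ : ℕ => μ)
        {x | δ ≤ |(∑ i ∈ Finset.range N, a (x i)) / N - ∫ ω, a ω ∂μ|} ≤
      ENNReal.ofReal (C ^ 2 / (N * δ ^ 2)) := by
  set P := Measure.infinitePi fun _ : ℕ => μ
  have hN' : (0 : ℝ) < N := by exact_mod_cast hN
  have hev : ∀ i, MeasurePreserving (fun x : ℕ → Ω => x i) P μ := fun i =>
    measurePreserving_eval_infinitePi _ i
  let Z : ℕ → (ℕ → Ω) → ℝ := fun i x => a (x i)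
  have hZm : ∀ i, Measurable (Z i) := fun i => ha.comp (measurable_pi_apply i)
  have hZ : ∀ i, MemLp (Z i) 2 P := fun i =>
    MemLp.of_bound (hZm i).aestronglyMeasurable C (Eventually.of_forall fun x => hC _)
  have hind : iIndepFun Z P := iIndepFun_infinitePi (P := fun _ : ℕ => μ) (X := fun _ => a)
    fun _ => ha
  have hvar : variance (∑ i ∈ Finset.range N, Z i) P ≤ N * C ^ 2 := by
    rw [IndepFun.variance_sum (fun i _ => hZ i) (fun i _ j _ hij => hind.indepFun hij)]
    calc ∑ i ∈ Finset.range N, variance (Z i) P ≤ ∑ i ∈ Finset.range N, C ^ 2 := by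
          refine Finset.sum_le_sum fun i _ => ?_
          have := variance_le_sq_of_bounded (μ := P) (X := Z i) (a := -C) (b := C)
            (Eventually.of_forall fun x => abs_le.1 (hC _)) (hZm i).aemeasurable
          refine this.trans (le_of_eq ?_)
          ring
      _ = N * C ^ 2 := by simp
  have hmean : P[∑ i ∈ Finset.range N, Z i] = N * ∫ ω, a ω ∂μ := by
    simp only [Finset.sum_apply]
    rw [integral_finsetSum _ fun i _ => (hZ i).integrable (by norm_num)]
    have : ∀ i, ∫ x, Z i x ∂P = ∫ ω, a ω ∂μ := fun i =>
      (by rw [← (hev i).map_eq, integral_map (hev i).measurable.aemeasurable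
            ha.aestronglyMeasurable])
    simp [this]
  have hmem : MemLp (∑ i ∈ Finset.range N, Z i) 2 P := memLp_finsetSum' _ fun i _ => hZ i
  refine (measure_mono fun x hx => ?_).trans
    ((meas_ge_le_variance_div_sq hmem (c := N * δ) (by positivity)).trans
      (ENNReal.ofReal_le_ofReal ?_))
  · rw [Set.mem_ofPred_eq, hmean, Finset.sum_apply]
    have hx' : δ ≤ |(∑ i ∈ Finset.range N, a (x i)) / N - ∫ ω, a ω ∂μ| := hx
    have e : (∑ i ∈ Finset.range N, Z i x) - N * ∫ ω, a ω ∂μ =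
        N * ((∑ i ∈ Finset.range N, a (x i)) / N - ∫ ω, a ω ∂μ) := by
      simp only [Z]
      field_simp
    rw [e, abs_mul, abs_of_pos hN']
    gcongr
  · rw [div_le_div_iff₀ (by positivity) (by positivity)]
    calc variance (∑ i ∈ Finset.range N, Z i) P * (N * δ ^ 2) ≤ N * C ^ 2 * (N * δ ^ 2) := by
          gcongr
      _ = C ^ 2 * (N * δ) ^ 2 := by ring

section Labels

variable {Y : Type*} [MetricSpace Y] [CompactSpace Y] [MeasurableSpace Y]

/-- The matrices whose first `N` points carry `1`-Lipschitz labels in `Y`, with label statistics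
close to `ν`. -/
def labelable (N : ℕ) (Φ : Finset C(Y, ℝ)) (ν : Measure Y) (δ : ℝ) : Set DistMatrix :=
  {d | ∃ y : ℕ → Y, (∀ i < N, ∀ j < N, dist (y i) (y j) ≤ d.1 i j) ∧
    ∀ b ∈ Φ, |(∑ i ∈ Finset.range N, b (y i)) / N - ∫ t, b t ∂ν| ≤ δ}

/-- The projection of a closed set along the compact space of label sequences. -/
theorem isClosed_labelable (N : ℕ) (Φ : Finset C(Y, ℝ)) (ν : Measure Y) (δ : ℝ) :
    IsClosed (labelable N Φ ν δ) := by
  let S : Set (DistMatrix × (ℕ → Y)) :=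
    {p | (∀ i < N, ∀ j < N, dist (p.2 i) (p.2 j) ≤ p.1.1 i j) ∧
      ∀ b ∈ Φ, |(∑ i ∈ Finset.range N, b (p.2 i)) / N - ∫ t, b t ∂ν| ≤ δ}
  have hS : IsClosed S := by
    simp only [S, Set.ofPred_and, Set.ofPred_forall]
    refine IsClosed.inter ?_ ?_
    · refine isClosed_iInter fun i => isClosed_iInter fun _ => isClosed_iInter fun j =>
        isClosed_iInter fun _ => isClosed_le ?_ ?_
      · fun_prop
      · exact continuous_subtype_val.comp ((continuous_entry i j).comp continuous_fst)
    · refine isClosed_iInter fun b => isClosed_iInter fun _ => isClosed_le ?_ continuous_const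
      fun_prop
  have : labelable N Φ ν δ = Prod.fst '' S := by
    ext d
    constructor
    · rintro ⟨y, hy⟩
      exact ⟨(d, y), hy, rfl⟩
    · rintro ⟨⟨d', y⟩, hy, rfl⟩
      exact ⟨y, hy⟩
  rw [this]
  exact isClosedMap_fst_of_compactSpace _ hS

variable [BorelSpace Y]

theorem QMMSpace.ae_matrixLaw_le (X : QMMSpace) (x : ℕ → X.carrier) {i j : ℕ} {r : ℝ}
    (hij : i < j) (h : r ≤ lowerEnd (X.dStar (x i, x j))) :
    ∀ᵐ d ∂X.matrixLaw x, r ≤ d.1 i j := by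
  have hm : MeasurableSet {t : I | ¬ r ≤ t} :=
    (measurableSet_le measurable_const measurable_subtype_coe).compl
  have h1 := X.matrixLaw_cylinder x {⟨(i, j), hij⟩} (fun _ => {t : I | ¬ r ≤ t}) (fun _ => hm)
  rw [ae_iff]
  simp only [Finset.mem_singleton, forall_eq, Finset.prod_singleton] at h1
  refine h1.trans ?_
  have := ae_lowerEnd_le (X.dStar (x i, x j))
  exact ae_iff.1 (this.mono fun t ht => h.trans ht)

/-- A `1`-Lipschitz map labels most samples. -/
theorem sampling_labelable_compl_le (X : QMMSpace) {f : X.carrier → Y} (hf : f ∈ X.Lip1 Y)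
    (Φ : Finset C(Y, ℝ)) (ν : Measure Y) {N : ℕ} (hN : 0 < N) {δ : ℝ} (hδ : 0 < δ)
    (hν : ∀ b ∈ Φ, |∫ t, b t ∂(X.μ.map f) - ∫ t, b t ∂ν| ≤ δ / 2) :
    (X.sampling : Measure DistMatrix) (labelable N Φ ν δ)ᶜ ≤
      ∑ b ∈ Φ, ENNReal.ofReal (‖b‖ ^ 2 / (N * (δ / 2) ^ 2)) := by
  set P := Measure.infinitePi fun _ : ℕ => X.μ with hP
  have hm : MeasurableSet (labelable N Φ ν δ)ᶜ := (isClosed_labelable N Φ ν δ).measurableSet.compl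
  -- Atypical statistics. Outside these events the values of `f` at the points are admissible labels
  -- for almost every matrix; one half of `δ` is spent on sampling, the other on the distance from
  -- the law of `f` to `ν`.
  let B : C(Y, ℝ) → Set (ℕ → X.carrier) := fun b =>
    {x | δ / 2 ≤ |(∑ i ∈ Finset.range N, b (f (x i))) / N - ∫ t, b (f t) ∂X.μ|}
  have hBm : ∀ b, MeasurableSet (B b) := fun b => by
    have hfi : ∀ i, Measurable fun x : ℕ → X.carrier => f (x i) := fun i =>
      hf.1.comp (measurable_pi_apply i)
    have hbf : ∀ i, Measurable fun x : ℕ → X.carrier => b (f (x i)) := fun i =>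
      b.continuous.measurable.comp (hfi i)
    exact measurableSet_le measurable_const (measurable_abs.comp
      (((Finset.measurable_sum _ fun i _ => hbf i).div_const _).sub_const _))
  have hlip : ∀ᵐ x ∂P, ∀ p : Upper, dist (f (x p.1.1)) (f (x p.1.2)) ≤
      lowerEnd (X.dStar (x p.1.1, x p.1.2)) := by
    rw [ae_all_iff]
    intro p
    have hq : MeasurePreserving (fun x : ℕ → X.carrier => (x p.1.1, x p.1.2)) P (X.μ.prod X.μ) :=
      ⟨by fun_prop, Measure.infinitePi_map_eval_prod p.2.ne⟩
    exact hq.quasiMeasurePreserving.ae hf.2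
  have hU : MeasurableSet (⋃ b ∈ Φ, B b) := Finset.measurableSet_biUnion _ fun b _ => hBm b
  have hle : ∀ᵐ x ∂P, X.matrixLaw x (labelable N Φ ν δ)ᶜ ≤
      (⋃ b ∈ Φ, B b).indicator 1 x := by
    filter_upwards [hlip] with x hx
    by_cases hxB : x ∈ ⋃ b ∈ Φ, B b
    · rw [Set.indicator_of_mem hxB]
      exact prob_le_one
    · rw [Set.indicator_of_notMem hxB, nonpos_iff_eq_zero]
      have hall : ∀ᵐ d ∂X.matrixLaw x, ∀ p : Upper,
          dist (f (x p.1.1)) (f (x p.1.2)) ≤ d.1 p.1.1 p.1.2 := by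
        rw [ae_all_iff]
        exact fun p => X.ae_matrixLaw_le x p.2 (hx p)
      have : ∀ᵐ d ∂X.matrixLaw x, d ∈ labelable N Φ ν δ := by
        filter_upwards [hall] with d hd
        refine ⟨fun i => f (x i), fun i _ j _ => ?_, fun b hb => ?_⟩
        · rcases lt_trichotomy i j with hij | rfl | hij
          · exact hd ⟨(i, j), hij⟩
          · simp [d.2.2]
          · rw [d.2.1, dist_comm]
            exact hd ⟨(j, i), hij⟩
        · have h1 : ¬ δ / 2 ≤ |(∑ i ∈ Finset.range N, b (f (x i))) / N - ∫ t, b (f t) ∂X.μ| :=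
            fun h => hxB (Set.mem_biUnion hb h)
          have h2 := hν b hb
          rw [integral_map hf.1.aemeasurable b.continuous.measurable.aestronglyMeasurable] at h2
          have h3 := abs_sub_le ((∑ i ∈ Finset.range N, b (f (x i))) / N) (∫ t, b (f t) ∂X.μ)
            (∫ t, b t ∂ν)
          linarith
      exact this
  rw [X.sampling_apply hm]
  calc ∫⁻ x, X.matrixLaw x (labelable N Φ ν δ)ᶜ ∂P
      ≤ ∫⁻ x, (⋃ b ∈ Φ, B b).indicator 1 x ∂P := lintegral_mono_ae hle
    _ = P (⋃ b ∈ Φ, B b) := lintegral_indicator_one hU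
    _ ≤ ∑ b ∈ Φ, P (B b) := measure_biUnion_finset_le _ _
    _ ≤ _ := Finset.sum_le_sum fun b _ =>
        measure_empirical_sub_ge_le X.μ (a := fun t => b (f t)) (b.continuous.measurable.comp hf.1)
          (fun t => b.norm_coe_le_norm _) hN (by positivity)

/-- Labelability passes to limits of sampling laws. -/
theorem sampling_labelable_compl_le_of_tendsto {ι : Type*} {L : Filter ι} [L.NeBot]
    {X : ι → QMMSpace} {f : ∀ i, (X i).carrier → Y} (hf : ∀ i, f i ∈ (X i).Lip1 Y)
    {ζ : ProbabilityMeasure DistMatrix} (hX : Tendsto (fun i => (X i).sampling) L (𝓝 ζ))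
    {ν : Measure Y} (hν : ∀ b : C(Y, ℝ),
      Tendsto (fun i => ∫ t, b t ∂((X i).μ.map (f i))) L (𝓝 (∫ t, b t ∂ν)))
    (Φ : Finset C(Y, ℝ)) {N : ℕ} (hN : 0 < N) {δ : ℝ} (hδ : 0 < δ) :
    (ζ : Measure DistMatrix) (labelable N Φ ν δ)ᶜ ≤
      ∑ b ∈ Φ, ENNReal.ofReal (‖b‖ ^ 2 / (N * (δ / 2) ^ 2)) := by
  have hopen : IsOpen (labelable N Φ ν δ)ᶜ := (isClosed_labelable N Φ ν δ).isOpen_compl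
  refine (ProbabilityMeasure.le_liminf_measure_open_of_tendsto hX hopen).trans ?_
  have hev : ∀ᶠ i in L, ∀ b ∈ Φ, |∫ t, b t ∂((X i).μ.map (f i)) - ∫ t, b t ∂ν| ≤ δ / 2 := by
    rw [Filter.eventually_all_finset]
    intro b _
    filter_upwards [Metric.tendsto_nhds.1 (hν b) (δ / 2) (by positivity)] with i hi
    exact hi.le
  refine liminf_le_of_frequently_le (Eventually.frequently ?_)
  filter_upwards [hev] with i hi
  exact sampling_labelable_compl_le (X i) (hf i) Φ ν hN hδ hi

end Labels

/-! ### Excess of label distances over random lengths -/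

section Excess

variable (Y : Type*) [MetricSpace Y]

/-- The excess `(dist y y' - l)⁺` as a continuous function of `(y, y')`, depending continuously
on `l`. -/
def excessMap : C(I, C(Y × Y, ℝ)) :=
  ContinuousMap.curry ⟨fun p : I × (Y × Y) => max (dist p.2.1 p.2.2 - (p.1 : ℝ)) 0, by fun_prop⟩

variable {Y}

variable [CompactSpace Y]

/-- The mean excess of the distance in `Y` over the random distance in `X`. -/
def QMMSpace.excess (X : QMMSpace) (p : X.carrier × X.carrier) : C(Y × Y, ℝ) :=
  ∫ l, excessMap Y l ∂(X.dStar p)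

theorem integrable_excessMap (m : Measure I) [IsFiniteMeasure m] :
    Integrable (fun l => excessMap Y l) m :=
  (ContinuousMap.continuous (excessMap Y)).integrable_of_hasCompactSupport
    (HasCompactSupport.of_compactSpace _)

theorem QMMSpace.excess_apply (X : QMMSpace) (p : X.carrier × X.carrier) (y y' : Y) :
    X.excess p (y, y') = ∫ l : I, max (dist y y' - (l : ℝ)) 0 ∂(X.dStar p) := by
  have := (ContinuousMap.evalCLM ℝ (y, y')).integral_comp_comm
    (integrable_excessMap (Y := Y) (X.dStar p))
  exact this.symm

theorem QMMSpace.excess_comm (X : QMMSpace) (x x' : X.carrier) (y y' : Y) :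
    X.excess (x, x') (y, y') = X.excess (x', x) (y', y) := by
  rw [excess_apply, excess_apply, X.dStar_comm, dist_comm]

theorem QMMSpace.excess_nonneg (X : QMMSpace) (p : X.carrier × X.carrier) (q : Y × Y) :
    0 ≤ X.excess p q := by
  rw [show q = (q.1, q.2) from rfl, excess_apply]
  exact integral_nonneg fun l => le_max_right _ _

/-- Lengths of at least `t` contribute at most `η`; shorter ones contribute at most the diameter
bound `R`. This reduces the mean excess to probabilities of falling below a threshold. -/
theorem QMMSpace.excess_le (X : QMMSpace) (p : X.carrier × X.carrier) (y y' : Y) {t η R : ℝ}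
    (hη : 0 ≤ η) (hR : dist y y' ≤ R) (ht : dist y y' ≤ t + η) :
    X.excess p (y, y') ≤ η + R * (X.dStar p).real {l : I | (l : ℝ) < t} := by
  have hm : MeasurableSet {l : I | (l : ℝ) < t} :=
    measurableSet_lt measurable_subtype_coe measurable_const
  have hR0 : 0 ≤ R := dist_nonneg.trans hR
  rw [excess_apply]
  calc ∫ l : I, max (dist y y' - (l : ℝ)) 0 ∂(X.dStar p)
      ≤ ∫ l : I, (η + {l : I | (l : ℝ) < t}.indicator (fun _ => R) l) ∂(X.dStar p) := by
        refine integral_mono ?_ ?_ fun l => ?_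
        · exact (by fun_prop : Continuous fun l : I =>
            max (dist y y' - (l : ℝ)) 0).integrable_of_hasCompactSupport
            (HasCompactSupport.of_compactSpace _)
        · exact (integrable_const _).add ((integrable_const _).indicator hm)
        · simp only [Set.indicator_apply, Set.mem_ofPred_eq]
          have := l.2.1
          split_ifs with h
          · exact max_le (by linarith) (by linarith)
          · exact max_le (by linarith) (by linarith)
    _ = η + R * (X.dStar p).real {l : I | (l : ℝ) < t} := by
        rw [integral_add (integrable_const _) ((integrable_const _).indicator hm),
          integral_indicator_const _ hm]
        simp [mul_comm]

end Excess

/-! ### Number of labellings against independence of the entries -/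

/-- The positions above the diagonal in the upper left `N × N` block. -/
def upperBlock (N : ℕ) : Finset Upper :=
  (Finset.range N ×ˢ Finset.range N).subtype fun p => p.1 < p.2

theorem mem_upperBlock {N : ℕ} {p : Upper} : p ∈ upperBlock N ↔ p.1.2 < N := by
  have := p.2
  simp only [upperBlock, Finset.mem_subtype, Finset.mem_product, Finset.mem_range]
  omega

theorem card_upperBlock_le (N : ℕ) : (upperBlock N).card ≤ N ^ 2 := by
  rw [upperBlock, Finset.card_subtype]
  refine (Finset.card_filter_le _ _).trans ?_
  simp [sq]

theorem sum_offDiag_range (N : ℕ) (F : ℕ × ℕ → ℝ) (hF : ∀ i j, F (i, j) = F (j, i)) :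
    ∑ p ∈ (Finset.range N).offDiag, F p = 2 * ∑ p ∈ upperBlock N, F p.1 := by
  have h1 : ∑ p ∈ upperBlock N, F p.1 =
      ∑ p ∈ (Finset.range N ×ˢ Finset.range N) with p.1 < p.2, F p := by
    rw [upperBlock, Finset.sum_subtype_eq_sum_filter]
  have h2 : ∑ p ∈ (Finset.range N ×ˢ Finset.range N) with p.2 < p.1, F p =
      ∑ p ∈ (Finset.range N ×ˢ Finset.range N) with p.1 < p.2, F p := by
    refine Finset.sum_equiv (Equiv.prodComm ℕ ℕ) (fun p => ?_) fun p _ => hF _ _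
    simp [and_comm]
  have h3 : (Finset.range N).offDiag =
      ({p ∈ Finset.range N ×ˢ Finset.range N | p.1 < p.2}) ∪
        {p ∈ Finset.range N ×ˢ Finset.range N | p.2 < p.1} := by
    ext p
    simp only [Finset.mem_offDiag, Finset.mem_union, Finset.mem_filter, Finset.mem_product]
    have : p.1 ≠ p.2 ↔ p.1 < p.2 ∨ p.2 < p.1 := by omega
    rw [this]
    tauto
  rw [h3, Finset.sum_union, h1, h2, two_mul]
  refine Finset.disjoint_filter.2 fun p _ h => by omega

/-- Independent entries rarely dominate a family of thresholds with large total probability of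
failure. -/
theorem QMMSpace.matrixLaw_thresholds_le (X : QMMSpace) (x : ℕ → X.carrier) (P : Finset Upper)
    (t : Upper → ℝ) {s : ℝ}
    (hs : s ≤ ∑ p ∈ P, (X.dStar (x p.1.1, x p.1.2)).real {l : I | (l : ℝ) < t p}) :
    X.matrixLaw x {d | ∀ p ∈ P, t p ≤ d.1 p.1.1 p.1.2} ≤ ENNReal.ofReal (Real.exp (-s)) := by
  have hm : ∀ p, MeasurableSet {l : I | t p ≤ (l : ℝ)} := fun p =>
    measurableSet_le measurable_const measurable_subtype_coe
  have h := X.matrixLaw_cylinder x P (fun p => {l : I | t p ≤ (l : ℝ)}) hm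
  refine h.trans_le ?_
  calc ∏ p ∈ P, X.dStar (x p.1.1, x p.1.2) {l : I | t p ≤ (l : ℝ)}
      ≤ ∏ p ∈ P, ENNReal.ofReal
          (Real.exp (-(X.dStar (x p.1.1, x p.1.2)).real {l : I | (l : ℝ) < t p})) := by
        refine Finset.prod_le_prod' fun p _ => ?_
        have hc : {l : I | t p ≤ (l : ℝ)} = {l : I | (l : ℝ) < t p}ᶜ := by
          ext l; simp
        rw [hc, ← ofReal_measureReal,
          measureReal_compl (measurableSet_lt measurable_subtype_coe measurable_const)]
        refine ENNReal.ofReal_le_ofReal ?_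
        simp only [probReal_univ]
        linarith [Real.add_one_le_exp
          (-(X.dStar (x p.1.1, x p.1.2)).real {l : I | (l : ℝ) < t p})]
    _ = ENNReal.ofReal (Real.exp
          (∑ p ∈ P, -(X.dStar (x p.1.1, x p.1.2)).real {l : I | (l : ℝ) < t p})) := by
        rw [Real.exp_sum, ENNReal.ofReal_prod_of_nonneg fun _ _ => (Real.exp_pos _).le]
    _ ≤ ENNReal.ofReal (Real.exp (-s)) := by
        refine ENNReal.ofReal_le_ofReal (Real.exp_le_exp.2 ?_)
        rw [Finset.sum_neg_distrib]
        linarith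

/-- Union bound over finitely many labels. -/
theorem QMMSpace.matrixLaw_labels_le (X : QMMSpace) (x : ℕ → X.carrier) {A : Type*} [Fintype A]
    {N : ℕ} [NeZero N] (t : A → A → ℝ) {s : ℝ} :
    X.matrixLaw x {d | ∃ a : Fin N → A,
        (∀ p ∈ upperBlock N, t (a (Fin.ofNat N p.1.1)) (a (Fin.ofNat N p.1.2)) ≤ d.1 p.1.1 p.1.2) ∧
        s ≤ ∑ p ∈ upperBlock N, (X.dStar (x p.1.1, x p.1.2)).real
          {l : I | (l : ℝ) < t (a (Fin.ofNat N p.1.1)) (a (Fin.ofNat N p.1.2))}} ≤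
      (Fintype.card A : ℝ≥0∞) ^ N * ENNReal.ofReal (Real.exp (-s)) := by
  classical
  rw [Set.ofPred_exists]
  refine (measure_iUnion_fintype_le _ _).trans ?_
  calc _ ≤ ∑ _a : Fin N → A, ENNReal.ofReal (Real.exp (-s)) := by
        refine Finset.sum_le_sum fun a _ => ?_
        by_cases ha : s ≤ ∑ p ∈ upperBlock N, (X.dStar (x p.1.1, x p.1.2)).real
          {l : I | (l : ℝ) < t (a (Fin.ofNat N p.1.1)) (a (Fin.ofNat N p.1.2))}
        · exact (measure_mono fun d hd => hd.1).trans (X.matrixLaw_thresholds_le x (upperBlock N)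
            (fun p => t (a (Fin.ofNat N p.1.1)) (a (Fin.ofNat N p.1.2))) ha)
        · refine (measure_mono fun d hd => ?_).trans (measure_empty (μ := X.matrixLaw x)).le |>.trans
            zero_le
          exact ha hd.2
    _ = _ := by simp

/-- The logarithm of the number of labellings is linear in `N`, the exponent of the failure
probability quadratic. Once `K ≤ exp (δ * N - 1)`, the product is at most `exp (-N)`. -/
theorem eventually_pow_mul_exp_lt (K : ℕ) {δ : ℝ} (hδ : 0 < δ) :
    ∀ᶠ N : ℕ in atTop,
      (K : ℝ≥0∞) ^ N * ENNReal.ofReal (Real.exp (-(δ * N ^ 2))) < 1 / 2 := by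
  have h1 : Tendsto (fun N : ℕ => Real.exp (δ * N - 1)) atTop atTop :=
    Real.tendsto_exp_atTop.comp (tendsto_atTop_add_const_right _ _
      (tendsto_natCast_atTop_atTop.const_mul_atTop hδ))
  filter_upwards [h1.eventually_ge_atTop (K : ℝ), eventually_ge_atTop 1] with N hN hN1
  have hN1' : (1 : ℝ) ≤ N := by exact_mod_cast hN1
  have e : (K : ℝ≥0∞) ^ N * ENNReal.ofReal (Real.exp (-(δ * N ^ 2))) =
      ENNReal.ofReal ((K : ℝ) ^ N * Real.exp (-(δ * N ^ 2))) := by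
    rw [ENNReal.ofReal_mul (by positivity), ENNReal.ofReal_pow (by positivity),
      ENNReal.ofReal_natCast]
  have h2 : (1 / 2 : ℝ≥0∞) = ENNReal.ofReal (1 / 2) := by
    rw [ENNReal.ofReal_div_of_pos (by norm_num)]; simp
  rw [e, h2, ENNReal.ofReal_lt_ofReal_iff (by norm_num)]
  calc (K : ℝ) ^ N * Real.exp (-(δ * N ^ 2))
      ≤ Real.exp (δ * N - 1) ^ N * Real.exp (-(δ * N ^ 2)) := by gcongr
    _ = Real.exp (-N) := by
        rw [← Real.exp_nat_mul, ← Real.exp_add]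
        congr 1
        ring
    _ ≤ Real.exp (-1) := Real.exp_le_exp.2 (by linarith)
    _ < 1 / 2 := by
        rw [Real.exp_neg, one_div]
        exact inv_strictAnti₀ (by norm_num) (by linarith [Real.exp_one_gt_d9])

theorem eventually_sum_ofReal_div_le {α : Type*} (S : Finset α) (C : α → ℝ) {c : ℝ} (hc : 0 < c) :
    ∀ᶠ N : ℕ in atTop, ∑ a ∈ S, ENNReal.ofReal (C a / (N * c)) ≤ 1 / 8 := by
  have h : Tendsto (fun N : ℕ => ∑ a ∈ S, ENNReal.ofReal (C a / (N * c))) atTop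
      (𝓝 (∑ a ∈ S, ENNReal.ofReal 0)) := by
    refine tendsto_finsetSum _ fun a _ => ENNReal.tendsto_ofReal ?_
    exact Tendsto.const_div_atTop (tendsto_natCast_atTop_atTop.atTop_mul_const hc) _
  have h0 : ∑ a ∈ S, ENNReal.ofReal 0 < 1 / 8 := by simp
  exact (h.eventually_lt_const h0).mono fun N hN => hN.le

/-! ### Existence of good labelled samples -/

section LabelledSample

variable {Y : Type*} [MetricSpace Y] [CompactSpace Y]

variable (Y) in
theorem exists_finite_net {ε : ℝ} (hε : 0 < ε) :
    ∃ (S : Finset Y) (q : Y → S), ∀ y : Y, dist y (q y : Y) ≤ ε := by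
  obtain ⟨s, -, hs, hs'⟩ := (isCompact_univ (X := Y)).finite_cover_balls hε
  have hex : ∀ y : Y, ∃ c : hs.toFinset, dist y (c : Y) ≤ ε := fun y => by
    have := hs' (Set.mem_univ y)
    simp only [Set.mem_iUnion, Metric.mem_ball, exists_prop] at this
    obtain ⟨c, hc, hd⟩ := this
    exact ⟨⟨c, by simpa using hc⟩, hd.le⟩
  choose q hq using hex
  exact ⟨hs.toFinset, q, hq⟩

theorem sum_offDiag_lintegral {Ω : Type*} [MeasurableSpace Ω] (μ : Measure Ω)
    [IsProbabilityMeasure μ] {v : Ω × Ω → ℝ≥0∞} (hv : Measurable v) (N : ℕ) :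
    ∫⁻ x, ∑ p ∈ (Finset.range N).offDiag, v (x p.1, x p.2) ∂(Measure.infinitePi fun _ : ℕ => μ) ≤
      (N : ℝ≥0∞) ^ 2 * ∫⁻ z, v z ∂(μ.prod μ) := by
  have hm : ∀ p : ℕ × ℕ, Measurable fun x : ℕ → Ω => v (x p.1, x p.2) := fun p =>
    hv.comp (by fun_prop)
  rw [lintegral_finsetSum _ fun p _ => hm p]
  have : ∀ p ∈ (Finset.range N).offDiag,
      ∫⁻ x, v (x p.1, x p.2) ∂(Measure.infinitePi fun _ : ℕ => μ) = ∫⁻ z, v z ∂(μ.prod μ) := by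
    intro p hp
    rw [← Measure.infinitePi_map_eval_prod (P := fun _ : ℕ => μ) (Finset.mem_offDiag.1 hp).2.2,
      lintegral_map hv (by fun_prop)]
  rw [Finset.sum_congr rfl this, Finset.sum_const, nsmul_eq_mul]
  gcongr
  have h : (Finset.range N).offDiag.card ≤ N ^ 2 := by
    rw [Finset.offDiag_card, Finset.card_range, sq]
    exact Nat.sub_le _ _
  exact_mod_cast h

variable [MeasurableSpace Y]

/-- If most samples of `X` are labelable, there are samples with good statistics and labels of
small mean excess. -/
theorem QMMSpace.exists_labelled_sample (X : QMMSpace) {ν : Measure Y} (Φ : Finset C(Y, ℝ))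
    {δ : ℝ} (hδ : 0 < δ) (hlab : ∀ N : ℕ, 0 < N →
      (X.sampling : Measure DistMatrix) (labelable N Φ ν δ)ᶜ ≤
        ∑ b ∈ Φ, ENNReal.ofReal (‖b‖ ^ 2 / (N * (δ / 2) ^ 2)))
    {α : Type*} (A : Finset α) {φ : α → X.carrier → ℝ} (hφ : ∀ a, Measurable (φ a))
    {C : α → ℝ} (hC : ∀ a x, |φ a x| ≤ C a)
    {v : ℕ → X.carrier × X.carrier → ℝ≥0∞} (hv : ∀ j, Measurable (v j))
    (hv1 : ∑' j, 2 ^ j * ∫⁻ z, v j z ∂(X.μ.prod X.μ) ≤ 1 / 4) (N₀ : ℕ) :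
    ∃ N, N₀ ≤ N ∧ 0 < N ∧ ∃ (x : ℕ → X.carrier) (y : ℕ → Y),
      (∀ a ∈ A, |(∑ i ∈ Finset.range N, φ a (x i)) / N - ∫ t, φ a t ∂X.μ| ≤ δ) ∧
      (∀ b ∈ Φ, |(∑ i ∈ Finset.range N, b (y i)) / N - ∫ t, b t ∂ν| ≤ δ) ∧
      (∀ j, 2 ^ j * ∑ p ∈ (Finset.range N).offDiag, v j (x p.1, x p.2) ≤ (N : ℝ≥0∞) ^ 2) ∧
      ∑ p ∈ (Finset.range N).offDiag, X.excess (x p.1, x p.2) (y p.1, y p.2) ≤ δ * N ^ 2 := by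
  classical
  set P := Measure.infinitePi fun _ : ℕ => X.μ with hP
  -- Rounding two labels changes their distance by at most `δ / 8`; together with the margin `δ / 8`
  -- in the threshold `t` below, this makes the error `δ / 4` per pair.
  obtain ⟨S, q, hq⟩ := exists_finite_net Y (ε := δ / 16) (by positivity)
  set R : ℝ := Metric.diam (Set.univ : Set Y) with hR
  have hdist : ∀ y y' : Y, dist y y' ≤ R := fun y y' =>
    Metric.dist_le_diam_of_mem isCompact_univ.isBounded (Set.mem_univ y) (Set.mem_univ y')
  have hR0 : 0 ≤ R := Metric.diam_nonneg
  -- Chosen so that `R * δ'` is at most `δ / 4`; adding the rounding error and counting ordered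
  -- pairs gives `δ` in the end.
  set δ' : ℝ := δ / (4 * (R + 1)) with hδ'
  have hδ'0 : 0 < δ' := by positivity
  obtain ⟨N, hN1, hN2, hN3, hN0, hNpos⟩ :=
    ((eventually_sum_ofReal_div_le Φ (fun b => ‖b‖ ^ 2) (c := (δ / 2) ^ 2) (by positivity)).and
      ((eventually_sum_ofReal_div_le A (fun a => C a ^ 2) (c := δ ^ 2) (by positivity)).and
        ((eventually_pow_mul_exp_lt (Fintype.card S) hδ'0).and
          ((eventually_ge_atTop N₀).and (eventually_ge_atTop 1))))).exists
  have hNpos' : (0 : ℝ) < N := by exact_mod_cast hNpos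
  have : NeZero N := ⟨by omega⟩
  refine ⟨N, hN0, hNpos, ?_⟩
  -- the bad events for the sample
  have hlm : MeasurableSet (labelable N Φ ν δ)ᶜ := (isClosed_labelable N Φ ν δ).measurableSet.compl
  -- Three bad events for the points: labels are unlikely, the statistics are wrong, or some error
  -- `v j` is large on the sample. Their probabilities are at most `1 / 4`, `1 / 8` and `1 / 4`, so
  -- good points exist.
  let B₁ : Set (ℕ → X.carrier) := {x | 1 / 2 ≤ X.matrixLaw x (labelable N Φ ν δ)ᶜ}
  let B₂ : Set (ℕ → X.carrier) :=
    ⋃ a ∈ A, {x | δ ≤ |(∑ i ∈ Finset.range N, φ a (x i)) / N - ∫ t, φ a t ∂X.μ|}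
  let B₃ : Set (ℕ → X.carrier) := ⋃ j,
    {x | (N : ℝ≥0∞) ^ 2 ≤ 2 ^ j * ∑ p ∈ (Finset.range N).offDiag, v j (x p.1, x p.2)}
  have hB₁ : P B₁ ≤ 1 / 4 := by
    have h := mul_meas_ge_le_lintegral (μ := P) (X.measurable_matrixLaw_apply hlm) (1 / 2)
    rw [← X.sampling_apply hlm] at h
    have h' := h.trans ((hlab N hNpos).trans hN1)
    calc P B₁ = 2 * (1 / 2 * P B₁) := by
          rw [← mul_assoc, one_div, ENNReal.mul_inv_cancel (by norm_num) (by norm_num), one_mul]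
      _ ≤ 2 * (1 / 8) := by gcongr
      _ = 1 / 4 := by
          rw [← ENNReal.toReal_eq_toReal_iff' (by finiteness) (by finiteness)]
          norm_num
  have hB₂ : P B₂ ≤ 1 / 8 := by
    refine (measure_biUnion_finset_le _ _).trans (le_trans ?_ hN2)
    exact Finset.sum_le_sum fun a _ =>
      measure_empirical_sub_ge_le X.μ (hφ a) (hC a) hNpos hδ
  have hB₃ : P B₃ ≤ 1 / 4 := by
    refine (measure_iUnion_le _).trans (le_trans ?_ hv1)
    refine ENNReal.tsum_le_tsum fun j => ?_
    have hm : Measurable fun x : ℕ → X.carrier =>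
        2 ^ j * ∑ p ∈ (Finset.range N).offDiag, v j (x p.1, x p.2) :=
      (Finset.measurable_sum _ fun p _ => (hv j).comp (by fun_prop)).const_mul _
    have hNN : ((N : ℝ≥0∞) ^ 2) ≠ 0 := by
      simp only [ne_eq, pow_eq_zero_iff, OfNat.ofNat_ne_zero, not_false_eq_true, Nat.cast_eq_zero]
      omega
    have h := mul_meas_ge_le_lintegral (μ := P) hm ((N : ℝ≥0∞) ^ 2)
    rw [lintegral_const_mul' _ _ (by finiteness)] at h
    have h' := h.trans (mul_le_mul_right (sum_offDiag_lintegral X.μ (hv j) N) (2 ^ j))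
    rw [mul_left_comm] at h'
    exact (ENNReal.mul_le_mul_iff_right hNN (by finiteness)).1 h'
  obtain ⟨x, hx⟩ : ∃ x, x ∉ B₁ ∪ (B₂ ∪ B₃) := by
    by_contra hcon
    push Not at hcon
    have h1 : P Set.univ ≤ 1 / 4 + (1 / 8 + 1 / 4) :=
      (measure_mono fun x _ => hcon x).trans ((measure_union_le _ _).trans
        (add_le_add hB₁ ((measure_union_le _ _).trans (add_le_add hB₂ hB₃))))
    rw [measure_univ, ← ENNReal.toReal_le_toReal (by finiteness) (by finiteness)] at h1
    rw [ENNReal.toReal_add (by finiteness) (by finiteness),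
      ENNReal.toReal_add (by finiteness) (by finiteness)] at h1
    norm_num at h1
  simp only [Set.mem_union, not_or] at hx
  obtain ⟨hx1, hx2, hx3⟩ := hx
  -- the matrix
  let t : S → S → ℝ := fun c c' => dist (c : Y) c' - δ / 8
  -- With the points fixed, the matrices dominating some rounded labelling that is likely to be
  -- violated. Their probability is below `1 / 2`, as is that of having no labels, so some matrix
  -- avoids both.
  let Bad : Set DistMatrix := {d | ∃ a : Fin N → S,
        (∀ p ∈ upperBlock N, t (a (Fin.ofNat N p.1.1)) (a (Fin.ofNat N p.1.2)) ≤ d.1 p.1.1 p.1.2) ∧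
        δ' * N ^ 2 ≤ ∑ p ∈ upperBlock N, (X.dStar (x p.1.1, x p.1.2)).real
          {l : I | (l : ℝ) < t (a (Fin.ofNat N p.1.1)) (a (Fin.ofNat N p.1.2))}}
  have hBad : X.matrixLaw x Bad < 1 / 2 := (X.matrixLaw_labels_le x t).trans_lt hN3
  obtain ⟨d, hd⟩ : ∃ d, d ∉ (labelable N Φ ν δ)ᶜ ∪ Bad := by
    by_contra hcon
    push Not at hcon
    have h1 : X.matrixLaw x Set.univ < 1 / 2 + 1 / 2 :=
      ((measure_mono fun x _ => hcon x).trans (measure_union_le _ _)).trans_lt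
        (ENNReal.add_lt_add (not_le.1 hx1) hBad)
    rw [measure_univ, ENNReal.add_halves] at h1
    exact lt_irrefl _ h1
  simp only [Set.mem_union, not_or, Set.mem_compl_iff, not_not] at hd
  obtain ⟨⟨y, hy1, hy2⟩, hd2⟩ := hd
  refine ⟨x, y, fun a ha => ?_, hy2, fun j => ?_, ?_⟩
  · by_contra hcon
    exact hx2 (Set.mem_biUnion ha (not_le.1 hcon).le)
  · by_contra hcon
    exact hx3 (Set.mem_iUnion.2 ⟨j, (not_le.1 hcon).le⟩)
  -- the excess
  let a : Fin N → S := fun i => q (y i)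
  have hval : ∀ i < N, a (Fin.ofNat N i) = q (y i) := fun i hi => by
    simp only [a]
    congr 2
    exact Nat.mod_eq_of_lt hi
  have hcmp : ∀ u w : Y, dist (q u : Y) (q w) ≤ dist u w + δ / 8 ∧
      dist u w ≤ dist (q u : Y) (q w) + δ / 8 := by
    intro u w
    have h1 := hq u
    have h2 := hq w
    have h3 := dist_triangle4 (q u : Y) u w (q w)
    have h4 := dist_triangle4 u (q u : Y) (q w) w
    rw [dist_comm (q u : Y) u] at h3
    rw [dist_comm (q w : Y) w] at h4
    constructor <;> linarith
  -- The rounded labels are dominated by `d`; a larger sum would therefore put `d` into `Bad`.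
  have hlt : ∑ p ∈ upperBlock N, (X.dStar (x p.1.1, x p.1.2)).real
      {l : I | (l : ℝ) < t (q (y p.1.1)) (q (y p.1.2))} < δ' * N ^ 2 := by
    by_contra hcon
    refine hd2 ⟨a, fun p hp => ?_, ?_⟩
    · have hp2 := mem_upperBlock.1 hp
      have hp1 : p.1.1 < N := lt_trans p.2 hp2
      rw [hval _ hp1, hval _ hp2]
      have := hy1 _ hp1 _ hp2
      have := (hcmp (y p.1.1) (y p.1.2)).1
      simp only [t]
      linarith
    · refine (not_lt.1 hcon).trans (le_of_eq (Finset.sum_congr rfl fun p hp => ?_))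
      have hp2 := mem_upperBlock.1 hp
      have hp1 : p.1.1 < N := lt_trans p.2 hp2
      rw [hval _ hp1, hval _ hp2]
  rw [sum_offDiag_range N (fun p => X.excess (x p.1, x p.2) (y p.1, y p.2))
    fun i j => X.excess_comm _ _ _ _]
  have hsum : ∑ p ∈ upperBlock N, X.excess (x p.1.1, x p.1.2) (y p.1.1, y p.1.2) ≤
      ∑ p ∈ upperBlock N, (δ / 4 + R * (X.dStar (x p.1.1, x p.1.2)).real
        {l : I | (l : ℝ) < t (q (y p.1.1)) (q (y p.1.2))}) := by
    refine Finset.sum_le_sum fun p _ => X.excess_le _ _ _ (by positivity) (hdist _ _) ?_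
    have := (hcmp (y p.1.1) (y p.1.2)).2
    simp only [t]
    linarith
  rw [Finset.sum_add_distrib, Finset.sum_const, nsmul_eq_mul, ← Finset.mul_sum] at hsum
  have hcard : ((upperBlock N).card : ℝ) ≤ N ^ 2 := by exact_mod_cast card_upperBlock_le N
  have h5 : R * ∑ p ∈ upperBlock N, (X.dStar (x p.1.1, x p.1.2)).real
      {l : I | (l : ℝ) < t (q (y p.1.1)) (q (y p.1.2))} ≤ δ / 4 * N ^ 2 :=
    calc _ ≤ R * (δ' * N ^ 2) := by gcongr
      _ ≤ (R + 1) * (δ' * N ^ 2) := by gcongr; linarith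
      _ = δ / 4 * N ^ 2 := by rw [hδ']; field_simp
  have h6 : ((upperBlock N).card : ℝ) * (δ / 4) ≤ N ^ 2 * (δ / 4) := by gcongr
  linarith

end LabelledSample

/-! ### Couplings of a qmm-space with a limit of labels -/

section Empirical

variable {Z : Type*} [MeasurableSpace Z]

/-- The empirical measure of the first `N` points of a sequence. -/
def empirical (N : ℕ) (z : ℕ → Z) : Measure Z :=
  (N : ℝ≥0∞)⁻¹ • ∑ i ∈ Finset.range N, Measure.dirac (z i)

theorem isProbabilityMeasure_empirical {N : ℕ} (hN : 0 < N) (z : ℕ → Z) :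
    IsProbabilityMeasure (empirical N z) := ⟨by
  have hN' : (N : ℝ≥0∞) ≠ 0 := by exact_mod_cast hN.ne'
  simp only [empirical, Measure.smul_apply, Measure.coe_finsetSum, Finset.sum_apply,
    measure_univ, Finset.sum_const, Finset.card_range, nsmul_eq_mul, mul_one, smul_eq_mul]
  exact ENNReal.inv_mul_cancel hN' (ENNReal.natCast_ne_top N)⟩

theorem integral_empirical (N : ℕ) (z : ℕ → Z) {f : Z → ℝ} (hf : StronglyMeasurable f) :
    ∫ t, f t ∂(empirical N z) = (∑ i ∈ Finset.range N, f (z i)) / N := by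
  rw [empirical, integral_smul_measure, integral_finsetSum_measure]
  · simp only [integral_dirac' _ _ hf, ENNReal.toReal_inv, ENNReal.toReal_natCast, smul_eq_mul]
    ring
  · exact fun i _ => integrable_dirac' hf (by simp)

end Empirical

theorem sum_range_sq_eq (N : ℕ) (F : ℕ → ℕ → ℝ) :
    ∑ i ∈ Finset.range N, ∑ j ∈ Finset.range N, F i j =
      ∑ p ∈ (Finset.range N).offDiag, F p.1 p.2 + ∑ i ∈ Finset.range N, F i i := by
  classical
  rw [← Finset.sum_product', ← Finset.diag_union_offDiag, Finset.sum_union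
    (Finset.disjoint_diag_offDiag _), add_comm, Finset.sum_diag]

section Coupling

variable {Y : Type*} [MetricSpace Y] [CompactSpace Y]

theorem QMMSpace.norm_excess_le (X : QMMSpace) (p : X.carrier × X.carrier) :
    ‖(X.excess p : C(Y × Y, ℝ))‖ ≤ ‖excessMap Y‖ := by
  have := norm_integral_le_of_norm_le_const (μ := X.dStar p) (f := fun l => excessMap Y l)
    (C := ‖excessMap Y‖) (Eventually.of_forall fun l => (excessMap Y).norm_coe_le_norm l)
  rw [probReal_univ, mul_one] at this
  exact this

theorem QMMSpace.stronglyMeasurable_excess (X : QMMSpace) :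
    StronglyMeasurable fun p => (X.excess p : C(Y × Y, ℝ)) :=
  StronglyMeasurable.integral_kernel (κ := X.dStar)
    (ContinuousMap.continuous (excessMap Y)).stronglyMeasurable

/-- The function of pairs of labelled points given by a function of pairs of points with values in
the functions of pairs of labels. -/
def pairEval {T : Type*} (c : T × T → C(Y × Y, ℝ)) (w : (T × Y) × (T × Y)) : ℝ :=
  c (w.1.1, w.2.1) (w.1.2, w.2.2)

theorem continuous_pairEval {c : I × I → C(Y × Y, ℝ)} (hc : Continuous c) :
    Continuous (pairEval c) := by
  unfold pairEval
  fun_prop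

variable [MeasurableSpace Y] [BorelSpace Y]

theorem stronglyMeasurable_pairEval {c : I × I → C(Y × Y, ℝ)} (hc : StronglyMeasurable c) :
    StronglyMeasurable (pairEval c) := by
  have h1 : StronglyMeasurable fun w : (I × Y) × (I × Y) => c (w.1.1, w.2.1) :=
    hc.comp_measurable (g := fun w : (I × Y) × (I × Y) => (w.1.1, w.2.1)) (by fun_prop)
  have h2 : StronglyMeasurable fun w : (I × Y) × (I × Y) => (w.1.2, w.2.2) :=
    (by fun_prop : Continuous fun w : (I × Y) × (I × Y) => (w.1.2, w.2.2)).stronglyMeasurable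
  exact (by fun_prop : Continuous fun q : C(Y × Y, ℝ) × (Y × Y) =>
    q.1 q.2).comp_stronglyMeasurable (h1.prodMk h2)

/-- Averages of a continuous pair function over an empirical measure. -/
theorem integral_pairEval_empirical_le {c H : I × I → C(Y × Y, ℝ)} (hc : Continuous c) {N : ℕ}
    (hN : 0 < N) (t : ℕ → I) (y : ℕ → Y) {C δ η : ℝ} (hC : ∀ q, ‖c q‖ ≤ C)
    (hδ : ∑ p ∈ (Finset.range N).offDiag, H (t p.1, t p.2) (y p.1, y p.2) ≤ δ * N ^ 2)
    (hη : ∑ p ∈ (Finset.range N).offDiag, ‖H (t p.1, t p.2) - c (t p.1, t p.2)‖ ≤ η * N ^ 2) :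
    ∫ w, pairEval c w ∂((empirical N fun i => (t i, y i)).prod (empirical N fun i => (t i, y i))) ≤
      δ + η + C / N := by
  have hN' : (0 : ℝ) < N := by exact_mod_cast hN
  have := isProbabilityMeasure_empirical hN fun i => (t i, y i)
  have hcont := continuous_pairEval hc
  rw [integral_prod _ (hcont.integrable_of_hasCompactSupport (HasCompactSupport.of_compactSpace _))]
  have hcs : ∀ z : I × Y, Continuous fun z' : I × Y => pairEval c (z, z') := fun z => by fun_prop
  simp only [fun z => integral_empirical N (fun i => (t i, y i)) (hcs z).stronglyMeasurable]
  rw [integral_empirical N _ (f := fun z => (∑ i ∈ Finset.range N, pairEval c (z, (t i, y i))) / N)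
    (by fun_prop : Continuous fun z : I × Y =>
      (∑ i ∈ Finset.range N, pairEval c (z, (t i, y i))) / N).stronglyMeasurable]
  rw [← Finset.sum_div, sum_range_sq_eq N fun i j => pairEval c ((t i, y i), (t j, y j))]
  have hev : ∀ (f : C(Y × Y, ℝ)) q, f q ≤ ‖f‖ := fun f q =>
    (le_abs_self _).trans (f.norm_coe_le_norm q)
  have h1 : ∑ p ∈ (Finset.range N).offDiag, pairEval c ((t p.1, y p.1), (t p.2, y p.2)) ≤
      (δ + η) * N ^ 2 := by
    calc _ ≤ ∑ p ∈ (Finset.range N).offDiag, (H (t p.1, t p.2) (y p.1, y p.2) +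
          ‖H (t p.1, t p.2) - c (t p.1, t p.2)‖) := by
          refine Finset.sum_le_sum fun p _ => ?_
          have := hev (c (t p.1, t p.2) - H (t p.1, t p.2)) (y p.1, y p.2)
          rw [norm_sub_rev, ContinuousMap.sub_apply] at this
          simp only [pairEval]
          linarith
      _ ≤ _ := by
          rw [Finset.sum_add_distrib]
          linarith
  -- The empirical product measure also charges the diagonal, where only the norm bound is
  -- available; it costs `C / N`.
  have h2 : ∑ i ∈ Finset.range N, pairEval c ((t i, y i), (t i, y i)) ≤ N * C := by
    calc _ ≤ ∑ i ∈ Finset.range N, C :=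
          Finset.sum_le_sum fun i _ => (hev _ _).trans (hC _)
      _ = N * C := by simp
  rw [div_div, div_le_iff₀ (by positivity)]
  calc _ ≤ (δ + η) * N ^ 2 + N * C := add_le_add h1 h2
    _ = (δ + η + C / N) * (N * N) := by field_simp

end Coupling

section

variable {Y : Type*} [MetricSpace Y] [CompactSpace Y] [MeasurableSpace Y] [BorelSpace Y]

theorem measure_eq_of_forall_integral_continuousMap {Z : Type*} [TopologicalSpace Z]
    [CompactSpace Z] [HasOuterApproxClosed Z] [MeasurableSpace Z] [BorelSpace Z] {m m' : Measure Z}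
    [IsFiniteMeasure m] [IsFiniteMeasure m'] (h : ∀ φ : C(Z, ℝ), ∫ z, φ z ∂m = ∫ z, φ z ∂m') :
    m = m' :=
  ext_of_forall_integral_eq_of_IsFiniteMeasure fun f => h f.toContinuousMap

/-- Bounded continuous approximations with rapidly decreasing errors. -/
theorem exists_approx_seq {E : Type*} [NormedAddCommGroup E] [NormedSpace ℝ E]
    {m : Measure (I × I)} [IsFiniteMeasure m] {H : I × I → E} (hH : Integrable H m) :
    ∃ c : ℕ → (I × I →ᵇ E), (∀ j, ∫⁻ q, ‖H q - c j q‖ₑ ∂m ≤ 4⁻¹ ^ j * 8⁻¹) ∧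
      ∑' j, 2 ^ j * ∫⁻ q, ‖H q - c j q‖ₑ ∂m ≤ 1 / 4 := by
  have h : ∀ j : ℕ, (4⁻¹ : ℝ≥0∞) ^ j * 8⁻¹ ≠ 0 := fun j =>
    mul_ne_zero (pow_ne_zero _ (by simp)) (by simp)
  choose c hc _ using fun j => hH.exists_boundedContinuous_lintegral_sub_le (h j)
  refine ⟨c, hc, ?_⟩
  -- The weights leave room for Markov's inequality, to make all errors along one sample
  -- simultaneously at most `(1 / 2) ^ j`.
  calc ∑' j, 2 ^ j * ∫⁻ q, ‖H q - c j q‖ₑ ∂m ≤ ∑' j : ℕ, (2⁻¹ : ℝ≥0∞) ^ j * 8⁻¹ := by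
        refine ENNReal.tsum_le_tsum fun j => ?_
        refine (mul_le_mul_right (hc j) _).trans (le_of_eq ?_)
        have : (4⁻¹ : ℝ≥0∞) = 2⁻¹ * 2⁻¹ := by
          rw [← ENNReal.mul_inv (by simp) (by simp)]; norm_num
        rw [this, mul_pow, ← mul_assoc, ← mul_assoc, ← mul_pow,
          ENNReal.mul_inv_cancel (by simp) (by simp), one_pow, one_mul]
    _ = 1 / 4 := by
        rw [ENNReal.tsum_mul_right, ENNReal.tsum_geometric, ENNReal.one_sub_inv_two, inv_inv,
          ← ENNReal.toReal_eq_toReal_iff' (by finiteness) (by finiteness)]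
        norm_num

variable (X : QMMSpace) {e : X.carrier → I} {s : I → X.carrier}

/-- Limits of good labelled samples couple `X` with the limit of the label distributions. -/
theorem QMMSpace.exists_coupling (he : Measurable e) (hs : Measurable s) (hse : ∀ x, s (e x) = x)
    {ν : Measure Y} [IsProbabilityMeasure ν]
    (hlab : ∀ (Φ : Finset C(Y, ℝ)) (δ : ℝ), 0 < δ → ∀ N : ℕ, 0 < N →
      (X.sampling : Measure DistMatrix) (labelable N Φ ν δ)ᶜ ≤
        ∑ b ∈ Φ, ENNReal.ofReal (‖b‖ ^ 2 / (N * (δ / 2) ^ 2))) :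
    ∃ Θ : ProbabilityMeasure (I × Y), (Θ : Measure (I × Y)).map Prod.fst = X.μ.map e ∧
      (Θ : Measure (I × Y)).map Prod.snd = ν ∧
      ∀ᵐ w ∂((Θ : Measure (I × Y)).prod (Θ : Measure (I × Y))),
        X.excess (s w.1.1, s w.2.1) (w.1.2, w.2.2) = 0 := by
  set m : Measure I := X.μ.map e with hm
  have : IsProbabilityMeasure m := Measure.isProbabilityMeasure_map he.aemeasurable
  -- The excess is continuous in the labels but only measurable in the points, so its integral need
  -- not pass to weak limits. It is replaced by continuous `c j`, close to it both along the samples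
  -- and under the limit measure.
  let H : I × I → C(Y × Y, ℝ) := fun q => X.excess (s q.1, s q.2)
  have hHm : StronglyMeasurable H :=
    X.stronglyMeasurable_excess.comp_measurable (g := fun q : I × I => (s q.1, s q.2))
      (by fun_prop)
  have hHb : ∀ q, ‖H q‖ ≤ ‖excessMap Y‖ := fun q => X.norm_excess_le _
  have hHi : Integrable H (m.prod m) :=
    Integrable.of_bound hHm.aestronglyMeasurable _ (Eventually.of_forall hHb)
  obtain ⟨c, hc1, hc2⟩ := exists_approx_seq hHi
  have hem : (X.μ.prod X.μ).map (Prod.map e e) = m.prod m := by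
    rw [hm, Measure.map_prod_map _ _ he he]
  have hdm : ∀ j, StronglyMeasurable fun q => H q - c j q := fun j =>
    hHm.sub (c j).continuous.stronglyMeasurable
  let v : ℕ → X.carrier × X.carrier → ℝ≥0∞ := fun j p =>
    ‖H (Prod.map e e p) - c j (Prod.map e e p)‖ₑ
  have hv : ∀ j, Measurable (v j) := fun j =>
    (hdm j).enorm.comp (he.prodMap he)
  have hvi : ∀ j, ∫⁻ p, v j p ∂(X.μ.prod X.μ) = ∫⁻ q, ‖H q - c j q‖ₑ ∂(m.prod m) := fun j => by
    rw [← hem, lintegral_map (hdm j).enorm (he.prodMap he)]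
  have hv1 : ∑' j, 2 ^ j * ∫⁻ p, v j p ∂(X.μ.prod X.μ) ≤ 1 / 4 := by
    simp only [hvi]; exact hc2
  -- good labelled samples
  have hex : ∀ T : Finset C(I, ℝ) × Finset C(Y, ℝ) × ℕ, ∃ Θ : ProbabilityMeasure (I × Y),
      (∀ a ∈ T.1, |∫ z, a z.1 ∂(Θ : Measure (I × Y)) - ∫ t, a t ∂m| ≤ 1 / ((T.2.2 : ℝ) + 1)) ∧
      (∀ b ∈ T.2.1, |∫ z, b z.2 ∂(Θ : Measure (I × Y)) - ∫ t, b t ∂ν| ≤ 1 / ((T.2.2 : ℝ) + 1)) ∧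
      ∀ j ≤ T.2.2, ∫ w, pairEval (c j) w ∂((Θ : Measure (I × Y)).prod (Θ : Measure (I × Y))) ≤
        1 / ((T.2.2 : ℝ) + 1) + (1 / 2) ^ j + 1 / ((T.2.2 : ℝ) + 1) := by
    rintro ⟨Ψ, Φ, n⟩
    set δ : ℝ := 1 / ((n : ℝ) + 1) with hδ
    have hδ0 : 0 < δ := by positivity
    -- The lower bound on `N` makes the diagonal term `‖c j‖ / N` at most `δ` for all `j ≤ n`.
    obtain ⟨N, hN0, hN, x, y, h1, h2, h3, h4⟩ := X.exists_labelled_sample Φ hδ0 (hlab Φ δ hδ0) Ψ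
      (φ := fun a x => a (e x)) (fun a => a.continuous.measurable.comp he) (C := fun a => ‖a‖)
      (fun a x => a.norm_coe_le_norm _) hv hv1 ⌈(∑ j ∈ Finset.range (n + 1), ‖c j‖) * (n + 1)⌉₊
    have hN' : (0 : ℝ) < N := by exact_mod_cast hN
    let z : ℕ → I × Y := fun i => (e (x i), y i)
    refine ⟨⟨empirical N z, isProbabilityMeasure_empirical hN z⟩, fun a ha => ?_, fun b hb => ?_,
      fun j hj => ?_⟩
    · rw [ProbabilityMeasure.coe_mk, integral_empirical N z
        (by fun_prop : Continuous fun z : I × Y => a z.1).stronglyMeasurable, hm,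
        integral_map he.aemeasurable a.continuous.aestronglyMeasurable]
      exact h1 a ha
    · rw [ProbabilityMeasure.coe_mk, integral_empirical N z
        (by fun_prop : Continuous fun z : I × Y => b z.2).stronglyMeasurable]
      exact h2 b hb
    · have h5 : ∑ p ∈ (Finset.range N).offDiag,
          ‖H (e (x p.1), e (x p.2)) - c j (e (x p.1), e (x p.2))‖ ≤ (1 / 2) ^ j * N ^ 2 := by
        have h := h3 j
        simp only [v, Prod.map_apply, ← ofReal_norm] at h
        rw [← ENNReal.ofReal_sum_of_nonneg fun _ _ => norm_nonneg _,
          show (2 : ℝ≥0∞) ^ j = ENNReal.ofReal (2 ^ j) by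
            rw [ENNReal.ofReal_pow (by norm_num), ENNReal.ofReal_ofNat],
          show (N : ℝ≥0∞) ^ 2 = ENNReal.ofReal (N ^ 2) by
            rw [ENNReal.ofReal_pow (by positivity), ENNReal.ofReal_natCast],
          ← ENNReal.ofReal_mul (by positivity), ENNReal.ofReal_le_ofReal_iff (by positivity)] at h
        rw [one_div, inv_pow, ← div_eq_inv_mul, le_div_iff₀ (by positivity), mul_comm]
        exact h
      have h6 : ∑ p ∈ (Finset.range N).offDiag,
          H (e (x p.1), e (x p.2)) (y p.1, y p.2) ≤ δ * N ^ 2 := by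
        simp only [H, hse]
        exact h4
      have h7 := integral_pairEval_empirical_le (c j).continuous hN (fun i => e (x i)) y
        (fun q => (c j).norm_coe_le_norm q) h6 h5
      refine h7.trans ?_
      have h8 : ‖c j‖ / N ≤ δ := by
        rw [hδ, div_le_div_iff₀ hN' (by positivity), one_mul]
        have h9 : ‖c j‖ ≤ ∑ j ∈ Finset.range (n + 1), ‖c j‖ :=
          Finset.single_le_sum (f := fun j => ‖c j‖) (fun _ _ => norm_nonneg _)
            (Finset.mem_range.2 (Nat.lt_succ_of_le hj))
        calc ‖c j‖ * (n + 1) ≤ (∑ j ∈ Finset.range (n + 1), ‖c j‖) * (n + 1) := by gcongr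
          _ ≤ _ := (Nat.le_ceil _).trans (by exact_mod_cast hN0)
      linarith
  choose Θ hΘ1 hΘ2 hΘ3 using hex
  classical
  let U : Ultrafilter (Finset C(I, ℝ) × Finset C(Y, ℝ) × ℕ) := Ultrafilter.of atTop
  have hU : (U : Filter (Finset C(I, ℝ) × Finset C(Y, ℝ) × ℕ)) ≤ atTop := Ultrafilter.of_le _
  obtain ⟨Θ₀, -, hΘ₀⟩ := (isCompact_univ (X := ProbabilityMeasure (I × Y))).ultrafilter_le_nhds
    (U.map Θ) (by simp)
  have hlim : Tendsto Θ U (𝓝 Θ₀) := hΘ₀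
  have hn : Tendsto (fun T : Finset C(I, ℝ) × Finset C(Y, ℝ) × ℕ => 1 / ((T.2.2 : ℝ) + 1)) U
      (𝓝 0) := by
    have h1 : Tendsto (fun T : Finset C(I, ℝ) × Finset C(Y, ℝ) × ℕ => T.2.2) U atTop := by
      refine Tendsto.mono_left ?_ hU
      rw [← prod_atTop_atTop_eq, ← prod_atTop_atTop_eq]
      exact tendsto_snd.comp tendsto_snd
    exact tendsto_one_div_add_atTop_nhds_zero_nat.comp h1
  have hint : ∀ φ : C(I × Y, ℝ), Tendsto (fun T => ∫ z, φ z ∂(Θ T : Measure (I × Y))) U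
      (𝓝 (∫ z, φ z ∂(Θ₀ : Measure (I × Y)))) := fun φ =>
    ProbabilityMeasure.tendsto_iff_forall_integral_tendsto.1 hlim
      (BoundedContinuousFunction.mkOfCompact φ)
  have hge : ∀ T₀, ∀ᶠ T in (U : Filter (Finset C(I, ℝ) × Finset C(Y, ℝ) × ℕ)), T₀ ≤ T := fun T₀ =>
    hU (eventually_ge_atTop T₀)
  have hfst : (Θ₀ : Measure (I × Y)).map Prod.fst = m := by
    have : IsProbabilityMeasure ((Θ₀ : Measure (I × Y)).map Prod.fst) :=
      Measure.isProbabilityMeasure_map measurable_fst.aemeasurable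
    refine measure_eq_of_forall_integral_continuousMap fun a => ?_
    rw [integral_map measurable_fst.aemeasurable a.continuous.aestronglyMeasurable]
    have h1 := hint ⟨fun z => a z.1, by fun_prop⟩
    refine tendsto_nhds_unique h1 ?_
    refine tendsto_iff_dist_tendsto_zero.2 (squeeze_zero' (Eventually.of_forall fun _ => dist_nonneg)
      ?_ hn)
    filter_upwards [hge ({a}, ∅, 0)] with T hT
    exact hΘ1 T a (hT.1 (Finset.mem_singleton_self a))
  refine ⟨Θ₀, hfst, ?_, ?_⟩
  · have : IsProbabilityMeasure ((Θ₀ : Measure (I × Y)).map Prod.snd) :=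
      Measure.isProbabilityMeasure_map measurable_snd.aemeasurable
    refine measure_eq_of_forall_integral_continuousMap fun b => ?_
    rw [integral_map measurable_snd.aemeasurable b.continuous.aestronglyMeasurable]
    have h1 := hint ⟨fun z => b z.2, by fun_prop⟩
    refine tendsto_nhds_unique h1 ?_
    refine tendsto_iff_dist_tendsto_zero.2 (squeeze_zero' (Eventually.of_forall fun _ => dist_nonneg)
      ?_ hn)
    filter_upwards [hge (∅, {b}, 0)] with T hT
    exact hΘ2 T b (hT.2.1 (Finset.mem_singleton_self b))
  have hprod : Tendsto (fun T => (Θ T).prod (Θ T)) U (𝓝 (Θ₀.prod Θ₀)) :=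
    (ProbabilityMeasure.continuous_prod.tendsto (Θ₀, Θ₀)).comp (hlim.prodMk_nhds hlim)
  have hpair : ∀ j, ∫ w, pairEval (c j) w ∂((Θ₀ : Measure (I × Y)).prod (Θ₀ : Measure (I × Y))) ≤
      (1 / 2) ^ j := by
    intro j
    have h1 := ProbabilityMeasure.tendsto_iff_forall_integral_tendsto.1 hprod
      (BoundedContinuousFunction.mkOfCompact ⟨pairEval (c j), continuous_pairEval (c j).continuous⟩)
    have h2 := (hn.add_const ((1 / 2) ^ j)).add hn
    rw [zero_add, add_zero] at h2
    refine le_of_tendsto_of_tendsto h1 h2 ?_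
    filter_upwards [hge (∅, ∅, j)] with T hT
    exact hΘ3 T j hT.2.2
  set Q : Measure ((I × Y) × (I × Y)) :=
    (Θ₀ : Measure (I × Y)).prod (Θ₀ : Measure (I × Y)) with hQ
  have hQm : Q.map (fun w => (w.1.1, w.2.1)) = m.prod m := by
    rw [← hfst, Measure.map_prod_map _ _ measurable_fst measurable_fst]
    rfl
  have hqm : Measurable fun w : (I × Y) × (I × Y) => (w.1.1, w.2.1) := by fun_prop
  -- This error does not involve the labels, so it depends only on the marginal of the points, which
  -- is known.
  have herr : ∀ j, ∫ w, ‖H (w.1.1, w.2.1) - c j (w.1.1, w.2.1)‖ ∂Q ≤ (1 / 4) ^ j := by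
    intro j
    rw [← integral_map (μ := Q) (φ := fun w => (w.1.1, w.2.1)) (f := fun q => ‖H q - c j q‖)
      hqm.aemeasurable (hdm j).norm.aestronglyMeasurable, hQm,
      integral_norm_eq_lintegral_enorm (hdm j).aestronglyMeasurable]
    refine ENNReal.toReal_le_of_le_ofReal (by positivity) ((hc1 j).trans ?_)
    rw [ENNReal.ofReal_pow (by norm_num), one_div, ENNReal.ofReal_inv_of_pos (by norm_num),
      ENNReal.ofReal_ofNat]
    exact mul_le_of_le_one_right' (by simp)
  have hHint : Integrable (pairEval H) Q :=
    Integrable.of_bound (stronglyMeasurable_pairEval hHm).aestronglyMeasurable ‖excessMap Y‖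
      (Eventually.of_forall fun w => ((H _).norm_coe_le_norm _).trans (hHb _))
  have hbound : ∀ j, ∫ w, pairEval H w ∂Q ≤ (1 / 2) ^ j + (1 / 4) ^ j := by
    intro j
    have i1 : Integrable (pairEval (c j)) Q :=
      (continuous_pairEval (c j).continuous).integrable_of_hasCompactSupport
        (HasCompactSupport.of_compactSpace _)
    have i2 : Integrable (fun w : (I × Y) × (I × Y) =>
        ‖H (w.1.1, w.2.1) - c j (w.1.1, w.2.1)‖) Q :=
      Integrable.of_bound ((hdm j).norm.comp_measurable hqm).aestronglyMeasurable
        (‖excessMap Y‖ + ‖c j‖) (Eventually.of_forall fun w => by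
          rw [norm_norm]
          exact (norm_sub_le _ _).trans (add_le_add (hHb _) ((c j).norm_coe_le_norm _)))
    calc ∫ w, pairEval H w ∂Q
        ≤ ∫ w, (pairEval (c j) w + ‖H (w.1.1, w.2.1) - c j (w.1.1, w.2.1)‖) ∂Q := by
          refine integral_mono hHint (i1.add i2) fun w => ?_
          have := (le_abs_self _).trans
            ((H (w.1.1, w.2.1) - c j (w.1.1, w.2.1)).norm_coe_le_norm (w.1.2, w.2.2))
          rw [ContinuousMap.sub_apply] at this
          simp only [pairEval]
          linarith
      _ = _ := integral_add i1 i2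
      _ ≤ _ := add_le_add (hpair j) (herr j)
  have hnn : 0 ≤ pairEval H := fun w => X.excess_nonneg _ _
  have hzero : ∫ w, pairEval H w ∂Q = 0 := by
    refine le_antisymm ?_ (integral_nonneg hnn)
    have := (tendsto_pow_atTop_nhds_zero_of_lt_one (r := (1 / 2 : ℝ)) (by norm_num)
      (by norm_num)).add (tendsto_pow_atTop_nhds_zero_of_lt_one (r := (1 / 4 : ℝ)) (by norm_num)
      (by norm_num))
    rw [add_zero] at this
    exact ge_of_tendsto' this hbound
  exact (integral_eq_zero_iff_of_nonneg hnn hHint).1 hzero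

end

/-! ### Selections from couplings -/

theorem prod_compProd_self {A B : Type*} [MeasurableSpace A] [MeasurableSpace B] (m : Measure A)
    [IsProbabilityMeasure m] (θ : Kernel A B) [IsMarkovKernel θ] :
    (m ⊗ₘ θ).prod (m ⊗ₘ θ) = ((m.prod m) ⊗ₘ (θ ∥ₖ θ)).map
      (fun z => ((z.1.1, z.2.1), (z.1.2, z.2.2))) := by
  refine Measure.prod_eq fun S T hS hT => ?_
  have hr : Measurable fun z : (A × A) × (B × B) => ((z.1.1, z.2.1), (z.1.2, z.2.2)) := by fun_prop
  rw [Measure.map_apply hr (hS.prod hT), Measure.compProd_apply (hr (hS.prod hT)),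
    Measure.compProd_apply hS, Measure.compProd_apply hT,
    ← lintegral_prod_mul (Kernel.measurable_kernel_prodMk_left hS).aemeasurable
      (Kernel.measurable_kernel_prodMk_left hT).aemeasurable]
  refine lintegral_congr fun p => ?_
  rw [Kernel.parallelComp_apply, ← Measure.prod_prod]
  rfl

/-- The index of the cell of a point in the partition of the unit interval into `n` cells. -/
def cell (n : ℕ) (t : I) : ℕ := ⌊(n : ℝ) * t⌋₊

theorem measurable_cell (n : ℕ) : Measurable (cell n) :=
  Nat.measurable_floor.comp (measurable_subtype_coe.const_mul _)

theorem eventually_cell_ne {t t' : I} (h : t ≠ t') : ∀ᶠ n in atTop, cell n t ≠ cell n t' := by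
  wlog hlt : (t : ℝ) < t' generalizing t t'
  · have hne : (t : ℝ) ≠ t' := fun h' => h (Subtype.ext h')
    exact (this h.symm (lt_of_le_of_ne (not_lt.1 hlt) hne.symm)).mono fun n hn => hn.symm
  have hpos : 0 < (t' : ℝ) - t := by linarith
  have h1 : Tendsto (fun n : ℕ => (n : ℝ) * ((t' : ℝ) - t)) atTop atTop :=
    tendsto_natCast_atTop_atTop.atTop_mul_const hpos
  filter_upwards [h1.eventually_ge_atTop 1] with n hn heq
  have h2 : ((cell n t' : ℕ) : ℝ) ≤ n * t' := Nat.floor_le (mul_nonneg n.cast_nonneg t'.2.1)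
  have h3 : (n : ℝ) * t' < cell n t' + 1 := Nat.lt_floor_add_one _
  have h4 : ((cell n t : ℕ) : ℝ) ≤ n * t := Nat.floor_le (mul_nonneg n.cast_nonneg t.2.1)
  rw [heq] at h4
  nlinarith

theorem measurable_eval_cell (n : ℕ) : Measurable fun p : I × (ℕ → I) => p.2 (cell n p.1) := by
  have h : Measurable fun q : (ℕ → I) × ℕ => q.1 q.2 :=
    measurable_from_prod_countable_left fun k => measurable_pi_apply k
  exact h.comp (measurable_snd.prodMk ((measurable_cell n).comp measurable_fst))

/-- Otherwise a product of neighbourhoods, of positive mass, would violate the bound. It frees the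
selection of labels from any joint law: arbitrary points of the supports will do. -/
theorem dist_le_of_mem_support {Y : Type*} [MetricSpace Y] [MeasurableSpace Y] {ν ν' : Measure Y} [SFinite ν]
    [SFinite ν'] {r : ℝ}
    (h : ∀ᵐ q ∂(ν.prod ν'), dist q.1 q.2 ≤ r) {y y' : Y} (hy : y ∈ ν.support)
    (hy' : y' ∈ ν'.support) : dist y y' ≤ r := by
  by_contra hlt
  have hopen : IsOpen {q : Y × Y | r < dist q.1 q.2} := isOpen_lt continuous_const continuous_dist
  have hmem : {q : Y × Y | r < dist q.1 q.2} ∈ 𝓝 (y, y') := hopen.mem_nhds (not_le.1 hlt)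
  rw [nhds_prod_eq, mem_prod_iff] at hmem
  obtain ⟨U, hU, V, hV, hUV⟩ := hmem
  have h1 := (Measure.mem_support_iff_forall y).1 hy U hU
  have h2 := (Measure.mem_support_iff_forall y').1 hy' V hV
  have h3 : (ν.prod ν') (U ×ˢ V) = 0 :=
    measure_mono_null (fun q hq => not_le.2 (hUV hq)) (ae_iff.1 h)
  rw [Measure.prod_prod] at h3
  exact (mul_ne_zero h1.ne' h2.ne') h3

section Selection

variable {Y : Type*} [MetricSpace Y] [CompactSpace Y] [MeasurableSpace Y] [BorelSpace Y]

/-- With a countable basis, membership in the support is a countable conjunction of measurable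
conditions. -/
theorem measurableSet_mem_support (θ : Kernel I Y) :
    MeasurableSet {p : I × Y | p.2 ∈ (θ p.1).support} := by
  obtain ⟨B, hBc, -, hB⟩ := TopologicalSpace.exists_countable_basis Y
  have h : {p : I × Y | p.2 ∈ (θ p.1).support} =
      ⋂ U ∈ B, {p : I × Y | p.2 ∈ U → θ p.1 U ≠ 0} := by
    ext p
    simp only [Set.mem_ofPred_eq, Set.mem_iInter]
    rw [Measure.mem_support_iff_forall]
    constructor
    · intro hp U hU hpU
      exact (hp U ((hB.isOpen hU).mem_nhds hpU)).ne'
    · intro hp U hU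
      obtain ⟨V, hV, hpV, hVU⟩ := hB.mem_nhds_iff.1 hU
      exact (pos_iff_ne_zero.2 (hp V hV hpV)).trans_le (measure_mono hVU)
  rw [h]
  refine MeasurableSet.biInter hBc fun U hU => ?_
  have h1 : MeasurableSet {p : I × Y | p.2 ∈ U} := measurable_snd (hB.isOpen hU).measurableSet
  have h2 : MeasurableSet {p : I × Y | θ p.1 U ≠ 0} :=
    (((θ.measurable_coe (hB.isOpen hU).measurableSet).comp measurable_fst)
      (measurableSet_singleton 0)).compl
  exact h1.imp h2

/-- A random family of probability measures on `Y` has measurable selections from the supports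
whose laws are close to the mean measure, provided the measures at atoms are Dirac measures. -/
theorem exists_selection (m : Measure I) [IsProbabilityMeasure m] (θ : Kernel I Y)
    [IsMarkovKernel θ] {r : I × I → ℝ} (hr0 : ∀ t, r (t, t) = 0)
    (hr : ∀ᵐ p ∂(m.prod m), ∀ᵐ q ∂((θ p.1).prod (θ p.2)), dist q.1 q.2 ≤ r p)
    (Φ : Finset C(Y, ℝ)) {ε : ℝ} (hε : 0 < ε) :
    ∃ g : I → Y, Measurable g ∧ (∀ᵐ p ∂(m.prod m), dist (g p.1) (g p.2) ≤ r p) ∧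
      ∀ b ∈ Φ, |∫ t, b (g t) ∂m - ∫ t, ∫ y, b y ∂(θ t) ∂m| < ε := by
  obtain ⟨t₀⟩ : Nonempty I := inferInstance
  have : Nonempty Y := (θ t₀).nonempty_of_neZero
  obtain ⟨F, hF, hFθ⟩ := θ.exists_measurable_map_eq_unitInterval
  let W : Measure (ℕ → I) := Measure.infinitePi fun _ => volume
  -- A random selection with the right law at each point: points of one cell share a uniform
  -- variable, different cells use independent ones.
  let G : ℕ → (ℕ → I) → I → Y := fun n ω t => F t (ω (cell n t))
  have hG : ∀ n, Measurable fun p : I × (ℕ → I) => G n p.2 p.1 := fun n =>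
    hF.comp (measurable_fst.prodMk (measurable_eval_cell n))
  have hFt : ∀ t, Measurable (F t) := fun t => hF.comp (measurable_const.prodMk measurable_id)
  have hev : ∀ k, MeasurePreserving (fun ω : ℕ → I => ω k) W volume := fun k =>
    measurePreserving_eval_infinitePi _ k
  have hGlaw : ∀ n t, W.map (fun ω => G n ω t) = θ t := fun n t => by
    rw [← hFθ t, ← (hev (cell n t)).map_eq, Measure.map_map (hFt t) (hev _).measurable]
    rfl
  -- the selections take values in the supports
  have hsupp : ∀ n, ∀ᵐ ω ∂W, ∀ᵐ t ∂m, G n ω t ∈ (θ t).support := by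
    intro n
    have hms : MeasurableSet {p : I × (ℕ → I) | G n p.2 p.1 ∈ (θ p.1).support} :=
      (measurable_fst.prodMk (hG n)) (measurableSet_mem_support θ)
    rw [← Measure.ae_ae_comm (p := fun t ω => G n ω t ∈ (θ t).support) hms]
    refine Eventually.of_forall fun t => ?_
    have h1 : ∀ᵐ y ∂(W.map fun ω => G n ω t), y ∈ (θ t).support := by
      rw [hGlaw]
      exact Measure.support_mem_ae
    exact ae_of_ae_map ((hG n).comp (measurable_const.prodMk measurable_id)).aemeasurable h1
  have hlip : ∀ n, ∀ᵐ ω ∂W, ∀ᵐ p ∂(m.prod m), dist (G n ω p.1) (G n ω p.2) ≤ r p := by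
    intro n
    filter_upwards [hsupp n] with ω hω
    filter_upwards [hr, Measure.quasiMeasurePreserving_fst.ae hω,
      Measure.quasiMeasurePreserving_snd.ae hω] with p h1 h2 h3
    exact dist_le_of_mem_support h1 h2 h3
  -- the fluctuations of the averages
  let f : C(Y, ℝ) → ℕ → I → (ℕ → I) → ℝ := fun b n t ω => b (G n ω t) - ∫ y, b y ∂(θ t)
  have hmean : ∀ b : C(Y, ℝ), StronglyMeasurable fun t => ∫ y, b y ∂(θ t) := fun b =>
    StronglyMeasurable.integral_kernel (κ := θ) b.continuous.stronglyMeasurable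
  have hfm : ∀ b n, Measurable fun p : I × (ℕ → I) => f b n p.1 p.2 := fun b n =>
    (b.continuous.measurable.comp (hG n)).sub ((hmean b).measurable.comp measurable_fst)
  have hmeanb : ∀ (b : C(Y, ℝ)) t, |∫ y, b y ∂(θ t)| ≤ ‖b‖ := fun b t => by
    have := norm_integral_le_of_norm_le_const (μ := θ t) (f := fun y => b y)
      (C := ‖b‖) (Eventually.of_forall fun y => b.norm_coe_le_norm y)
    rwa [probReal_univ, mul_one] at this
  have hfb : ∀ b n t ω, |f b n t ω| ≤ 2 * ‖b‖ := fun b n t ω => by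
    have h1 := abs_sub (b (G n ω t)) (∫ y, b y ∂(θ t))
    have h2 : |b (G n ω t)| ≤ ‖b‖ := b.norm_coe_le_norm _
    have h3 := hmeanb b t
    simp only [f]
    linarith
  have hfbb : ∀ b n t t' ω, |f b n t ω * f b n t' ω| ≤ (2 * ‖b‖) ^ 2 := fun b n t t' ω => by
    rw [abs_mul, sq]
    exact mul_le_mul (hfb _ _ _ _) (hfb _ _ _ _) (abs_nonneg _) (by positivity)
  have hf0 : ∀ b n t, ∫ ω, f b n t ω ∂W = 0 := by
    intro b n t
    have hGt : Measurable fun ω => G n ω t := (hG n).comp (measurable_const.prodMk measurable_id)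
    have h1 : ∫ ω, b (G n ω t) ∂W = ∫ y, b y ∂(θ t) := by
      rw [← hGlaw n t, integral_map hGt.aemeasurable b.continuous.aestronglyMeasurable]
    have h2 : Integrable (fun ω => b (G n ω t)) W :=
      Integrable.of_bound (b.continuous.measurable.comp hGt).aestronglyMeasurable ‖b‖
        (Eventually.of_forall fun ω => b.norm_coe_le_norm _)
    simp only [f]
    rw [integral_sub h2 (integrable_const _), h1]
    simp
  let k : C(Y, ℝ) → ℕ → I × I → ℝ := fun b n p => ∫ ω, f b n p.1 ω * f b n p.2 ω ∂W
  have hkm : ∀ b n, Measurable fun z : (I × I) × (ℕ → I) => f b n z.1.1 z.2 * f b n z.1.2 z.2 :=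
    fun b n => ((hfm b n).comp (by fun_prop : Measurable fun z : (I × I) × (ℕ → I) =>
      (z.1.1, z.2))).mul ((hfm b n).comp (by fun_prop : Measurable fun z : (I × I) × (ℕ → I) =>
      (z.1.2, z.2)))
  -- Distinct points end up in different cells, where the fluctuations are independent and centred.
  -- On the diagonal, which has positive mass if there are atoms, `r = 0` forces the conditional law
  -- to be Dirac and the fluctuation to vanish.
  have hk0 : ∀ b, ∀ᵐ p ∂(m.prod m), Tendsto (fun n => k b n p) atTop (𝓝 0) := by
    intro b
    filter_upwards [hr] with p hp
    by_cases hpp : p.1 = p.2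
    · obtain ⟨t, t'⟩ := p
      simp only at hpp
      subst hpp
      have hz : ∀ n, k b n (t, t) = 0 := by
        intro n
        have hGt : Measurable fun ω => G n ω t :=
          (hG n).comp (measurable_const.prodMk measurable_id)
        have h1 : ∀ᵐ y ∂(W.map fun ω => G n ω t), y ∈ (θ t).support := by
          rw [hGlaw]
          exact Measure.support_mem_ae
        have h2 := ae_of_ae_map hGt.aemeasurable h1
        have h3 : ∀ᵐ ω ∂W, f b n t ω * f b n t ω = 0 := by
          filter_upwards [h2] with ω hω
          have h4 : ∀ᵐ y ∂(θ t), b y = b (G n ω t) := by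
            filter_upwards [Measure.support_mem_ae (μ := θ t)] with y hy
            have := dist_le_of_mem_support hp hy hω
            rw [hr0] at this
            rw [dist_le_zero.1 this]
          have h5 : ∫ y, b y ∂(θ t) = b (G n ω t) := by
            rw [integral_congr_ae h4]
            simp
          simp only [f, h5, sub_self, mul_zero]
        simp only [k]
        rw [integral_congr_ae h3, integral_zero]
      simp only [hz]
      exact tendsto_const_nhds
    · refine tendsto_const_nhds.congr' ?_
      filter_upwards [eventually_cell_ne hpp] with n hn
      have hpair : W.map (fun ω => (ω (cell n p.1), ω (cell n p.2))) =
          (volume : Measure I).prod volume :=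
        Measure.infinitePi_map_eval_prod (P := fun _ : ℕ => (volume : Measure I)) hn
      let φ : I → I → ℝ := fun t u => b (F t u) - ∫ y, b y ∂(θ t)
      have hφm : ∀ t, Measurable (φ t) := fun t =>
        (b.continuous.measurable.comp (hFt t)).sub_const _
      have hφ0 : ∫ u, φ p.1 u = 0 := by
        have h1 := hf0 b n p.1
        rw [← (hev (cell n p.1)).map_eq, integral_map (hev _).measurable.aemeasurable
          (hφm _).aestronglyMeasurable]
        exact h1
      have h6 : k b n p = ∫ z : I × I, φ p.1 z.1 * φ p.2 z.2 ∂((volume : Measure I).prod volume) := by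
        have hm2 : Measurable fun z : I × I => φ p.1 z.1 * φ p.2 z.2 :=
          ((hφm p.1).comp measurable_fst).mul ((hφm p.2).comp measurable_snd)
        rw [← hpair, integral_map (by fun_prop) hm2.aestronglyMeasurable]
      rw [h6, integral_prod_mul, hφ0, zero_mul]
  -- The error of the law of a selection; its second moment is the double integral of the
  -- covariances `k`, which tends to zero by dominated convergence.
  let S : C(Y, ℝ) → ℕ → (ℕ → I) → ℝ := fun b n ω => ∫ t, f b n t ω ∂m
  have hSk : ∀ b n, ∫ ω, S b n ω ^ 2 ∂W = ∫ p, k b n p ∂(m.prod m) := by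
    intro b n
    have h1 : ∀ ω, S b n ω ^ 2 = ∫ p, f b n p.1 ω * f b n p.2 ω ∂(m.prod m) := fun ω => by
      rw [integral_prod_mul (fun t => f b n t ω) (fun t => f b n t ω), sq]
    simp only [h1]
    refine integral_integral_swap (f := fun ω (p : I × I) => f b n p.1 ω * f b n p.2 ω) ?_
    refine Integrable.of_bound ((hkm b n).comp measurable_swap).aestronglyMeasurable
      ((2 * ‖b‖) ^ 2) (Eventually.of_forall fun z => hfbb _ _ _ _ _)
  have hSlim : ∀ b, Tendsto (fun n => ∫ ω, S b n ω ^ 2 ∂W) atTop (𝓝 0) := by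
    intro b
    simp only [hSk]
    have := tendsto_integral_of_dominated_convergence (μ := m.prod m) (F := fun n => k b n)
      (f := fun _ => 0) (fun _ => (2 * ‖b‖) ^ 2)
      (fun n => ((hkm b n).stronglyMeasurable.integral_prod_right').aestronglyMeasurable)
      (integrable_const _) (fun n => Eventually.of_forall fun p => by
        have := norm_integral_le_of_norm_le_const (μ := W)
          (f := fun ω => f b n p.1 ω * f b n p.2 ω) (C := (2 * ‖b‖) ^ 2)
          (Eventually.of_forall fun ω => hfbb _ _ _ _ _)
        rwa [probReal_univ, mul_one] at this) (hk0 b)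
    simpa using this
  have hsum : Tendsto (fun n => ∑ b ∈ Φ, ∫ ω, S b n ω ^ 2 ∂W) atTop (𝓝 0) := by
    have := tendsto_finsetSum Φ fun b _ => hSlim b
    simpa using this
  obtain ⟨n, hn⟩ := (hsum.eventually_lt_const (by positivity : (0 : ℝ) < ε ^ 2)).exists
  have hSm : ∀ b, Measurable (S b n) := fun b =>
    ((hfm b n).stronglyMeasurable.integral_prod_left').measurable
  have hSb : ∀ b ω, |S b n ω| ≤ 2 * ‖b‖ := fun b ω => by
    have := norm_integral_le_of_norm_le_const (μ := m) (f := fun t => f b n t ω)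
      (C := 2 * ‖b‖) (Eventually.of_forall fun t => hfb _ _ _ _)
    rwa [probReal_univ, mul_one] at this
  have hSi : ∀ b, Integrable (fun ω => S b n ω ^ 2) W := fun b =>
    Integrable.of_bound ((hSm b).pow_const 2).aestronglyMeasurable ((2 * ‖b‖) ^ 2)
      (Eventually.of_forall fun ω => by
        rw [Real.norm_eq_abs, abs_pow]
        exact pow_le_pow_left₀ (abs_nonneg _) (hSb b ω) 2)
  rw [← integral_finsetSum _ fun b _ => hSi b] at hn
  obtain ⟨ω, hω1, hω2⟩ : ∃ ω, (∀ᵐ p ∂(m.prod m), dist (G n ω p.1) (G n ω p.2) ≤ r p) ∧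
      ∑ b ∈ Φ, S b n ω ^ 2 < ε ^ 2 := by
    by_contra hcon
    push Not at hcon
    have h1 : ∀ᵐ ω ∂W, ε ^ 2 ≤ ∑ b ∈ Φ, S b n ω ^ 2 := by
      filter_upwards [hlip n] with ω hω using hcon ω hω
    have h2 := integral_mono_ae (integrable_const (ε ^ 2))
      (integrable_finsetSum Φ fun b _ => hSi b) h1
    simp only [integral_const, probReal_univ, one_smul] at h2
    linarith
  have hGω : Measurable (G n ω) := (hG n).comp (measurable_id.prodMk measurable_const)
  refine ⟨G n ω, hGω, hω1, fun b hb => ?_⟩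
  have h1 : S b n ω ^ 2 < ε ^ 2 :=
    (Finset.single_le_sum (f := fun b => S b n ω ^ 2) (fun _ _ => sq_nonneg _) hb).trans_lt hω2
  have h2 : S b n ω = ∫ t, b (G n ω t) ∂m - ∫ t, ∫ y, b y ∂(θ t) ∂m := by
    simp only [S, f]
    exact integral_sub
      (Integrable.of_bound (b.continuous.measurable.comp hGω).aestronglyMeasurable ‖b‖
        (Eventually.of_forall fun t => b.norm_coe_le_norm _))
      (Integrable.of_bound (hmean b).aestronglyMeasurable ‖b‖
        (Eventually.of_forall fun t => hmeanb b t))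
  rw [← h2]
  exact abs_lt_of_sq_lt_sq h1 hε.le

end Selection

/-! ### Limits of observables -/

section Limits

variable {Y : Type*} [MetricSpace Y] [CompactSpace Y]

theorem QMMSpace.dist_le_lowerEnd_of_excess_eq_zero (X : QMMSpace) {p : X.carrier × X.carrier}
    {y y' : Y} (h : X.excess p (y, y') = 0) : dist y y' ≤ lowerEnd (X.dStar p) := by
  rw [X.excess_apply] at h
  refine le_lowerEnd (IsProbabilityMeasure.ne_zero _) ?_
  have hc : Continuous fun l : I => max (dist y y' - (l : ℝ)) 0 := by fun_prop
  have := (integral_eq_zero_iff_of_nonneg (fun l : I => le_max_right _ _)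
    (hc.integrable_of_hasCompactSupport (HasCompactSupport.of_compactSpace _))).1 h
  filter_upwards [this] with l hl
  have h1 := le_max_left (dist y y' - (l : ℝ)) 0
  have h2 : max (dist y y' - (l : ℝ)) 0 = 0 := hl
  linarith

variable [MeasurableSpace Y] [BorelSpace Y]

/-- Limits of laws of `1`-Lipschitz observables along convergent sampling laws are limits of laws of
`1`-Lipschitz observables on the limit space. -/
theorem QMMSpace.mem_closure_of_tendsto (X : QMMSpace) {ι : Type*} {L : Filter ι} [L.NeBot]
    {Z : ι → QMMSpace} {f : ∀ i, (Z i).carrier → Y} (hf : ∀ i, f i ∈ (Z i).Lip1 Y)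
    (hZ : Tendsto (fun i => (Z i).sampling) L (𝓝 X.sampling)) {ν : ProbabilityMeasure Y}
    (hν : ∀ b : C(Y, ℝ),
      Tendsto (fun i => ∫ t, b t ∂((Z i).μ.map (f i))) L (𝓝 (∫ t, b t ∂(ν : Measure Y)))) :
    ν ∈ closure {ν' : ProbabilityMeasure Y | ∃ g ∈ X.Lip1 Y, (ν' : Measure Y) = X.μ.map g} := by
  have : Nonempty Y := (ν : Measure Y).nonempty_of_neZero
  -- The standard Borel space is placed into the unit interval, which supplies compactness for
  -- limits of couplings and cells for the selection.
  have hemb := measurableEmbedding_sigmoid_comp_embeddingReal X.carrier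
  set e : X.carrier → I := unitInterval.sigmoid ∘ embeddingReal X.carrier
  have he : Measurable e := hemb.measurable
  have hs : Measurable hemb.invFun := hemb.measurable_invFun
  have hse : ∀ x, hemb.invFun (e x) = x := hemb.leftInverse_invFun
  obtain ⟨Θ, hΘ1, hΘ2, hΘ3⟩ := X.exists_coupling (ν := (ν : Measure Y)) he hs hse
    fun Φ δ hδ N hN => sampling_labelable_compl_le_of_tendsto hf hZ hν Φ hN hδ
  set s := hemb.invFun
  set m : Measure I := X.μ.map e with hm
  have : IsProbabilityMeasure m := Measure.isProbabilityMeasure_map he.aemeasurable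
  let θ : Kernel I Y := (Θ : Measure (I × Y)).condKernel
  have hdis : m ⊗ₘ θ = (Θ : Measure (I × Y)) := by
    rw [← hΘ1]
    exact (Θ : Measure (I × Y)).disintegrate _
  let r : I × I → ℝ := fun p => lowerEnd (X.dStar (s p.1, s p.2))
  have hr0 : ∀ t, r (t, t) = 0 := fun t => by
    simp only [r, X.dStar_self, lowerEnd_dirac]
    rfl
  -- The almost sure constraint on two independent copies of the coupling, disintegrated over the
  -- pair of points.
  have hr : ∀ᵐ p ∂(m.prod m), ∀ᵐ q ∂((θ p.1).prod (θ p.2)), dist q.1 q.2 ≤ r p := by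
    rw [← hdis, prod_compProd_self] at hΘ3
    have h1 := ae_of_ae_map (by fun_prop) hΘ3
    have h2 := Measure.ae_ae_of_ae_compProd h1
    filter_upwards [h2] with p hp
    rw [Kernel.parallelComp_apply] at hp
    filter_upwards [hp] with q hq
    exact X.dist_le_lowerEnd_of_excess_eq_zero hq
  classical
  refine mem_closure_of_forall_finset fun Φ ε hε => ?_
  obtain ⟨g, hg, hgr, hgΦ⟩ := exists_selection m θ hr0 hr
    (Φ.image fun b => b.toContinuousMap) hε
  have hge : Measurable fun x => g (e x) := hg.comp he
  have hpush : X.μ.map (fun x => g (e x)) = m.map g := by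
    rw [hm, Measure.map_map hg he]
    rfl
  have hae : ∀ᵐ p ∂(X.μ.prod X.μ), dist (g (e p.1)) (g (e p.2)) ≤ lowerEnd (X.dStar p) := by
    have hmp : MeasurePreserving (Prod.map e e) (X.μ.prod X.μ) (m.prod m) :=
      ⟨he.prodMap he, by rw [hm, Measure.map_prod_map _ _ he he]⟩
    filter_upwards [hmp.quasiMeasurePreserving.ae hgr] with p hp
    simp only [r, Prod.map_fst, Prod.map_snd, hse] at hp
    exact hp
  refine ⟨⟨X.μ.map fun x => g (e x), Measure.isProbabilityMeasure_map hge.aemeasurable⟩,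
    ⟨fun x => g (e x), ⟨hge, hae⟩, rfl⟩, fun b hb => ?_⟩
  have h1 := hgΦ b.toContinuousMap (Finset.mem_image_of_mem _ hb)
  have h2 : ∫ y, b y ∂(X.μ.map fun x => g (e x)) = ∫ t, b (g t) ∂m := by
    rw [hpush, integral_map hg.aemeasurable b.continuous.aestronglyMeasurable]
  have h3 : ∫ t, ∫ y, b y ∂(θ t) ∂m = ∫ y, b y ∂(ν : Measure Y) := by
    have hi : Integrable (fun z : I × Y => b z.2) (m ⊗ₘ θ) :=
      (by fun_prop : Continuous fun z : I × Y => b z.2).integrable_of_hasCompactSupport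
        (HasCompactSupport.of_compactSpace _)
    rw [← Measure.integral_compProd hi, hdis, ← hΘ2,
      integral_map measurable_snd.aemeasurable b.continuous.aestronglyMeasurable]
  rw [ProbabilityMeasure.coe_mk, h2, ← h3]
  exact h1.le

/-- Observational diameters along convergent sampling laws. -/
theorem QMMSpace.obsDiam_le_of_frequently (X : QMMSpace) {Z : ℕ → QMMSpace}
    (hZ : Tendsto (fun n => (Z n).sampling) atTop (𝓝 X.sampling)) {κ κ' : ℝ} (hκ : κ' < κ)
    (hκ1 : κ < 1) {c : ℝ≥0∞} (hc : ∃ᶠ n in atTop, c < (Z n).obsDiam Y κ) :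
    c ≤ X.obsDiam Y κ' := by
  -- Near-optimal observables exist only along these indices; the ultrafilter on them picks a limit
  -- law.
  let A : Type := {n : ℕ // c < (Z n).obsDiam Y κ}
  have hex : ∀ a : A, ∃ f ∈ (Z a.1).Lip1 Y, c < partialDiam ((Z a.1).μ.map f) κ := fun a => by
    have := a.2
    unfold QMMSpace.obsDiam at this
    simp only [lt_iSup_iff] at this
    obtain ⟨f, hf, h⟩ := this
    exact ⟨f, hf, h⟩
  choose f hf hfc using hex
  let L : Filter A := comap (fun a : A => a.1) atTop
  have : L.NeBot := by
    rw [comap_neBot_iff_frequently]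
    exact hc.mono fun n hn => ⟨⟨n, hn⟩, rfl⟩
  let U : Ultrafilter A := Ultrafilter.of L
  have hU : (U : Filter A) ≤ L := Ultrafilter.of_le L
  let w : A → ProbabilityMeasure Y := fun a =>
    ⟨(Z a.1).μ.map (f a), Measure.isProbabilityMeasure_map (hf a).1.aemeasurable⟩
  obtain ⟨ν, -, hν⟩ := (isCompact_univ (X := ProbabilityMeasure Y)).ultrafilter_le_nhds
    (U.map w) (by simp)
  have hlim : Tendsto w U (𝓝 ν) := hν
  have hmem := X.mem_closure_of_tendsto (L := (U : Filter A)) (Z := fun a => Z a.1) (f := f)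
    hf (hZ.comp (tendsto_comap.mono_left hU)) (ν := ν) fun b =>
      ProbabilityMeasure.tendsto_iff_forall_integral_tendsto.1 hlim
        (BoundedContinuousFunction.mkOfCompact b)
  have h1 : partialDiam (ν : Measure Y) κ' ≤ X.obsDiam Y κ' :=
    partialDiam_le_of_mem_closure hmem (by
      rintro ν' ⟨g, hg, hν'⟩
      rw [hν']
      exact le_iSup₂ (f := fun (g : X.carrier → Y) (_ : g ∈ X.Lip1 Y) =>
        partialDiam (X.μ.map g) κ') g hg)
  refine le_trans (le_of_not_gt fun hlt => ?_) h1
  obtain ⟨a, ha⟩ := (eventually_partialDiam_lt hlim hκ hκ1 hlt).exists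
  exact lt_asymm ha (hfc a)

/-- The closure theorem for a constant net: laws of observables on `X` are limits of those on `X'`.
Upper bounds pass to limits at the same `κ`, so nothing is lost, and the extension is independent of
the representing qmm-space. -/
theorem QMMSpace.obsDiam_le_of_sampling_eq {X X' : QMMSpace} (h : X.sampling = X'.sampling)
    (κ : ℝ) : X.obsDiam Y κ ≤ X'.obsDiam Y κ := by
  refine iSup₂_le fun f hf => ?_
  let w : ProbabilityMeasure Y :=
    ⟨X.μ.map f, Measure.isProbabilityMeasure_map hf.1.aemeasurable⟩
  have hmem := X'.mem_closure_of_tendsto (L := (⊤ : Filter Unit)) (Z := fun _ => X)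
    (f := fun _ => f) (fun _ => hf) (by rw [h]; exact tendsto_const_nhds) (ν := w)
    fun b => tendsto_const_nhds
  exact partialDiam_le_of_mem_closure hmem (by
    rintro ν' ⟨g, hg, hν'⟩
    rw [hν']
    exact le_iSup₂ (f := fun (g : X'.carrier → Y) (_ : g ∈ X'.Lip1 Y) =>
      partialDiam (X'.μ.map g) κ) g hg)

theorem QMMSpace.obsDiam_eq_of_sampling_eq {X X' : QMMSpace} (h : X.sampling = X'.sampling)
    (κ : ℝ) : X.obsDiam Y κ = X'.obsDiam Y κ :=
  le_antisymm (obsDiam_le_of_sampling_eq h κ) (obsDiam_le_of_sampling_eq h.symm κ)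

end Limits

end

/-! ### The theorem -/

theorem mainTheorem3 (Y : Type*) [MetricSpace Y] [CompactSpace Y] [MeasurableSpace Y]
    [BorelSpace Y] :
    ∃ ObsDiam : ChiBar → ℝ → ℝ≥0∞,
      -- it extends the observational diameter of mm-spaces
      (∀ (X : MMSpace) (ζ : ChiBar), X.sampling = ζ →
        ∀ κ : ℝ, 0 < κ → κ < 1 → ObsDiam ζ κ = X.obsDiam Y κ) ∧
      -- qmm-spaces represent exactly the elements of the compactification, and the value at an
      -- element is given by the `1`-Lipschitz maps on any qmm-space representing it
      (∀ ζ : ChiBar, ∃ X : QMMSpace, X.sampling = ζ) ∧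
      (∀ X : QMMSpace, X.sampling ∈ ChiBar) ∧
      (∀ (X : QMMSpace) (ζ : ChiBar), X.sampling = ζ →
        ∀ κ : ℝ, 0 < κ → κ < 1 → ObsDiam ζ κ = X.obsDiam Y κ) ∧
      -- essential upper semicontinuity
      (∀ (ζ : ℕ → ChiBar) (ζ' : ChiBar), Tendsto ζ atTop (𝓝 ζ') →
        ∀ κ κ' : ℝ, 0 < κ' → κ' < κ → κ < 1 →
          limsup (fun n => ObsDiam (ζ n) κ) atTop ≤ ObsDiam ζ' κ') := by
  have hrep : ∀ ζ : ChiBar, ∃ X : QMMSpace, X.sampling = ζ := fun ζ =>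
    exists_qmmSpace_of_isSamplingLaw (isSamplingLaw_of_mem_chiBar ζ.2)
  -- The extension is computed on an arbitrarily chosen representative; it depends only on the
  -- sampling law.
  choose R hR using hrep
  refine ⟨fun ζ κ => (R ζ).obsDiam Y κ, fun X ζ hX κ _ _ => ?_, fun ζ => ⟨R ζ, hR ζ⟩,
    fun X => mem_chiBar_of_isSamplingLaw X.isSamplingLaw_sampling, fun X ζ hX κ _ _ => ?_,
    fun ζ ζ' hζ κ κ' _ hκ hκ1 => ?_⟩
  · rw [← X.toQMM_obsDiam Y κ]
    exact QMMSpace.obsDiam_eq_of_sampling_eq ((hR ζ).trans (hX.symm.trans X.toQMM_sampling.symm)) κ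
  · exact QMMSpace.obsDiam_eq_of_sampling_eq ((hR ζ).trans hX.symm) κ
  · have hlim : Tendsto (fun n => (R (ζ n)).sampling) atTop (𝓝 (R ζ').sampling) := by
      simp only [hR]
      exact (continuous_subtype_val.tendsto ζ').comp hζ
    refine le_of_forall_lt fun c hc => ?_
    obtain ⟨c', hcc', hc'⟩ := exists_between hc
    exact hcc'.trans_le ((R ζ').obsDiam_le_of_frequently hlim hκ hκ1 (frequently_lt_of_lt_limsup
      (by isBoundedDefault) hc'))
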